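/- Let $S$ be a finite set with $|S|\ge 2$, and let $X_S$ be an $S$-marked curve: a smooth complex projective curve $X$ of genus zero with an embedding $S\sqcup\{\infty\}\hookrightarrow X$, whose image is the set of marked points; the punctured curve $X_S^\circ$ is the complement of the marked points. Fix an admissible coordinate, i.e. an isomorphism $z\colon X\to\mathbb{P}^1$ sending the marked point $\infty$ to $\infty$ and two marked points of $S$ to $0$ and $1$. The tangential base points are the vectors $\pm\partial_z$ at each marked point $s\in S$ and $\pm\partial_w$, $w=z^{-1}$, at $\infty$. A path from a tangential base point $\vec p$ (at the marked point $p$) to a tangential base point $\vec q$ (at the marked point $q$) is a smooth map $\gamma\colon[0,1]\to X$ with $\gamma(0)=p$, $\gamma'(0)=\vec p$, $\gamma(1)=q$, $\gamma'(1)=-\vec q$ and $\gamma(t)\in X_S^\circ$ for $0<t<1$; it is a closed loop at $\vec p$ if $\vec q=\vec p$. For a word $s_1\cdots s_n$ in the alphabet $S$, put $\alpha_i=\frac{1}{2\pi\mathrm{i}}\frac{dz}{z-z(s_i)}$. The regularized iterated integral $\int_\gamma s_1\cdots s_n\in\mathbb{C}$ is the regularized limit, as $\epsilon\to0^+$, of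 $$\int_{\epsilon\le t_n\le\cdots\le t_1\le 1-\epsilon}(\gamma^*\alpha_1)(t_1)\cdots(\gamma^*\alpha_n)(t_n),$$ that is, the constant term $c_0$ of its expansion $c_0+c_1\log\epsilon+\cdots+c_N(\log\epsilon)^N+o(1)$. It is extended $\mathbb{Z}$-linearly to the free $\mathbb{Z}$-module $\mathbb{Z}\langle S\rangle=\bigoplus_{n\ge0}\mathbb{Z}S^n$ on all words (the integral of the empty word being $1$). For $n\ge 0$, the module of periods of weight $n$ is the $\mathbb{Z}$-submodule $P_n(X_S)\subset\mathbb{C}$ spanned by all finite products $\prod_i\int_{\gamma_i}u_i$, where each $\gamma_i$ is a path between tangential base points, $u_i\in\mathbb{Z}S^{n_i}$ and $\sum_i n_i=n$. Then for every closed loop $\gamma$ at a tangential base point of $X_S$ and every word $s_1\cdots s_n$ in $S$ of length $n\ge1$, the regularized iterated integral along $\gamma$ exists and $$\int_\gamma s_1\cdots s_n\in P_{n-1}(X_S).$$ -/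

import Mathlib

open Set Filter Topology
open scoped Manifold ContDiff

noncomputable section

namespace GenusZero

/-! ### Genus-zero curves -/

/-- The affine coordinate on the Riemann sphere `ℂ ∪ {∞}`, with value `0` at `∞` by convention. -/
def affine : OnePoint ℂ → ℂ
  | none => 0
  | some a => a

/-- The point of the Riemann sphere at which the coordinate `w = 1 / z` takes the value `u`. -/
def ofInv (u : ℂ) : OnePoint ℂ :=
  if u = 0 then OnePoint.infty else ((u⁻¹ : ℂ) : OnePoint ℂ)

variable (X : Type*) [TopologicalSpace X] [ChartedSpace ℂ X]

/-- A biholomorphic map from the Riemann surface `X` onto the Riemann sphere `ℂ ∪ {∞}`.  The complex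
structure of the sphere is the one given by the coordinates `z` (off `∞`) and `w = 1 / z` (off `0`);
with the convention `0⁻¹ = 0`, the coordinate `w` takes the value `0` at `∞`. -/
structure SphereIso where
  /-- the underlying homeomorphism -/
  toHomeo : X ≃ₜ OnePoint ℂ
  /-- `z` is holomorphic away from `∞` -/
  holo_z : ∀ x, toHomeo x ≠ OnePoint.infty →
    ContMDiffAt 𝓘(ℂ, ℂ) 𝓘(ℂ, ℂ) ω (fun y => affine (toHomeo y)) x
  /-- `w = 1 / z` is holomorphic away from `0` -/
  holo_w : ∀ x, toHomeo x ≠ ((0 : ℂ) : OnePoint ℂ) →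
    ContMDiffAt 𝓘(ℂ, ℂ) 𝓘(ℂ, ℂ) ω (fun y => (affine (toHomeo y))⁻¹) x
  /-- the inverse is holomorphic in the coordinate `z` -/
  holo_symm_z : ContMDiff 𝓘(ℂ, ℂ) 𝓘(ℂ, ℂ) ω (fun u : ℂ => toHomeo.symm (u : OnePoint ℂ))
  /-- the inverse is holomorphic in the coordinate `w` -/
  holo_symm_w : ContMDiff 𝓘(ℂ, ℂ) 𝓘(ℂ, ℂ) ω (fun u : ℂ => toHomeo.symm (ofInv u))

/-- A marking of `X` by `S`: the surface `X` is a smooth projective curve of genus zero, that is,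
isomorphic to the Riemann sphere, with an embedding of `S ⊔ {∞}`; the extra label `∞` is `none`. -/
structure MarkedCurve (S : Type*) where
  /-- the marked points -/
  mark : Option S → X
  mark_injective : Function.Injective mark
  genus_zero : Nonempty (SphereIso X)

end GenusZero

namespace GenusZero

variable {X : Type*} [TopologicalSpace X] [ChartedSpace ℂ X] {S : Type*}

/-- An admissible coordinate: an isomorphism `z` of the curve with the Riemann sphere that sends
the marked point `∞` to `∞`, and two of the other marked points to `0` and `1`. -/
structure AdmissibleCoord (C : MarkedCurve X S) extends SphereIso X where
  map_infty : toHomeo (C.mark none) = OnePoint.infty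
  normalized : ∃ r q : S, toHomeo (C.mark (some r)) = ((0 : ℂ) : OnePoint ℂ) ∧
    toHomeo (C.mark (some q)) = ((1 : ℂ) : OnePoint ℂ)

namespace AdmissibleCoord

variable {C : MarkedCurve X S} (z : AdmissibleCoord C)

/-- The coordinate as a function on the curve (value `0` at the point at infinity). -/
def coord (x : X) : ℂ := affine (z.toHomeo x)

/-- The position in `ℂ` of a finite marked point. -/
def pos (s : S) : ℂ := z.coord (C.mark (some s))

/-- The local coordinate used at a marked point to define its tangential base points:
`z` at a finite marked point, `w = 1 / z` at infinity. -/
def localCoord : Option S → X → ℂ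
  | some _ => fun x => z.coord x
  | none => fun x => (z.coord x)⁻¹

end AdmissibleCoord

/-! ### Tangential base points and paths -/

/-- A tangential base point: a marked point with one of the two unit vectors `± ∂` for the local
coordinate there (`z` at finite marked points, `w = 1 / z` at infinity). -/
structure TangentialBasePoint (S : Type*) where
  /-- the label of the marked point -/
  point : Option S
  /-- the sign of the unit tangent vector -/
  sign : ℤˣ

/-- A smooth path `[0, 1] → X` from the tangential base point `p` to the tangential base point `q`:
its initial velocity is the vector `p`, its final velocity is minus the vector `q`, and it lies in
the punctured curve at all other times.  (Only the values on `[0, 1]` matter.) -/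
structure TangentialPath {C : MarkedCurve X S} (z : AdmissibleCoord C)
    (p q : TangentialBasePoint S) where
  /-- the underlying map -/
  toFun : ℝ → X
  smooth : ContMDiffOn 𝓘(ℝ, ℝ) 𝓘(ℝ, ℂ) ∞ toFun (Icc 0 1)
  source : toFun 0 = C.mark p.point
  target : toFun 1 = C.mark q.point
  velocity_source : HasDerivWithinAt (fun t => z.localCoord p.point (toFun t))
    (((p.sign : ℤ) : ℂ)) (Icc 0 1) 0
  velocity_target : HasDerivWithinAt (fun t => z.localCoord q.point (toFun t))
    (-((q.sign : ℤ) : ℂ)) (Icc 0 1) 1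
  mem_punctured : ∀ t ∈ Ioo (0 : ℝ) 1, toFun t ∉ range C.mark

/-! ### Regularized limits -/

/-- `f` has an expansion `f ε = c₀ + c₁ log ε + ⋯ + c_N (log ε) ^ N + o(1)` as `ε → 0⁺`,
with `c₀ = c`. -/
def HasRegLim (f : ℝ → ℂ) (c : ℂ) : Prop :=
  ∃ P : Polynomial ℂ, P.coeff 0 = c ∧
    Tendsto (fun ε : ℝ => f ε - P.eval ((Real.log ε : ℝ) : ℂ)) (𝓝[>] 0) (𝓝 0)

/-- The regularized limit is unique. -/
theorem HasRegLim.unique {f : ℝ → ℂ} {c d : ℂ} (hc : HasRegLim f c) (hd : HasRegLim f d) :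
    c = d := by
  obtain ⟨P, rfl, hP⟩ := hc
  obtain ⟨Q, rfl, hQ⟩ := hd
  have h : Tendsto (fun ε : ℝ => (P - Q).eval ((Real.log ε : ℝ) : ℂ)) (𝓝[>] 0) (𝓝 0) := by
    have := hQ.sub hP
    simp only [sub_zero] at this
    refine this.congr fun ε => ?_
    simp
  have hlog : Tendsto (fun ε : ℝ => ‖((Real.log ε : ℝ) : ℂ)‖) (𝓝[>] 0) atTop := by
    simp only [Complex.norm_real]
    exact tendsto_abs_atBot_atTop.comp Real.tendsto_log_nhdsGT_zero
  by_cases hdeg : 0 < (P - Q).degree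
  · exact absurd ((P - Q).tendsto_norm_atTop hdeg hlog)
      (not_tendsto_atTop_of_tendsto_nhds h.norm)
  · have hC := Polynomial.eq_C_of_degree_le_zero (not_lt.mp hdeg)
    rw [hC] at h
    simp only [Polynomial.eval_C, Polynomial.coeff_sub] at h
    exact sub_eq_zero.mp (tendsto_nhds_unique tendsto_const_nhds h)

open Classical in
/-- The regularized limit of `f` as `ε → 0⁺`, if it exists (`0` otherwise). -/
def regLim (f : ℝ → ℂ) : ℂ := if h : ∃ c, HasRegLim f c then h.choose else 0

/-! ### Regularized iterated integrals -/

/-- Iterated integral, along the restriction to `[a, t]` of the path `ζ` in the plane, of a word in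
the forms `dz / (2πi (z - pos s))`.  The first letter belongs to the outermost integration:
`∫_{a ≤ tₙ ≤ ⋯ ≤ t₁ ≤ t} α₁(t₁) ⋯ αₙ(tₙ)`. -/
def iterInt (pos : S → ℂ) (ζ : ℝ → ℂ) (a : ℝ) : List S → ℝ → ℂ
  | [], _ => 1
  | s :: v, t => ∫ τ in a..t,
      (1 / (2 * (Real.pi : ℂ) * Complex.I)) * (deriv ζ τ / (ζ τ - pos s)) * iterInt pos ζ a v τ

namespace TangentialPath

variable {C : MarkedCurve X S} {z : AdmissibleCoord C} {p q : TangentialBasePoint S}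

/-- The iterated integral of the word `v` along the truncated path `γ|_[ε, 1 - ε]`. -/
def truncInt (γ : TangentialPath z p q) (v : List S) (ε : ℝ) : ℂ :=
  iterInt z.pos (fun t => z.coord (γ.toFun t)) ε v (1 - ε)

/-- The regularized iterated integral of a word along a path between tangential base points. -/
def wordInt (γ : TangentialPath z p q) (v : List S) : ℂ := regLim (γ.truncInt v)

/-- The regularized iterated integral, as a `ℤ`-linear map on the free algebra `ℤ⟨S⟩`, the free
`ℤ`-module on the words in `S`. -/
def integral (γ : TangentialPath z p q) : (List S →₀ ℤ) →ₗ[ℤ] ℂ :=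
  Finsupp.linearCombination ℤ γ.wordInt

end TangentialPath

/-- The homogeneous part of `ℤ⟨S⟩` of weight `n`, spanned by the words of length `n`. -/
def wordsOfWeight (S : Type*) (n : ℕ) : Submodule ℤ (List S →₀ ℤ) :=
  Finsupp.supported ℤ ℤ {v : List S | v.length = n}

/-! ### Periods -/

/-- The periods of weight `n`: the `ℤ`-submodule of `ℂ` spanned by all finite products
`∏ i, ∫_{γ i} u i` of regularized iterated integrals along paths between tangential base points,
where `u i` is homogeneous of weight `d i` and `∑ i, d i = n`. -/
def periods {C : MarkedCurve X S} (z : AdmissibleCoord C) (n : ℕ) : Submodule ℤ ℂ :=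
  Submodule.span ℤ {x : ℂ | ∃ (k : ℕ) (d : Fin k → ℕ) (p q : Fin k → TangentialBasePoint S)
    (γ : ∀ i, TangentialPath z (p i) (q i)) (u : Fin k → (List S →₀ ℤ)),
    (∀ i, u i ∈ wordsOfWeight S (d i)) ∧ ∑ i, d i = n ∧ x = ∏ i, (γ i).integral (u i)}

end GenusZero

end

noncomputable section

namespace GenusZero
open scoped Matrix.Norms.Operator

/-! ### Linear differential equations in a Banach algebra -/

section Banach

variable {𝕜 : Type*} [RCLike 𝕜] {𝔸 : Type*} [NormedRing 𝔸] [NormedAlgebra 𝕜 𝔸] [CompleteSpace 𝔸]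

/-! For a word of length `n`, the iterated integrals of all its subwords fill a unipotent matrix of
size `n + 1` that solves `dY = ω Y`, where `ω` has the forms `dx / (2πi (x - a i))` just above the
diagonal. Near a point of the sphere with residue matrix `N` this equation has a solution `h(u)
exp(log(u/σ) N)` with `h` holomorphic and `h(0) = 1`, normalized by the tangent vector `σ`.
Comparing the normalized solutions at the two ends of a path gives a constant matrix `Φ`. Since `h =
1 + O(ε)` beats every power of `log ε`, the entries of `Φ` are exactly the regularized iterated
integrals (`IsTangentialCurve.hasRegLim`). So `Φ` has an entry of weight `j - i` in position `(i,
j)`.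

For a closed loop the weight drops by one because `Φ` is a product of conjugates of local
monodromies. Cut the plane along rays from the marked points, away from a generic base point. A flat
section `L` on this star-shaped domain changes, when continued across the cut of `s`, by a conjugate
of `exp(2πi N_s)` (`exists_flat_across_cut`). The conjugating matrices are transports inside the cut
plane, hence matrices of periods of the full weight `j - i`. The `(i, j)` entry of `exp(2πi N_s)`
above the diagonal is `1/(j - i)!` if all letters in between equal `s`, and `0` otherwise, because
the residue `1/(2πi)` cancels `2πi`. If `1/k!` lies in `P_{k-1}` for all `k ≥ 1`, these matrices lie
in the group `lowWeightGroup` of unipotent matrices whose `(i, j)` entry has weight `j - i - 1`,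
which is stable under conjugation by period matrices. No generators of the fundamental group are
needed: continuing `L` along any curve gives branches that differ by elements of the group
(`IsBranch.lift`), and a loop therefore has `Φ` in it (`exists_eq_of_hasTransport`).

Two arithmetic facts remain. First, `1` is in `P_1`: a half turn at a marked point, from one tangent
vector to its negative, gives the integral `±1/2` (`one_mem_periods_one`). This makes `P_m` increase
with `m`, which is needed for `lowWeightGroup` to be closed under products. Second, `1/m!` is in
`P_{m-1}`, by strong induction on `m`. For the word with one letter at `1` followed by `m - 1`
letters at `0`, local monodromies at finite points involve only `1/k!` with `k < m` (for `m > 1`),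
while at infinity all residues are equal, so the monodromy `exp(-2πi N_∞)` has corner entry `1/m!`.
A large circle expresses the latter through the former and periods (`exists_eq_of_circle`,
`inv_factorial_mem_of_word`). -/

theorem hasDerivAt_ringInverse {X : 𝕜 → 𝔸} {X' : 𝔸} {t : 𝕜} (h : HasDerivAt X X' t)
    (hu : IsUnit (X t)) :
    HasDerivAt (fun τ => Ring.inverse (X τ))
      (-(Ring.inverse (X t) * X' * Ring.inverse (X t))) t := by
  obtain ⟨u, hu⟩ := hu
  have h1 := hasFDerivAt_ringInverse (𝕜 := 𝕜) u
  rw [hu] at h1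
  have h2 := h1.comp_hasDerivAt t h
  rw [← hu, Ring.inverse_unit]
  convert! h2 using 1

/-- Two solutions of the same linear differential equation differ by a constant factor. -/
theorem exists_eq_mul_of_flat {s : Set 𝕜} (hs : IsOpen s) (hs' : IsPreconnected s)
    {B X Y : 𝕜 → 𝔸} (hX : ∀ t ∈ s, HasDerivAt X (B t * X t) t)
    (hY : ∀ t ∈ s, HasDerivAt Y (B t * Y t) t) (hu : ∀ t ∈ s, IsUnit (X t)) :
    ∃ c, ∀ t ∈ s, Y t = X t * c := by
  have hd : ∀ t ∈ s, HasDerivAt (fun τ => Ring.inverse (X τ) * Y τ) 0 t := by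
    intro t ht
    have := (hasDerivAt_ringInverse (hX t ht) (hu t ht)).mul (hY t ht)
    convert! this using 1
    have h1 : X t * Ring.inverse (X t) = 1 := Ring.mul_inverse_cancel _ (hu t ht)
    calc (0 : 𝔸) = -(Ring.inverse (X t) * B t * (X t * Ring.inverse (X t)) * Y t)
        + Ring.inverse (X t) * (B t * Y t) := by rw [h1]; noncomm_ring
      _ = _ := by noncomm_ring
  obtain ⟨c, hc⟩ := hs.exists_is_const_of_deriv_eq_zero hs'
    (fun t ht => (hd t ht).differentiableAt.differentiableWithinAt) (fun t ht => (hd t ht).deriv)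
  refine ⟨c, fun t ht => ?_⟩
  rw [← hc t ht, Ring.mul_inverse_cancel_left _ _ (hu t ht)]

end Banach

/-! ### Primitives on star-shaped domains -/

/-- The primitive is the integral along the segment from `b`, namely `∫ (x - b) f(b + t(x - b)) dt`
over `[0, 1]`. Differentiating under the integral sign produces the total `t`-derivative of `t f(b +
t(x - b))`, which integrates to `f x`. -/
theorem exists_primitive_of_starConvex {E : Type*} [NormedAddCommGroup E] [NormedSpace ℂ E]
    [CompleteSpace E] {U : Set ℂ} (hU : IsOpen U) {b : ℂ} (hb : StarConvex ℝ b U)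
    {f : ℂ → E} (hf : DifferentiableOn ℂ f U) :
    ∃ F : ℂ → E, F b = 0 ∧ ∀ x ∈ U, HasDerivAt F (f x) x := by
  set p : ℂ → ℝ → ℂ := fun x t => b + t * (x - b) with hp
  have hpU : ∀ x ∈ U, ∀ t ∈ Icc (0 : ℝ) 1, p x t ∈ U := by
    intro x hx t ht
    have := hb.add_smul_sub_mem hx ht.1 ht.2
    simpa [hp] using this
  have hf' : DifferentiableOn ℂ (deriv f) U := hf.deriv hU
  have hpc : Continuous (fun q : ℂ × ℝ => p q.1 q.2) := by simp only [hp]; fun_prop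
  have hpx : ∀ x, Continuous (p x) := fun x => hpc.comp (Continuous.prodMk_right x)
  refine ⟨fun x => ∫ t in (0 : ℝ)..1, (x - b) • f (p x t), by simp, fun x₀ hx₀ => ?_⟩
  have hcF : ∀ x ∈ U, ContinuousOn (fun t : ℝ => (x - b) • f (p x t)) (uIcc 0 1) := by
    intro x hx
    rw [uIcc_of_le zero_le_one]
    exact continuousOn_const.smul (hf.continuousOn.comp (hpx x).continuousOn (hpU x hx))
  set F' : ℂ → ℝ → E := fun x t => f (p x t) + (t : ℂ) • (x - b) • deriv f (p x t) with hF'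
  have hder : ∀ x ∈ U, ∀ t ∈ Icc (0 : ℝ) 1,
      HasDerivAt (fun x => (x - b) • f (p x t)) (F' x t) x := by
    intro x hx t ht
    have h1 : HasDerivAt f (deriv f (p x t)) (p x t) :=
      (hf.differentiableAt (hU.mem_nhds (hpU x hx t ht))).hasDerivAt
    have h2 : HasDerivAt (fun x => p x t) (t : ℂ) x := by
      simpa [hp] using (((hasDerivAt_id x).sub_const b).const_mul (t : ℂ)).const_add b
    have h3 := ((hasDerivAt_id x).sub_const b).smul (h1.scomp x h2)
    convert! h3 using 1
    simp only [hF', one_smul, id, Function.comp]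
    rw [smul_comm, add_comm]
  have hcF' : ContinuousOn (fun q : ℂ × ℝ => F' q.1 q.2) (U ×ˢ Icc (0 : ℝ) 1) := by
    have hmaps : MapsTo (fun q : ℂ × ℝ => p q.1 q.2) (U ×ˢ Icc (0 : ℝ) 1) U :=
      fun q hq => hpU q.1 hq.1 q.2 hq.2
    have h1 := hf.continuousOn.comp hpc.continuousOn hmaps
    have h2 := hf'.continuousOn.comp hpc.continuousOn hmaps
    simp only [hF']
    refine h1.add (ContinuousOn.smul (by fun_prop) (ContinuousOn.smul (by fun_prop) h2))
  obtain ⟨r, hr, hrU⟩ := Metric.isOpen_iff.1 hU x₀ hx₀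
  have hsub : Metric.closedBall x₀ (r / 2) ⊆ U :=
    (Metric.closedBall_subset_ball (by linarith)).trans hrU
  obtain ⟨C, hC⟩ := (((isCompact_closedBall x₀ (r / 2)).prod
    (isCompact_Icc (a := (0 : ℝ)) (b := 1)))).exists_bound_of_continuousOn
    (hcF'.mono (prod_mono hsub Subset.rfl))
  have hF'x : ContinuousOn (F' x₀) (uIcc 0 1) := by
    rw [uIcc_of_le zero_le_one]
    exact hcF'.comp (Continuous.prodMk_right x₀).continuousOn (fun t ht => ⟨hx₀, ht⟩)
  have hmem : ∀ t ∈ uIoc (0 : ℝ) 1, t ∈ Icc (0 : ℝ) 1 := by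
    intro t ht
    rw [uIoc_of_le zero_le_one] at ht
    exact ⟨ht.1.le, ht.2⟩
  have key := (intervalIntegral.hasDerivAt_integral_of_dominated_loc_of_deriv_le
    (F := fun x t => (x - b) • f (p x t)) (F' := F') (x₀ := x₀) (a := 0) (b := 1)
    (s := Metric.ball x₀ (r / 2)) (bound := fun _ => C) (μ := MeasureTheory.volume)
    (Metric.ball_mem_nhds _ (by positivity))
    (by
      filter_upwards [hU.mem_nhds hx₀] with x hx
      exact (hcF x hx).intervalIntegrable.def'.aestronglyMeasurable)
    (hcF x₀ hx₀).intervalIntegrable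
    hF'x.intervalIntegrable.def'.aestronglyMeasurable
    (Eventually.of_forall fun t ht x hx =>
      hC (x, t) ⟨Metric.ball_subset_closedBall hx, hmem t ht⟩)
    intervalIntegrable_const
    (Eventually.of_forall fun t ht x hx =>
      hder x (hsub (Metric.ball_subset_closedBall hx)) t (hmem t ht))).2
  convert! key using 1
  have hprim : ∀ t ∈ uIcc (0 : ℝ) 1, HasDerivAt (fun t : ℝ => (t : ℂ) • f (p x₀ t)) (F' x₀ t) t := by
    intro t ht
    rw [uIcc_of_le zero_le_one] at ht
    have h1 : HasDerivAt f (deriv f (p x₀ t)) (p x₀ t) :=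
      (hf.differentiableAt (hU.mem_nhds (hpU x₀ hx₀ t ht))).hasDerivAt
    have h2 : HasDerivAt (fun t : ℝ => p x₀ t) (x₀ - b) t := by
      simpa [hp] using ((Complex.ofRealCLM.hasDerivAt (x := t)).mul_const (x₀ - b)).const_add b
    have h3 := (Complex.ofRealCLM.hasDerivAt (x := t)).smul (h1.scomp t h2)
    convert! h3 using 1
    simp [hF', add_comm]
  rw [intervalIntegral.integral_eq_sub_of_hasDerivAt hprim hF'x.intervalIntegrable]
  simp [hp]

end GenusZero

namespace GenusZero
open scoped Matrix.Norms.Operator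

/-! ### Triangular matrices -/

/-- Square complex matrices with rows and columns indexed by `0, …, n`. -/
abbrev Mat (n : ℕ) := Matrix (Fin (n + 1)) (Fin (n + 1)) ℂ

/-- The matrices that vanish below the `d`-th superdiagonal. -/
def filt (n d : ℕ) : Submodule ℂ (Mat n) where
  carrier := {M | ∀ i j : Fin (n + 1), (j : ℕ) < i + d → M i j = 0}
  add_mem' := fun ha hb i j h => by simp [ha i j h, hb i j h]
  zero_mem' := fun i j _ => rfl
  smul_mem' := fun c M hM i j h => by simp [hM i j h]

variable {n : ℕ}

theorem filt_anti {d e : ℕ} (h : d ≤ e) : filt n e ≤ filt n d :=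
  fun _ hM i j hij => hM i j (by omega)

theorem one_mem_filt : (1 : Mat n) ∈ filt n 0 := fun i j h =>
  Matrix.one_apply_ne (fun e => by subst e; omega)

theorem mul_mem_filt {d e : ℕ} {M M' : Mat n} (hM : M ∈ filt n d) (hM' : M' ∈ filt n e) :
    M * M' ∈ filt n (d + e) := by
  intro i j h
  rw [Matrix.mul_apply]
  refine Finset.sum_eq_zero fun k _ => ?_
  by_cases hk : (k : ℕ) < i + d
  · rw [hM i k hk, zero_mul]
  · rw [hM' k j (by omega), mul_zero]

theorem mul_mem_filt_succ {d : ℕ} {M M' : Mat n} (hM : M ∈ filt n 1) (hM' : M' ∈ filt n d) :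
    M * M' ∈ filt n (d + 1) := fun i j h => mul_mem_filt hM hM' i j (by omega)

theorem pow_mem_filt {M : Mat n} (hM : M ∈ filt n 1) (k : ℕ) : M ^ k ∈ filt n k := by
  induction k with
  | zero => simpa using one_mem_filt
  | succ k ih => rw [pow_succ]; exact mul_mem_filt ih hM

theorem eq_zero_of_mem_filt {d : ℕ} (hd : n < d) {M : Mat n} (hM : M ∈ filt n d) : M = 0 := by
  ext i j
  exact hM i j (by omega)

theorem isNilpotent_of_mem_filt {M : Mat n} (hM : M ∈ filt n 1) : IsNilpotent M :=
  ⟨n + 1, eq_zero_of_mem_filt (Nat.lt_succ_self n) (pow_mem_filt hM _)⟩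

theorem isUnit_of_sub_one_mem {M : Mat n} (hM : M - 1 ∈ filt n 1) : IsUnit M := by
  have := (isNilpotent_of_mem_filt hM).isUnit_one_add
  simpa using this

theorem sub_one_mem_mul {M M' : Mat n} (hM : M - 1 ∈ filt n 1) (hM' : M' - 1 ∈ filt n 1) :
    M * M' - 1 ∈ filt n 1 := by
  have h : M * M' - 1 = (M - 1) * (M' - 1) + (M - 1) + (M' - 1) := by noncomm_ring
  rw [h]
  exact add_mem (add_mem (filt_anti (by norm_num) (mul_mem_filt hM hM')) hM) hM'

theorem inverse_eq_sum {x : Mat n} (hx : x ∈ filt n 1) :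
    Ring.inverse (1 + x) = ∑ k ∈ Finset.range (n + 1), (-x) ^ k := by
  have h1 : (1 + x) * ∑ k ∈ Finset.range (n + 1), (-x) ^ k = 1 := by
    have := mul_neg_geom_sum (-x) (n + 1)
    rwa [eq_zero_of_mem_filt (Nat.lt_succ_self n) (pow_mem_filt (neg_mem hx) _), sub_zero,
      sub_neg_eq_add] at this
  have hu : IsUnit (1 + x) := isUnit_of_sub_one_mem (by simpa using hx)
  rw [← Ring.inverse_mul_cancel_left _ (∑ k ∈ Finset.range (n + 1), (-x) ^ k) hu, h1, mul_one]

theorem sub_one_mem_inverse {M : Mat n} (hM : M - 1 ∈ filt n 1) :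
    Ring.inverse M - 1 ∈ filt n 1 := by
  have h := inverse_eq_sum hM
  rw [add_sub_cancel] at h
  rw [h, Finset.sum_range_succ']
  simp only [pow_zero, add_sub_cancel_right]
  exact sum_mem fun k _ => filt_anti (by omega) (pow_mem_filt (neg_mem hM) (k + 1))

/-! ### Superdiagonal matrices and their exponentials -/

/-- The matrix with entries `g 0, g 1, …` just above the diagonal and `0` elsewhere. -/
def superdiag (n : ℕ) (g : ℕ → ℂ) : Mat n :=
  Matrix.of fun i j => if (i : ℕ) + 1 = j then g i else 0

theorem superdiag_apply (g : ℕ → ℂ) (i j : Fin (n + 1)) :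
    superdiag n g i j = if (i : ℕ) + 1 = j then g i else 0 := rfl

theorem superdiag_mem (g : ℕ → ℂ) : superdiag n g ∈ filt n 1 := fun i j h => by
  rw [superdiag_apply, if_neg (by omega)]

theorem superdiag_add (g g' : ℕ → ℂ) :
    superdiag n (fun i => g i + g' i) = superdiag n g + superdiag n g' := by
  ext i j
  simp only [superdiag_apply, Matrix.add_apply]
  split_ifs <;> simp

theorem superdiag_smul (c : ℂ) (g : ℕ → ℂ) :
    superdiag n (fun i => c * g i) = c • superdiag n g := by
  ext i j
  simp only [superdiag_apply, Matrix.smul_apply, smul_eq_mul]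
  split_ifs <;> simp

theorem superdiag_congr {g g' : ℕ → ℂ} (h : ∀ i < n, g i = g' i) :
    superdiag n g = superdiag n g' := by
  ext i j
  simp only [superdiag_apply]
  split_ifs with hij
  · exact h i (by omega)
  · rfl

theorem superdiag_mul_apply (g : ℕ → ℂ) (M : Mat n) (i j : Fin (n + 1)) (hi : (i : ℕ) < n) :
    (superdiag n g * M) i j = g i * M ⟨i + 1, by omega⟩ j := by
  rw [Matrix.mul_apply, Finset.sum_eq_single ⟨i + 1, by omega⟩]
  · simp [superdiag_apply]
  · intro k _ hk
    rw [superdiag_apply, if_neg (fun h => hk (Fin.ext h.symm)), zero_mul]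
  · simp

theorem superdiag_mul_last (g : ℕ → ℂ) (M : Mat n) (i j : Fin (n + 1)) (hi : ¬ (i : ℕ) < n) :
    (superdiag n g * M) i j = 0 := by
  rw [Matrix.mul_apply]
  refine Finset.sum_eq_zero fun k _ => ?_
  rw [superdiag_apply, if_neg (by omega), zero_mul]

theorem superdiag_pow_apply (g : ℕ → ℂ) (k : ℕ) (i j : Fin (n + 1)) :
    (superdiag n g ^ k) i j = if (i : ℕ) + k = j then ∏ l ∈ Finset.Ico (i : ℕ) j, g l else 0 := by
  induction k generalizing i with
  | zero =>
    rw [pow_zero, Matrix.one_apply]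
    by_cases h : i = j
    · subst h; simp
    · rw [if_neg h, if_neg (fun h' => h (Fin.ext (by simpa using h')))]
  | succ k ih =>
    rw [pow_succ']
    by_cases hi : (i : ℕ) < n
    · rw [superdiag_mul_apply _ _ _ _ hi, ih]
      by_cases h : (i : ℕ) + (k + 1) = j
      · rw [if_pos h, if_pos (by simp; omega),
          Finset.prod_eq_prod_Ico_succ_bot (a := (i : ℕ)) (by omega)]
      · rw [if_neg h, if_neg (by simp; omega), mul_zero]
    · rw [superdiag_mul_last _ _ _ _ hi, if_neg (by omega)]

theorem exp_eq_sum_of_mem_filt {N : Mat n} (hN : N ∈ filt n 1) :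
    NormedSpace.exp N = ∑ k ∈ Finset.range (n + 1), ((k.factorial : ℂ)⁻¹) • N ^ k := by
  rw [NormedSpace.exp_eq_tsum ℂ]
  refine tsum_eq_sum fun k hk => ?_
  rw [eq_zero_of_mem_filt (d := k) (by simpa using hk) (pow_mem_filt hN k), smul_zero]

theorem exp_sub_one_mem {N : Mat n} (hN : N ∈ filt n 1) : NormedSpace.exp N - 1 ∈ filt n 1 := by
  rw [exp_eq_sum_of_mem_filt hN, Finset.sum_range_succ']
  simp only [Nat.factorial_zero, Nat.cast_one, inv_one, pow_zero, one_smul, add_sub_cancel_right]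
  exact sum_mem fun k _ => Submodule.smul_mem _ _ (filt_anti (by omega) (pow_mem_filt hN (k + 1)))

/-- Only the power `j - i` of a superdiagonal matrix reaches the position `(i, j)`. This is where
inverse factorials enter. -/
theorem exp_superdiag_apply (g : ℕ → ℂ) (i j : Fin (n + 1)) (hij : i ≤ j) :
    NormedSpace.exp (superdiag n g) i j
      = (((j - i : ℕ).factorial : ℂ)⁻¹) * ∏ l ∈ Finset.Ico (i : ℕ) j, g l := by
  rw [exp_eq_sum_of_mem_filt (superdiag_mem g), Matrix.sum_apply,
    Finset.sum_eq_single ((j : ℕ) - i)]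
  · rw [Matrix.smul_apply, superdiag_pow_apply, if_pos (by omega), smul_eq_mul]
  · intro k _ hk
    rw [Matrix.smul_apply, superdiag_pow_apply, if_neg (by omega), smul_zero]
  · intro h
    exact absurd (Finset.mem_range.2 (by omega)) h

/-- The entry in row `i` and column `j`, as a continuous linear functional. -/
def entryCLM (i j : Fin (n + 1)) : Mat n →L[ℂ] ℂ :=
  LinearMap.toContinuousLinearMap (Matrix.entryLinearMap ℂ ℂ i j)

theorem hasDerivAt_entry {Y : ℂ → Mat n} {Y' : Mat n} {x : ℂ} (h : HasDerivAt Y Y' x)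
    (i j : Fin (n + 1)) : HasDerivAt (fun x => Y x i j) (Y' i j) x :=
  (entryCLM i j).hasFDerivAt.comp_hasDerivAt x h

/-- A strictly triangular linear differential equation has a unipotent solution on a star-shaped
domain. -/
theorem exists_unipotent_solution {U : Set ℂ} (hU : IsOpen U) {b : ℂ} (hb : StarConvex ℝ b U)
    (hbU : b ∈ U) (rhs : (ℂ → Mat n) → ℂ → Mat n)
    (hadd : ∀ Y Z, DifferentiableOn ℂ Y U → DifferentiableOn ℂ Z U →
      ∀ x ∈ U, rhs (Y + Z) x = rhs Y x + rhs Z x)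
    (hdiff : ∀ Y, DifferentiableOn ℂ Y U → DifferentiableOn ℂ (rhs Y) U)
    (hfilt : ∀ d Y, DifferentiableOn ℂ Y U → (∀ x ∈ U, Y x ∈ filt n d) → ∀ x ∈ U, rhs Y x ∈ filt n (d + 1)) :
    ∃ Y : ℂ → Mat n, Y b = 1 ∧ (∀ x ∈ U, Y x - 1 ∈ filt n 1) ∧
      ∀ x ∈ U, HasDerivAt Y (rhs Y x) x := by
  have hpre : IsPreconnected U := (hb.isPathConnected hbU).isConnected.isPreconnected
  -- Picard iteration with error term `R`: adding a primitive of `R` cancels the error and leaves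
  -- the new error `rhs Z`, one superdiagonal higher. After `n` rounds the error vanishes, so no
  -- convergence is involved. The right-hand side is an operator on functions, not a matrix, because
  -- the normal form below needs a difference quotient at `0`.
  have key : ∀ m : ℕ, ∃ Y R : ℂ → Mat n, Y b = 1 ∧ (∀ x ∈ U, Y x - 1 ∈ filt n 1) ∧
      DifferentiableOn ℂ R U ∧ (∀ x ∈ U, R x ∈ filt n (m + 1)) ∧
      ∀ x ∈ U, HasDerivAt Y (rhs Y x - R x) x := by
    intro m
    induction m with
    | zero =>
      refine ⟨fun _ => 1, rhs (fun _ => 1), rfl, fun x _ => by simp,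
        hdiff _ (differentiableOn_const 1), hfilt 0 _ (differentiableOn_const 1) fun x _ => one_mem_filt,
        fun x _ => ?_⟩
      rw [sub_self]
      exact hasDerivAt_const x (1 : Mat n)
    | succ m ih =>
      obtain ⟨Y, R, h1, h2, h3, h4, h5⟩ := ih
      obtain ⟨Z, hZb, hZ⟩ := exists_primitive_of_starConvex hU hb h3
      have hZf : ∀ x ∈ U, Z x ∈ filt n (m + 1) := by
        intro x hx i j hij
        have hd : ∀ y ∈ U, HasDerivAt (fun y => Z y i j) 0 y := by
          intro y hy
          have := hasDerivAt_entry (hZ y hy) i j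
          rwa [h4 y hy i j hij] at this
        have := hU.is_const_of_deriv_eq_zero hpre
          (fun y hy => (hd y hy).differentiableAt.differentiableWithinAt)
          (fun y hy => (hd y hy).deriv) hx hbU
        rw [this, hZb]; rfl
      have hYd : DifferentiableOn ℂ Y U := fun x hx =>
        (h5 x hx).differentiableAt.differentiableWithinAt
      have hZd : DifferentiableOn ℂ Z U := fun x hx =>
        (hZ x hx).differentiableAt.differentiableWithinAt
      refine ⟨Y + Z, rhs Z, by simp [h1, hZb], fun x hx => ?_, hdiff _ hZd, hfilt _ _ hZd hZf,
        fun x hx => ?_⟩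
      · have : (Y + Z) x - 1 = (Y x - 1) + Z x := by simp only [Pi.add_apply]; abel
        rw [this]
        exact add_mem (h2 x hx) (filt_anti (by omega) (hZf x hx))
      · have := (h5 x hx).add (hZ x hx)
        convert! this using 1
        rw [hadd Y Z hYd hZd x hx]; simp
  obtain ⟨Y, R, h1, h2, -, h4, h5⟩ := key n
  refine ⟨Y, h1, h2, fun x hx => ?_⟩
  have := h5 x hx
  rwa [eq_zero_of_mem_filt (Nat.lt_succ_self n) (h4 x hx), sub_zero] at this

end GenusZero

namespace GenusZero
open scoped Matrix.Norms.Operator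

/-! ### The connection and its flat sections -/

/-- The constant `1 / (2πi)`. -/
def invTwoPiI : ℂ := 1 / (2 * (Real.pi : ℂ) * Complex.I)

theorem two_pi_I_ne_zero : 2 * (Real.pi : ℂ) * Complex.I ≠ 0 := Complex.two_pi_I_ne_zero

theorem mul_invTwoPiI : (2 * (Real.pi : ℂ) * Complex.I) * invTwoPiI = 1 := by
  rw [invTwoPiI, mul_one_div_cancel two_pi_I_ne_zero]

variable {n : ℕ} {a : ℕ → ℂ}

/-- The matrix of the connection whose flat sections are the iterated integrals of the forms
`dx / (2πi (x - a i))`. -/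
def conn (n : ℕ) (a : ℕ → ℂ) (x : ℂ) : Mat n := superdiag n fun i => invTwoPiI / (x - a i)

theorem differentiableOn_superdiag {g : ℂ → ℕ → ℂ} {U : Set ℂ}
    (h : ∀ i < n, DifferentiableOn ℂ (fun x => g x i) U) :
    DifferentiableOn ℂ (fun x => superdiag n (g x)) U := by
  have hpi : DifferentiableOn ℂ (fun x => ∑ i : Fin n, g x i •
      superdiag n (fun l => if l = i then 1 else 0)) U := by
    refine DifferentiableOn.fun_sum fun i _ => ?_
    exact DifferentiableOn.smul (h i i.2) (differentiableOn_const _)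
  convert! hpi using 2 with x
  ext i j
  rw [Matrix.sum_apply]
  simp only [Matrix.smul_apply, superdiag_apply, smul_eq_mul]
  split_ifs with hij
  · rw [Finset.sum_eq_single ⟨(i : ℕ), by omega⟩]
    · simp
    · intro k _ hk
      rw [if_neg (fun e => hk (Fin.ext e.symm)), mul_zero]
    · simp
  · simp

/-- A flat unipotent section of the connection exists on every star-shaped domain. -/
theorem exists_flat_of_starConvex {U : Set ℂ} (hU : IsOpen U) {b : ℂ} (hb : StarConvex ℝ b U)
    (hbU : b ∈ U) (ha : ∀ x ∈ U, ∀ i < n, x ≠ a i) :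
    ∃ L : ℂ → Mat n, L b = 1 ∧ (∀ x ∈ U, L x - 1 ∈ filt n 1) ∧
      ∀ x ∈ U, HasDerivAt L (conn n a x * L x) x := by
  refine exists_unipotent_solution hU hb hbU (fun Y x => conn n a x * Y x)
    (fun Y Z _ _ x _ => ?_) (fun Y hY => ?_) (fun d Y _ hY x hx => ?_)
  · simp [mul_add]
  · refine DifferentiableOn.mul (differentiableOn_superdiag fun i hi => ?_) hY
    refine DifferentiableOn.div (differentiableOn_const _)
      (differentiableOn_id.sub (differentiableOn_const _)) fun x hx => ?_
    exact sub_ne_zero.2 (ha x hx i hi)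
  · exact mul_mem_filt_succ (superdiag_mem _) (hY x hx)

/-! ### Local normal form at a singular point

A point of the Riemann sphere is an element of `Option ℂ`, where `none` stands for `∞`. -/

/-- The local coordinate at a point of the sphere: `x - c` at `c`, and `1 / x` at infinity. -/
def loc : Option ℂ → ℂ → ℂ
  | some c => fun x => x - c
  | none => fun x => x⁻¹

/-- The derivative of the local coordinate. -/
def locDeriv : Option ℂ → ℂ → ℂ
  | some _ => fun _ => 1
  | none => fun x => -(x ^ 2)⁻¹

/-- The inverse of the local coordinate. -/
def chart : Option ℂ → ℂ → ℂ
  | some c => fun u => c + u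
  | none => fun u => u⁻¹

theorem loc_chart (c : Option ℂ) (u : ℂ) : loc c (chart c u) = u := by
  cases c <;> simp [loc, chart]

theorem chart_loc (c : Option ℂ) (x : ℂ) : chart c (loc c x) = x := by
  cases c <;> simp [loc, chart]

theorem hasDerivAt_loc (c : Option ℂ) {x : ℂ} (hx : loc c x ≠ 0) :
    HasDerivAt (loc c) (locDeriv c x) x := by
  cases c with
  | some c => exact (hasDerivAt_id x).sub_const c
  | none => exact hasDerivAt_inv (fun h => hx (by simp [loc, h]))

/-- The residues of the connection at a point of the sphere. -/
def localExp (a : ℕ → ℂ) : Option ℂ → ℕ → ℂ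
  | some c => fun i => if a i = c then invTwoPiI else 0
  | none => fun _ => -invTwoPiI

/-- The holomorphic part of the connection form in the local coordinate. -/
def regPart (a : ℕ → ℂ) : Option ℂ → ℕ → ℂ → ℂ
  | some c => fun i u => if a i = c then 0 else invTwoPiI / (u - (a i - c))
  | none => fun i u => -(invTwoPiI * a i) / (1 - a i * u)

/-- The residue matrix of the connection at a point of the sphere. -/
def resMat (n : ℕ) (a : ℕ → ℂ) (c : Option ℂ) : Mat n := superdiag n (localExp a c)

/-- This splits each form into its polar and its holomorphic part. At infinity, with `u = 1/x`, one
has `dx/(x - a) = -du/u - a du/(1 - a u)`, so every letter has the same residue there, whatever its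
position. -/
theorem exists_regular_radius (n : ℕ) (a : ℕ → ℂ) (c : Option ℂ) :
    ∃ r > 0, ∀ i < n, DifferentiableOn ℂ (regPart a c i) (Metric.ball 0 r) ∧
      ∀ x, loc c x ∈ Metric.ball 0 r → loc c x ≠ 0 → x ≠ a i ∧
        locDeriv c x * (localExp a c i / loc c x + regPart a c i (loc c x))
          = invTwoPiI / (x - a i) := by
  cases c with
  | some c =>
    have h : ∀ᶠ u in 𝓝 (0 : ℂ), ∀ i ∈ Finset.range n, a i ≠ c → u - (a i - c) ≠ 0 := by
      rw [Filter.eventually_all_finset]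
      intro i _
      by_cases hi : a i = c
      · exact Eventually.of_forall fun u h => absurd hi h
      · have hc : ContinuousAt (fun u : ℂ => u - (a i - c)) 0 := by fun_prop
        filter_upwards [hc.eventually_ne (y := 0) (by
          rw [zero_sub]; exact neg_ne_zero.2 (sub_ne_zero.2 hi))] with u hu _ using hu
    obtain ⟨r, hr, hball⟩ := Metric.eventually_nhds_iff_ball.1 h
    refine ⟨r, hr, fun i hi => ⟨?_, fun x hx hx0 => ?_⟩⟩
    · by_cases hai : a i = c
      · simp only [regPart, if_pos hai]; exact differentiableOn_const _
      · simp only [regPart, if_neg hai]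
        exact DifferentiableOn.div (differentiableOn_const _)
          (differentiableOn_id.sub (differentiableOn_const _))
          fun u hu => hball u hu i (Finset.mem_range.2 hi) hai
    · simp only [loc] at hx hx0
      simp only [locDeriv, localExp, regPart, loc, one_mul]
      by_cases hai : a i = c
      · subst hai
        exact ⟨sub_ne_zero.1 hx0, by simp⟩
      · have h1 := hball _ hx i (Finset.mem_range.2 hi) hai
        rw [sub_sub_sub_cancel_right] at h1
        rw [if_neg hai, if_neg hai]
        exact ⟨sub_ne_zero.1 h1, by simp⟩
  | none =>
    have h : ∀ᶠ u in 𝓝 (0 : ℂ), ∀ i ∈ Finset.range n, 1 - a i * u ≠ 0 := by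
      rw [Filter.eventually_all_finset]
      intro i _
      have hc : ContinuousAt (fun u : ℂ => 1 - a i * u) 0 := by fun_prop
      exact hc.eventually_ne (y := 0) (by simp)
    obtain ⟨r, hr, hball⟩ := Metric.eventually_nhds_iff_ball.1 h
    refine ⟨r, hr, fun i hi => ⟨?_, fun x hx hx0 => ?_⟩⟩
    · simp only [regPart]
      exact DifferentiableOn.div (differentiableOn_const _) (by fun_prop)
        fun u hu => hball u hu i (Finset.mem_range.2 hi)
    · simp only [loc] at hx hx0
      have hx1 : x ≠ 0 := fun h => hx0 (by simp [h])
      have h1 := hball _ hx i (Finset.mem_range.2 hi)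
      have h2 : x - a i ≠ 0 := fun h => h1 (by
        rw [← sub_eq_zero.1 h, mul_inv_cancel₀ hx1, sub_self])
      refine ⟨sub_ne_zero.1 h2, ?_⟩
      simp only [locDeriv, localExp, regPart, loc]
      have h3 : 1 - a i * x⁻¹ = (x - a i) / x := by field_simp
      rw [h3]
      field_simp
      ring

/-- Gauge transformation to the normal form `N / u` near a point of the sphere. -/
theorem exists_normalForm (n : ℕ) (a : ℕ → ℂ) (c : Option ℂ) :
    ∃ (r : ℝ) (h : ℂ → Mat n), 0 < r ∧ h 0 = 1 ∧
      (∀ u ∈ Metric.ball 0 r, h u - 1 ∈ filt n 1) ∧ DifferentiableOn ℂ h (Metric.ball 0 r) ∧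
      (∀ x, loc c x ∈ Metric.ball 0 r → loc c x ≠ 0 → ∀ i < n, x ≠ a i) ∧
      ∀ x, loc c x ∈ Metric.ball 0 r → loc c x ≠ 0 → HasDerivAt (fun x => h (loc c x))
        (conn n a x * h (loc c x) - (locDeriv c x / loc c x) • (h (loc c x) * resMat n a c)) x := by
  obtain ⟨r, hr, hreg⟩ := exists_regular_radius n a c
  set N := resMat n a c with hN
  have hNf : N ∈ filt n 1 := superdiag_mem _
  set k : ℂ → Mat n := fun u => superdiag n (fun i => regPart a c i u) with hk
  have hball0 : (0 : ℂ) ∈ Metric.ball (0 : ℂ) r := Metric.mem_ball_self hr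
  have hcomm : ∀ Y : ℂ → Mat n, DifferentiableOn ℂ Y (Metric.ball 0 r) →
      DifferentiableOn ℂ (fun u => N * Y u - Y u * N) (Metric.ball 0 r) := fun Y hY =>
    ((differentiableOn_const _).mul hY).sub (hY.mul (differentiableOn_const _))
  -- The gauge equation is `h' = k h + (N h - h N)/u`. The singular quotient is replaced by `dslope`
  -- at `0`, which preserves holomorphy; the two agree for the solution, since `h 0 = 1` commutes
  -- with `N`.
  obtain ⟨h, h0, h1, h2⟩ := exists_unipotent_solution (n := n) (U := Metric.ball (0 : ℂ) r) (b := 0)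
    Metric.isOpen_ball ((convex_ball 0 r).starConvex hball0) hball0
    (fun Y u => k u * Y u + dslope (fun u => N * Y u - Y u * N) 0 u)
    (fun Y Z hY hZ u hu => by
      have e : (fun u => N * (Y + Z) u - (Y + Z) u * N)
          = (fun u => N * Y u - Y u * N) + (fun u => N * Z u - Z u * N) := by
        funext u; simp only [Pi.add_apply]; noncomm_ring
      have hd : dslope (fun u => N * (Y + Z) u - (Y + Z) u * N) 0 u
          = dslope (fun u => N * Y u - Y u * N) 0 u + dslope (fun u => N * Z u - Z u * N) 0 u := by
        rw [e]
        by_cases hu0 : u = 0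
        · subst hu0
          have hm := Metric.isOpen_ball.mem_nhds hball0
          rw [dslope_same, dslope_same, dslope_same,
            deriv_add ((hcomm Y hY).differentiableAt hm) ((hcomm Z hZ).differentiableAt hm)]
        · rw [dslope_of_ne _ hu0, dslope_of_ne _ hu0, dslope_of_ne _ hu0]
          simp only [slope_def_module, Pi.add_apply]
          rw [← smul_add]
          congr 1
          abel
      rw [hd, Pi.add_apply, mul_add]
      abel)
    (fun Y hY => by
      refine DifferentiableOn.add (DifferentiableOn.mul
        (differentiableOn_superdiag fun i hi => (hreg i hi).1) hY) ?_
      rw [Complex.differentiableOn_dslope (Metric.isOpen_ball.mem_nhds hball0)]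
      exact hcomm Y hY)
    (fun d Y hYd hY u hu => by
      have hf : ∀ u ∈ Metric.ball (0 : ℂ) r, N * Y u - Y u * N ∈ filt n (d + 1) := by
        intro u hu
        refine sub_mem ?_ (mul_mem_filt (hY u hu) hNf)
        exact mul_mem_filt_succ hNf (hY u hu)
      refine add_mem ?_ ?_
      · exact mul_mem_filt_succ (superdiag_mem _) (hY u hu)
      · by_cases hu0 : u = 0
        · subst hu0
          have hm := Metric.isOpen_ball.mem_nhds hball0
          rw [dslope_same]
          intro i j hij
          have h1 := hasDerivAt_entry ((hcomm Y hYd).differentiableAt hm).hasDerivAt i j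
          refine h1.unique ((hasDerivAt_const (0 : ℂ) (0 : ℂ)).congr_of_eventuallyEq ?_)
          filter_upwards [hm] with u hu using hf u hu i j hij
        · rw [dslope_of_ne _ hu0, slope_def_module]
          exact Submodule.smul_mem _ _ (sub_mem (hf u hu) (hf 0 hball0)))
  refine ⟨r, h, hr, h0, h1, fun u hu => (h2 u hu).differentiableAt.differentiableWithinAt,
    fun x hx hx0 i hi => ((hreg i hi).2 x hx hx0).1, fun x hx hx0 => ?_⟩
  have h3 := (h2 _ hx).scomp x (hasDerivAt_loc c hx0)
  convert! h3 using 1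
  have hcx : conn n a x = locDeriv c x • ((loc c x)⁻¹ • N + k (loc c x)) := by
    rw [hN, hk, resMat, ← superdiag_smul, ← superdiag_add, ← superdiag_smul, conn]
    refine superdiag_congr fun i hi => ?_
    rw [← ((hreg i hi).2 x hx hx0).2, div_eq_inv_mul]
  rw [dslope_of_ne _ hx0, slope_def_module, h0, hcx]
  simp only [sub_zero, mul_one, one_mul, sub_self]
  rw [div_eq_mul_inv, mul_smul, smul_mul_assoc, add_mul, smul_mul_assoc]
  simp only [smul_add, smul_sub]
  abel

end GenusZero

/-! ### Flat sections normalized by a tangent vector -/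

namespace GenusZero
open scoped Matrix.Norms.Operator

variable {n : ℕ} {a : ℕ → ℂ}

/-- The radius of a disc on which the connection has the normal form `N / u`. -/
def normRadius (n : ℕ) (a : ℕ → ℂ) (c : Option ℂ) : ℝ := (exists_normalForm n a c).choose

/-- The gauge transformation to the normal form. -/
def normMat (n : ℕ) (a : ℕ → ℂ) (c : Option ℂ) : ℂ → Mat n :=
  (exists_normalForm n a c).choose_spec.choose

theorem normMat_spec (n : ℕ) (a : ℕ → ℂ) (c : Option ℂ) :
    0 < normRadius n a c ∧ normMat n a c 0 = 1 ∧
      (∀ u ∈ Metric.ball 0 (normRadius n a c), normMat n a c u - 1 ∈ filt n 1) ∧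
      DifferentiableOn ℂ (normMat n a c) (Metric.ball 0 (normRadius n a c)) ∧
      (∀ x, loc c x ∈ Metric.ball 0 (normRadius n a c) → loc c x ≠ 0 → ∀ i < n, x ≠ a i) ∧
      ∀ x, loc c x ∈ Metric.ball 0 (normRadius n a c) → loc c x ≠ 0 →
        HasDerivAt (fun x => normMat n a c (loc c x)) (conn n a x * normMat n a c (loc c x)
          - (locDeriv c x / loc c x) • (normMat n a c (loc c x) * resMat n a c)) x :=
  (exists_normalForm n a c).choose_spec.choose_spec

theorem normRadius_pos : ∀ {c : Option ℂ}, 0 < normRadius n a c :=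
  fun {c} => (normMat_spec n a c).1

theorem exp_add_smul (s t : ℂ) (N : Mat n) :
    NormedSpace.exp ((s + t) • N) = NormedSpace.exp (s • N) * NormedSpace.exp (t • N) := by
  rw [add_smul]
  exact NormedSpace.exp_add_of_commute (((Commute.refl N).smul_left s).smul_right t)

theorem exp_smul_mul_exp_neg_smul (t : ℂ) (N : Mat n) :
    NormedSpace.exp (t • N) * NormedSpace.exp ((-t) • N) = 1 := by
  rw [← exp_add_smul, add_neg_cancel, zero_smul, NormedSpace.exp_zero]

theorem exp_neg_smul_mul_exp_smul (t : ℂ) (N : Mat n) :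
    NormedSpace.exp ((-t) • N) * NormedSpace.exp (t • N) = 1 := by
  rw [← exp_add_smul, neg_add_cancel, zero_smul, NormedSpace.exp_zero]

theorem resMat_mem (c : Option ℂ) : resMat n a c ∈ filt n 1 := superdiag_mem _

/-- The flat section near a point of the sphere, normalized with respect to the tangent vector
`σ`. -/
def normSec (n : ℕ) (a : ℕ → ℂ) (c : Option ℂ) (σ x : ℂ) : Mat n :=
  normMat n a c (loc c x) * NormedSpace.exp (Complex.log (loc c x / σ) • resMat n a c)

/-- The slit disc on which the normalized flat section is defined. -/
def normDom (n : ℕ) (a : ℕ → ℂ) (c : Option ℂ) (σ : ℂ) : Set ℂ :=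
  {x | loc c x ∈ Metric.ball 0 (normRadius n a c) ∧ loc c x / σ ∈ Complex.slitPlane}

theorem loc_ne_zero_of_mem {c : Option ℂ} {σ x : ℂ} (hx : x ∈ normDom n a c σ) :
    loc c x ≠ 0 := by
  intro h
  have := Complex.slitPlane_ne_zero hx.2
  simp [h] at this

theorem normSec_sub_one_mem {c : Option ℂ} {σ x : ℂ} (hx : x ∈ normDom n a c σ) :
    normSec n a c σ x - 1 ∈ filt n 1 :=
  sub_one_mem_mul ((normMat_spec n a c).2.2.1 _ hx.1)
    (exp_sub_one_mem (Submodule.smul_mem _ _ (resMat_mem c)))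

theorem isUnit_normSec {c : Option ℂ} {σ x : ℂ} (hx : x ∈ normDom n a c σ) :
    IsUnit (normSec n a c σ x) := isUnit_of_sub_one_mem (normSec_sub_one_mem hx)

theorem hasDerivAt_normSec {c : Option ℂ} {σ x : ℂ} (hx : x ∈ normDom n a c σ) :
    HasDerivAt (normSec n a c σ) (conn n a x * normSec n a c σ x) x := by
  have h0 := loc_ne_zero_of_mem hx
  have h1 := (normMat_spec n a c).2.2.2.2.2 x hx.1 h0
  have hσ : σ ≠ 0 := by
    rintro rfl
    have := Complex.slitPlane_ne_zero hx.2
    simp at this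
  have h2 : HasDerivAt (fun x => Complex.log (loc c x / σ)) (locDeriv c x / loc c x) x := by
    have := ((hasDerivAt_loc c h0).div_const σ).clog hx.2
    convert! this using 1
    field_simp
  have h3 := (hasDerivAt_exp_smul_const' (resMat n a c)
    (Complex.log (loc c x / σ))).scomp x h2
  have h4 := h1.mul h3
  convert! h4 using 1
  simp only [normSec, Function.comp]
  rw [sub_mul, smul_mul_assoc, mul_smul_comm, mul_assoc, mul_assoc, sub_add_cancel]
  rfl

theorem normSec_eq_mul_exp {c : Option ℂ} {σ σ' θ x : ℂ}
    (h : Complex.log (loc c x / σ) = Complex.log (loc c x / σ') + θ) :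
    normSec n a c σ x = normSec n a c σ' x * NormedSpace.exp (θ • resMat n a c) := by
  rw [normSec, normSec, h, exp_add_smul, mul_assoc]

/-! ### Asymptotics along a curve -/

section Curve

variable {c : Option ℂ} {σ : ℂ} {ζ : ℝ → ℂ}

theorem tendsto_loc_div {u : ℝ → ℂ} (hσ : σ ≠ 0)
    (h : (fun t => u t - σ * t) =O[𝓝[>] 0] fun t : ℝ => t ^ 2) :
    (fun t => u t / (σ * t) - 1) =O[𝓝[>] 0] fun t : ℝ => t := by
  have h1 : (fun t : ℝ => (u t - σ * t) * (σ * t)⁻¹) =O[𝓝[>] 0] fun t : ℝ => t ^ 2 * t⁻¹ := by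
    refine h.mul ?_
    refine Asymptotics.IsBigO.of_bound ‖σ⁻¹‖ (Eventually.of_forall fun t => ?_)
    simp [mul_comm]
  refine (h1.congr' ?_ ?_)
  · filter_upwards [self_mem_nhdsWithin] with t (ht : 0 < t)
    have : (t : ℂ) ≠ 0 := by exact_mod_cast ht.ne'
    field_simp
  · filter_upwards [self_mem_nhdsWithin] with t (ht : 0 < t)
    field_simp

theorem tendsto_id_nhdsGT : Tendsto (fun t : ℝ => t) (𝓝[>] 0) (𝓝 0) :=
  tendsto_id.mono_left nhdsWithin_le_nhds

theorem tendsto_one_of_isBigO {g : ℝ → ℂ} (h : (fun t => g t - 1) =O[𝓝[>] 0] fun t : ℝ => t) :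
    Tendsto g (𝓝[>] 0) (𝓝 1) := by
  have := (h.trans_tendsto tendsto_id_nhdsGT).add_const 1
  simpa using this

theorem eventually_mem_normDom (hσ : σ ≠ 0)
    (h : (fun t => loc c (ζ t) - σ * t) =O[𝓝[>] 0] fun t : ℝ => t ^ 2) :
    ∀ᶠ t in 𝓝[>] 0, ζ t ∈ normDom n a c σ := by
  have h1 := tendsto_one_of_isBigO (tendsto_loc_div hσ h)
  have hslit : ∀ᶠ t in 𝓝[>] (0 : ℝ), loc c (ζ t) / (σ * t) ∈ Complex.slitPlane :=
    h1.eventually (Complex.isOpen_slitPlane.mem_nhds Complex.one_mem_slitPlane)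
  have hlim : Tendsto (fun t : ℝ => loc c (ζ t)) (𝓝[>] 0) (𝓝 0) := by
    have h2 : Tendsto (fun t : ℝ => σ * t) (𝓝[>] 0) (𝓝 0) := by
      have : Continuous fun t : ℝ => σ * (t : ℂ) := by fun_prop
      simpa using (this.tendsto 0).mono_left nhdsWithin_le_nhds
    have h3 : Tendsto (fun t : ℝ => t ^ 2) (𝓝[>] 0) (𝓝 0) := by
      have : Continuous fun t : ℝ => t ^ 2 := by fun_prop
      simpa using (this.tendsto 0).mono_left nhdsWithin_le_nhds
    have := (h.trans_tendsto h3).add h2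
    simpa using this
  filter_upwards [hslit, hlim.eventually (Metric.ball_mem_nhds 0 (normRadius_pos (n := n) (a := a)
    (c := c))), self_mem_nhdsWithin] with t ht hb (ht0 : 0 < t)
  refine ⟨hb, ?_⟩
  have h4 : loc c (ζ t) / σ = t * (loc c (ζ t) / (σ * t)) := by
    have : (t : ℂ) ≠ 0 := by exact_mod_cast ht0.ne'
    field_simp
  rw [h4]
  have := Complex.mem_slitPlane_iff.1 ht
  rw [Complex.mem_slitPlane_iff, Complex.re_ofReal_mul, Complex.im_ofReal_mul]
  rcases this with h | h
  · exact Or.inl (mul_pos ht0 h)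
  · exact Or.inr (mul_ne_zero ht0.ne' h)

theorem isBigO_exp_sub_one {g : ℝ → ℂ} (h : g =O[𝓝[>] 0] fun t : ℝ => t) (N : Mat n) :
    (fun t => NormedSpace.exp (g t • N) - 1) =O[𝓝[>] 0] fun t : ℝ => t := by
  have h1 := (hasDerivAt_exp_smul_const N (0 : ℂ)).differentiableAt.isBigO_sub
  simp only [zero_smul, NormedSpace.exp_zero, sub_zero] at h1
  exact (h1.comp_tendsto (h.trans_tendsto tendsto_id_nhdsGT)).trans h

theorem isBigO_mul_sub_one {X Y : ℝ → Mat n} (hX : (fun t => X t - 1) =O[𝓝[>] 0] fun t : ℝ => t)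
    (hY : (fun t => Y t - 1) =O[𝓝[>] 0] fun t : ℝ => t) :
    (fun t => X t * Y t - 1) =O[𝓝[>] 0] fun t : ℝ => t := by
  have h1 : (fun t : ℝ => (1 : ℝ)) =O[𝓝[>] (0 : ℝ)] fun _ => (1 : ℝ) := Asymptotics.isBigO_refl _ _
  have h2 : (fun t : ℝ => t) =O[𝓝[>] (0 : ℝ)] fun _ => (1 : ℝ) :=
    tendsto_id_nhdsGT.isBigO_one ℝ
  have h3 := hX.mul (hY.trans h2)
  simp only [mul_one] at h3
  refine ((h3.add hX).add hY).congr_left fun t => ?_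
  noncomm_ring

/-- Along the curve the local coordinate is `σ t (1 + O(t))`. As `t > 0`, the logarithm splits as
`log t + O(t)`, and both the gauge factor and the exponential of the remainder are `1 + O(t)`. -/
theorem exists_normSec_asymptotics (hσ : σ ≠ 0)
    (h : (fun t => loc c (ζ t) - σ * t) =O[𝓝[>] 0] fun t : ℝ => t ^ 2) :
    ∃ R : ℝ → Mat n, (fun t => R t - 1) =O[𝓝[>] 0] (fun t : ℝ => t) ∧
      ∀ᶠ t in 𝓝[>] 0, normSec n a c σ (ζ t)
        = R t * NormedSpace.exp (((Real.log t : ℝ) : ℂ) • resMat n a c) := by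
  have h1 := tendsto_loc_div hσ h
  have h1' := tendsto_one_of_isBigO h1
  refine ⟨fun t => normMat n a c (loc c (ζ t)) *
    NormedSpace.exp (Complex.log (loc c (ζ t) / (σ * t)) • resMat n a c), ?_, ?_⟩
  · refine isBigO_mul_sub_one ?_ (isBigO_exp_sub_one ?_ _)
    · obtain ⟨hr, h0, -, hd, -⟩ := normMat_spec n a c
      have hd0 := (hd.differentiableAt (Metric.isOpen_ball.mem_nhds
        (Metric.mem_ball_self hr))).isBigO_sub
      simp only [h0, sub_zero] at hd0
      have hO : (fun t => loc c (ζ t)) =O[𝓝[>] 0] fun t : ℝ => t := by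
        have e1 : (fun t : ℝ => t ^ 2) =O[𝓝[>] (0 : ℝ)] fun t : ℝ => t := by
          have := (Asymptotics.isBigO_refl (fun t : ℝ => t) (𝓝[>] (0 : ℝ))).mul
            (tendsto_id_nhdsGT.isBigO_one ℝ)
          simpa [pow_two] using this
        have e2 : (fun t : ℝ => σ * t) =O[𝓝[>] (0 : ℝ)] fun t : ℝ => t :=
          Asymptotics.IsBigO.of_bound ‖σ‖ (Eventually.of_forall fun t => by simp)
        exact ((h.trans e1).add e2).congr_left fun t => by ring
      exact (hd0.comp_tendsto (hO.trans_tendsto tendsto_id_nhdsGT)).trans hO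
    · have hl := (Complex.differentiableAt_log Complex.one_mem_slitPlane).isBigO_sub
      simp only [Complex.log_one, sub_zero] at hl
      exact (hl.comp_tendsto h1').trans h1
  · filter_upwards [self_mem_nhdsWithin, h1'.eventually_ne one_ne_zero] with t (ht : 0 < t) hne
    have ht' : (t : ℂ) ≠ 0 := by exact_mod_cast ht.ne'
    have h4 : loc c (ζ t) / σ = t * (loc c (ζ t) / (σ * t)) := by field_simp
    rw [normSec, h4, Complex.log_ofReal_mul ht hne,
      add_comm ((Real.log t : ℝ) : ℂ), exp_add_smul, mul_assoc]

end Curve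

end GenusZero

namespace GenusZero
open scoped Matrix.Norms.Operator

variable {n : ℕ} {a : ℕ → ℂ}

/-! ### Regularized limits of matrix entries -/

/-- The exponential `exp (X • N)` of a nilpotent matrix, with polynomial entries. -/
def expPoly (N : Mat n) : Matrix (Fin (n + 1)) (Fin (n + 1)) (Polynomial ℂ) :=
  ∑ k ∈ Finset.range (n + 1),
    (Polynomial.X ^ k : Polynomial ℂ) • Polynomial.C.mapMatrix ((k.factorial : ℂ)⁻¹ • N ^ k)

theorem eval_expPoly {N : Mat n} (hN : N ∈ filt n 1) (x : ℂ) :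
    (Polynomial.evalRingHom x).mapMatrix (expPoly N) = NormedSpace.exp (x • N) := by
  rw [exp_eq_sum_of_mem_filt (Submodule.smul_mem _ _ hN), expPoly, map_sum]
  refine Finset.sum_congr rfl fun k _ => ?_
  ext i j
  simp only [RingHom.mapMatrix_apply, Matrix.map_apply, Matrix.smul_apply, smul_eq_mul,
    Polynomial.coe_evalRingHom, Polynomial.eval_mul, Polynomial.eval_pow, Polynomial.eval_X,
    Polynomial.eval_C, smul_pow]
  ring

/-- This lets an error `O(ε)` absorb any polynomial in `log ε`. -/
theorem tendsto_mul_eval_log (P : Polynomial ℂ) :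
    Tendsto (fun ε : ℝ => (ε : ℂ) * P.eval ((Real.log ε : ℝ) : ℂ)) (𝓝[>] 0) (𝓝 0) := by
  induction P using Polynomial.induction_on' with
  | add p q hp hq => simpa [mul_add] using hp.add hq
  | monomial k c =>
    have h1 : Tendsto (fun ε : ℝ => (-Real.log ε) ^ k * Real.exp (-(-Real.log ε)))
        (𝓝[>] 0) (𝓝 0) :=
      (Real.tendsto_pow_mul_exp_neg_atTop_nhds_zero k).comp
        (tendsto_neg_atBot_atTop.comp Real.tendsto_log_nhdsGT_zero)
    have h2 : Tendsto (fun ε : ℝ => (c * (-1) ^ k) *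
        (((-Real.log ε) ^ k * Real.exp (-(-Real.log ε)) : ℝ) : ℂ)) (𝓝[>] 0) (𝓝 0) := by
      have := ((Complex.continuous_ofReal.tendsto 0).comp h1).const_mul (c * (-1) ^ k)
      simpa using this
    refine h2.congr' ?_
    filter_upwards [self_mem_nhdsWithin] with ε (hε : 0 < ε)
    rw [neg_neg, Real.exp_log hε, Polynomial.eval_monomial]
    have h3 : ((-1 : ℂ)) ^ k * (-1) ^ k = 1 := by rw [← mul_pow]; simp
    push_cast
    rw [neg_pow]
    linear_combination (c * ((Real.log ε : ℝ) : ℂ) ^ k * ε) * h3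

theorem mat_eq_sum (M : Mat n) :
    M = ∑ i, ∑ j, M i j • (Matrix.single i j 1 : Mat n) := by
  conv_lhs => rw [Matrix.matrix_eq_sum_single M]
  simp

theorem tendsto_zero_of_entries {M : ℝ → Mat n} {l : Filter ℝ}
    (h : ∀ i j, Tendsto (fun t => M t i j) l (𝓝 0)) : Tendsto M l (𝓝 0) := by
  have h1 : Tendsto (fun t => ∑ i, ∑ j, M t i j • (Matrix.single i j 1 : Mat n)) l
      (𝓝 (∑ i : Fin (n + 1), ∑ j : Fin (n + 1), (0 : ℂ) • (Matrix.single i j 1 : Mat n))) :=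
    tendsto_finsetSum _ fun i _ => tendsto_finsetSum _ fun j _ => (h i j).smul_const _
  simpa only [← mat_eq_sum, zero_smul, Finset.sum_const_zero] using h1

theorem isBigO_inverse_sub_one {R : ℝ → Mat n}
    (hR : (fun t => R t - 1) =O[𝓝[>] 0] fun t : ℝ => t) :
    (fun t => Ring.inverse (R t) - 1) =O[𝓝[>] 0] fun t : ℝ => t := by
  have h1 : DifferentiableAt ℂ (Ring.inverse : Mat n → Mat n) 1 :=
    differentiableAt_inverse isUnit_one
  have h2 := h1.isBigO_sub
  simp only [Ring.inverse_one] at h2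
  have h3 : Tendsto R (𝓝[>] 0) (𝓝 1) := by
    have := (hR.trans_tendsto tendsto_id_nhdsGT).add_const 1
    simp only [sub_add_cancel, zero_add] at this
    exact this
  exact (h2.comp_tendsto h3).trans hR

/-- The hypothesis says `F = R₁ exp(log ε N') Φ exp(-log ε N) R₀⁻¹`. The middle part is a polynomial
in `log ε` because `N` and `N'` are nilpotent, its constant term is `Φ`, and replacing the outer
factors `1 + O(ε)` by `1` costs `o(1)`. -/
theorem hasRegLim_entry {F R₀ R₁ : ℝ → Mat n} {Φ N N' : Mat n} (hN : N ∈ filt n 1)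
    (hN' : N' ∈ filt n 1) (h₀ : (fun t => R₀ t - 1) =O[𝓝[>] 0] fun t : ℝ => t)
    (h₁ : (fun t => R₁ t - 1) =O[𝓝[>] 0] fun t : ℝ => t)
    (hF : ∀ᶠ ε in 𝓝[>] (0 : ℝ), F ε * (R₀ ε * NormedSpace.exp (((Real.log ε : ℝ) : ℂ) • N))
      = R₁ ε * NormedSpace.exp (((Real.log ε : ℝ) : ℂ) • N') * Φ) (i j : Fin (n + 1)) :
    HasRegLim (fun ε => F ε i j) (Φ i j) := by
  set Q : Matrix (Fin (n + 1)) (Fin (n + 1)) (Polynomial ℂ) :=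
    expPoly N' * Polynomial.C.mapMatrix Φ * expPoly (-N) with hQ
  have hneg : -N ∈ filt n 1 := neg_mem hN
  have hev : ∀ x, (Polynomial.evalRingHom x).mapMatrix Q
      = NormedSpace.exp (x • N') * Φ * NormedSpace.exp ((-x) • N) := by
    intro x
    have hC : (Polynomial.evalRingHom x).mapMatrix (Polynomial.C.mapMatrix Φ) = Φ := by
      ext i j; simp
    rw [hQ, map_mul, map_mul, eval_expPoly hN', eval_expPoly hneg, hC, smul_neg, neg_smul]
  refine ⟨Q i j, ?_, ?_⟩
  · have := hev 0
    rw [zero_smul, neg_zero, zero_smul, NormedSpace.exp_zero, one_mul, mul_one] at this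
    rw [Polynomial.coeff_zero_eq_eval_zero, ← this]
    rfl
  set M : ℝ → Mat n := fun ε => (Polynomial.evalRingHom ((Real.log ε : ℝ) : ℂ)).mapMatrix Q with hM
  have hεM : Tendsto (fun ε : ℝ => (ε : ℂ) • M ε) (𝓝[>] 0) (𝓝 0) :=
    tendsto_zero_of_entries fun i j => tendsto_mul_eval_log (Q i j)
  have hεM' : Tendsto (fun ε : ℝ => ε * ‖M ε‖) (𝓝[>] 0) (𝓝 0) := by
    refine hεM.norm.congr' ?_ |>.trans (by simp)
    filter_upwards [self_mem_nhdsWithin] with ε (hε : 0 < ε)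
    rw [norm_smul, Complex.norm_real, Real.norm_of_nonneg hε.le]
  have h₀' := isBigO_inverse_sub_one h₀
  have hMO : M =O[𝓝[>] 0] fun ε => ‖M ε‖ := (Asymptotics.isBigO_refl _ _).norm_right
  have e1 : Tendsto (fun ε => (R₁ ε - 1) * M ε) (𝓝[>] 0) (𝓝 0) :=
    (h₁.mul hMO).trans_tendsto hεM'
  have e2 : Tendsto (fun ε => M ε * (Ring.inverse (R₀ ε) - 1)) (𝓝[>] 0) (𝓝 0) :=
    (hMO.mul h₀').trans_tendsto (by simpa only [mul_comm] using hεM')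
  have e3 : Tendsto (fun ε => (R₁ ε - 1) * M ε * (Ring.inverse (R₀ ε) - 1)) (𝓝[>] 0) (𝓝 0) := by
    have := e1.mul (h₀'.trans_tendsto tendsto_id_nhdsGT)
    simpa using this
  have hsum := (e1.add e2).add e3
  simp only [add_zero] at hsum
  have hR₀u : ∀ᶠ ε in 𝓝[>] 0, IsUnit (R₀ ε) := by
    have h3 : Tendsto R₀ (𝓝[>] 0) (𝓝 1) := by
      have := (h₀.trans_tendsto tendsto_id_nhdsGT).add_const 1
      simp only [sub_add_cancel, zero_add] at this
      exact this
    exact h3.eventually (Units.isOpen.mem_nhds isUnit_one)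
  have hdiff : Tendsto (fun ε => F ε - M ε) (𝓝[>] 0) (𝓝 0) := by
    refine hsum.congr' ?_
    filter_upwards [hF, hR₀u] with ε hε hu
    set E := NormedSpace.exp (((Real.log ε : ℝ) : ℂ) • N)
    set E' := NormedSpace.exp (((Real.log ε : ℝ) : ℂ) • N')
    set D := NormedSpace.exp ((-((Real.log ε : ℝ) : ℂ)) • N)
    have hED : E * D = 1 := exp_smul_mul_exp_neg_smul _ _
    have hF' : F ε = R₁ ε * M ε * Ring.inverse (R₀ ε) := by
      have hMe : M ε = E' * Φ * D := hev _
      calc F ε = F ε * (R₀ ε * (E * D) * Ring.inverse (R₀ ε)) := by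
            rw [hED, mul_one, Ring.mul_inverse_cancel _ hu, mul_one]
        _ = F ε * (R₀ ε * E) * D * Ring.inverse (R₀ ε) := by noncomm_ring
        _ = _ := by rw [hε, hMe]; noncomm_ring
    rw [hF']
    noncomm_ring
  have hent : Tendsto (fun ε => entryCLM i j (F ε - M ε)) (𝓝[>] 0) (𝓝 0) := by
    have := ((entryCLM i j).continuous.tendsto 0).comp hdiff
    rwa [map_zero] at this
  exact hent

end GenusZero

namespace GenusZero
open scoped Matrix.Norms.Operator

variable {S : Type*} {n : ℕ}

/-! ### Iterated integrals as entries of a flat matrix -/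

/-- The position of the `i`-th letter of a word. -/
def letterPos (pos : S → ℂ) (v : List S) (i : ℕ) : ℂ := (v.map pos).getD i 0

/-- The part of a word between two positions. -/
def slice (v : List S) (i j : ℕ) : List S := (v.drop i).take (j - i)

theorem slice_self (v : List S) (i : ℕ) : slice v i i = [] := by simp [slice]

theorem slice_zero_length (v : List S) : slice v 0 v.length = v := by simp [slice]

theorem length_slice (v : List S) {i j : ℕ} (hj : j ≤ v.length) (hij : i ≤ j) :
    (slice v i j).length = j - i := by
  simp [slice]; omega

theorem slice_eq_cons (v : List S) {i j : ℕ} (hj : j ≤ v.length) (hij : i < j) :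
    slice v i j = v[i] :: slice v (i + 1) j := by
  rw [slice, slice, List.drop_eq_getElem_cons (by omega), show j - i = (j - (i + 1)) + 1 by omega,
    List.take_succ_cons]

theorem letterPos_eq (pos : S → ℂ) (v : List S) {i : ℕ} (hi : i < v.length) :
    letterPos pos v i = pos v[i] := by
  simp [letterPos, hi]

section

variable {pos : S → ℂ} {ζ : ℝ → ℂ}

theorem hasDerivAt_iterInt_cons (hζ : ContDiffOn ℝ 1 ζ (Ioo 0 1))
    (hav : ∀ t ∈ Ioo (0 : ℝ) 1, ∀ s, ζ t ≠ pos s) {ε : ℝ} (hε : ε ∈ Ioo (0 : ℝ) 1) (w : List S)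
    (hw : ContinuousOn (iterInt pos ζ ε w) (Ioo 0 1)) (s : S) {t : ℝ} (ht : t ∈ Ioo (0 : ℝ) 1) :
    HasDerivAt (iterInt pos ζ ε (s :: w))
      (invTwoPiI * (deriv ζ t / (ζ t - pos s)) * iterInt pos ζ ε w t) t := by
  have hc : ContinuousOn (fun τ => invTwoPiI * (deriv ζ τ / (ζ τ - pos s)) * iterInt pos ζ ε w τ)
      (Ioo 0 1) := by
    refine ContinuousOn.mul (continuousOn_const.mul (ContinuousOn.div
      (hζ.continuousOn_deriv_of_isOpen isOpen_Ioo le_rfl)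
      (hζ.continuousOn.sub continuousOn_const) fun τ hτ => sub_ne_zero.2 (hav τ hτ s))) hw
  have hsub : uIcc ε t ⊆ Ioo 0 1 := (ordConnected_Ioo).uIcc_subset hε ht
  exact intervalIntegral.integral_hasDerivAt_right (hc.mono hsub).intervalIntegrable
    (hc.stronglyMeasurableAtFilter isOpen_Ioo t ht) (hc.continuousAt (isOpen_Ioo.mem_nhds ht))

theorem continuousOn_iterInt (hζ : ContDiffOn ℝ 1 ζ (Ioo 0 1))
    (hav : ∀ t ∈ Ioo (0 : ℝ) 1, ∀ s, ζ t ≠ pos s) {ε : ℝ} (hε : ε ∈ Ioo (0 : ℝ) 1) (w : List S) :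
    ContinuousOn (iterInt pos ζ ε w) (Ioo 0 1) := by
  induction w with
  | nil => exact continuousOn_const
  | cons s w ih => exact fun t ht =>
      (hasDerivAt_iterInt_cons hζ hav hε w ih s ht).continuousAt.continuousWithinAt

/-- The matrix of the iterated integrals of the parts of a word. -/
def iterMat (pos : S → ℂ) (ζ : ℝ → ℂ) (v : List S) (ε t : ℝ) : Mat v.length :=
  Matrix.of fun i j => if i ≤ j then iterInt pos ζ ε (slice v i j) t else 0

theorem iterMat_apply (v : List S) (ε t : ℝ) {i j : Fin (v.length + 1)} (hij : i ≤ j) :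
    iterMat pos ζ v ε t i j = iterInt pos ζ ε (slice v i j) t := if_pos hij

theorem iterMat_apply_of_lt (v : List S) (ε t : ℝ) {i j : Fin (v.length + 1)} (hij : j < i) :
    iterMat pos ζ v ε t i j = 0 := if_neg (not_le.2 hij)

theorem iterMat_apply_self (v : List S) (ε t : ℝ) (i : Fin (v.length + 1)) :
    iterMat pos ζ v ε t i i = 1 := by
  rw [iterMat_apply v ε t le_rfl, slice_self]; rfl

theorem iterMat_sub_one_mem (v : List S) (ε t : ℝ) :
    iterMat pos ζ v ε t - 1 ∈ filt v.length 1 := by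
  intro i j h
  rw [Matrix.sub_apply]
  rcases (show j ≤ i by exact Fin.le_def.2 (by omega)).lt_or_eq with h | rfl
  · rw [iterMat_apply_of_lt v ε t h, Matrix.one_apply_ne h.ne', sub_zero]
  · rw [iterMat_apply_self, Matrix.one_apply_eq, sub_self]

theorem iterMat_self (v : List S) (ε : ℝ) : iterMat pos ζ v ε ε = 1 := by
  ext i j
  rcases lt_trichotomy i j with h | rfl | h
  · rw [iterMat_apply v ε ε h.le, Matrix.one_apply_ne h.ne,
      slice_eq_cons v (by omega) (Fin.lt_def.1 h)]
    exact intervalIntegral.integral_same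
  · rw [iterMat_apply_self, Matrix.one_apply_eq]
  · rw [iterMat_apply_of_lt v ε ε h, Matrix.one_apply_ne h.ne']

theorem hasDerivAt_of_entries {Y : ℝ → Mat n} {Y' : Mat n} {t : ℝ}
    (h : ∀ i j, HasDerivAt (fun t => Y t i j) (Y' i j) t) : HasDerivAt Y Y' t := by
  have h1 : HasDerivAt (fun t => ∑ i, ∑ j, Y t i j • (Matrix.single i j 1 : Mat n))
      (∑ i, ∑ j, Y' i j • (Matrix.single i j 1 : Mat n)) t :=
    HasDerivAt.fun_sum fun i _ => HasDerivAt.fun_sum fun j _ => (h i j).smul_const _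
  simp only [← mat_eq_sum] at h1
  exact h1

/-- Differentiating the outermost integration strips the first letter of the slice, that is, it
moves row `i` to row `i + 1`; this is left multiplication by a superdiagonal matrix. -/
theorem hasDerivAt_iterMat (hζ : ContDiffOn ℝ 1 ζ (Ioo 0 1))
    (hav : ∀ t ∈ Ioo (0 : ℝ) 1, ∀ s, ζ t ≠ pos s) (v : List S) {ε : ℝ}
    (hε : ε ∈ Ioo (0 : ℝ) 1) {t : ℝ} (ht : t ∈ Ioo (0 : ℝ) 1) :
    HasDerivAt (iterMat pos ζ v ε)
      (deriv ζ t • conn v.length (letterPos pos v) (ζ t) * iterMat pos ζ v ε t) t := by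
  refine hasDerivAt_of_entries fun i j => ?_
  rw [conn, ← superdiag_smul]
  by_cases hi : (i : ℕ) < v.length
  · rw [superdiag_mul_apply _ _ _ _ hi, letterPos_eq _ _ hi]
    rcases lt_trichotomy i j with h | rfl | h
    · have hij : (i : ℕ) < j := Fin.lt_def.1 h
      rw [iterMat_apply v ε t (i := ⟨i + 1, by omega⟩) (Fin.le_def.2 (by simpa using hij))]
      have e : (fun t => iterMat pos ζ v ε t i j)
          = iterInt pos ζ ε (v[(i : ℕ)] :: slice v (i + 1) j) := by
        funext t
        rw [iterMat_apply v ε t h.le, slice_eq_cons v (by omega) hij]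
      rw [e]
      have := hasDerivAt_iterInt_cons hζ hav hε (slice v (i + 1) j)
        (continuousOn_iterInt hζ hav hε _) v[(i : ℕ)] ht
      convert! this using 1
      ring
    · rw [iterMat_apply_of_lt v ε t (Fin.lt_def.2 (by simp)), mul_zero]
      simp only [iterMat_apply_self]
      exact hasDerivAt_const t (1 : ℂ)
    · rw [iterMat_apply_of_lt v ε t (Fin.lt_def.2 (by
        have := Fin.lt_def.1 h; simp; omega)), mul_zero]
      simp only [iterMat_apply_of_lt v ε _ h]
      exact hasDerivAt_const t (0 : ℂ)
  · rw [superdiag_mul_last _ _ _ _ hi]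
    rcases (show j ≤ i by exact Fin.le_def.2 (by omega)).lt_or_eq with h | rfl
    · simp only [iterMat_apply_of_lt v ε _ h]
      exact hasDerivAt_const t (0 : ℂ)
    · simp only [iterMat_apply_self]
      exact hasDerivAt_const t (1 : ℂ)

/-! ### Transport along plane curves between tangential base points -/

/-- A continuously differentiable plane curve over `(0, 1)` that avoids the given positions and
joins the tangent vector `σ` at `c` to the tangent vector `σ'` at `c'`. -/
structure IsTangentialCurve (pos : S → ℂ) (ζ : ℝ → ℂ) (c : Option ℂ) (σ : ℂ) (c' : Option ℂ)
    (σ' : ℂ) : Prop where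
  contDiffOn : ContDiffOn ℝ 1 ζ (Ioo 0 1)
  avoids : ∀ t ∈ Ioo (0 : ℝ) 1, ∀ s, ζ t ≠ pos s
  source_ne : σ ≠ 0
  target_ne : σ' ≠ 0
  source : (fun t => loc c (ζ t) - σ * t) =O[𝓝[>] 0] fun t : ℝ => t ^ 2
  target : (fun t => loc c' (ζ (1 - t)) - σ' * t) =O[𝓝[>] 0] fun t : ℝ => t ^ 2

/-- A family of matrices is flat along a curve on a set of times. -/
def FlatAlong (n : ℕ) (a : ℕ → ℂ) (ζ : ℝ → ℂ) (I : Set ℝ) (H : ℝ → Mat n) : Prop :=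
  ∀ t ∈ I, HasDerivAt H (deriv ζ t • conn n a (ζ t) * H t) t

/-- The regularized transport along a curve between tangential base points is `Φ`. -/
def HasTransport (n : ℕ) (a : ℕ → ℂ) (ζ : ℝ → ℂ) (c : Option ℂ) (σ : ℂ) (c' : Option ℂ) (σ' : ℂ)
    (Φ : Mat n) : Prop :=
  ∃ H : ℝ → Mat n, FlatAlong n a ζ (Ioo 0 1) H ∧
    (∀ᶠ t in 𝓝[>] 0, H t = normSec n a c σ (ζ t)) ∧
    ∀ᶠ t in 𝓝[>] 0, H (1 - t) = normSec n a c' σ' (ζ (1 - t)) * Φ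

theorem FlatAlong.comp {a : ℕ → ℂ} {L : ℂ → Mat n} {I : Set ℝ}
    (hζ : ∀ t ∈ I, DifferentiableAt ℝ ζ t)
    (hL : ∀ t ∈ I, HasDerivAt L (conn n a (ζ t) * L (ζ t)) (ζ t)) :
    FlatAlong n a ζ I fun t => L (ζ t) := fun t ht => by
  have := (hL t ht).scomp t (hζ t ht).hasDerivAt
  convert! this using 1
  rw [smul_mul_assoc]

theorem eventually_one_sub {P : ℝ → Prop} (h : ∀ᶠ t in 𝓝[>] (0 : ℝ), P t) :
    ∃ δ ∈ Ioo (0 : ℝ) 1, ∀ t ∈ Ioo (0 : ℝ) δ, P t := by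
  obtain ⟨δ, hδ, h⟩ := mem_nhdsGT_iff_exists_Ioo_subset.1 h
  refine ⟨min δ (1 / 2), ⟨lt_min hδ (by norm_num), (min_le_right _ _).trans_lt (by norm_num)⟩,
    fun t ht => h ⟨ht.1, ht.2.trans_le (min_le_left _ _)⟩⟩

namespace IsTangentialCurve

variable {c c' : Option ℂ} {σ σ' : ℂ}

theorem differentiableAt (h : IsTangentialCurve pos ζ c σ c' σ') {t : ℝ} (ht : t ∈ Ioo (0 : ℝ) 1) :
    DifferentiableAt ℝ ζ t :=
  (h.contDiffOn.differentiableOn one_ne_zero).differentiableAt (isOpen_Ioo.mem_nhds ht)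

/-- The iterated integrals from time `1/2` form a fundamental solution on all of `(0, 1)`. A right
factor `C` matches it with the normalized section at the source, and comparison with the normalized
section at the target yields `Φ`. -/
theorem exists_hasTransport (h : IsTangentialCurve pos ζ c σ c' σ') (v : List S) :
    ∃ Φ, HasTransport v.length (letterPos pos v) ζ c σ c' σ' Φ := by
  obtain ⟨δ, hδ, hd⟩ := eventually_one_sub (eventually_mem_normDom (n := v.length)
    (a := letterPos pos v) h.source_ne h.source)
  obtain ⟨δ', hδ', hd'⟩ := eventually_one_sub (eventually_mem_normDom (n := v.length)
    (a := letterPos pos v) h.target_ne h.target)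
  have hhalf : (1 / 2 : ℝ) ∈ Ioo (0 : ℝ) 1 := by norm_num
  have hW := fun t ht => hasDerivAt_iterMat (t := t) h.contDiffOn h.avoids v hhalf ht
  have hsub : Ioo 0 δ ⊆ Ioo (0 : ℝ) 1 := Ioo_subset_Ioo_right hδ.2.le
  have hsub' : Ioo (1 - δ') 1 ⊆ Ioo (0 : ℝ) 1 := Ioo_subset_Ioo_left (by linarith [hδ'.2])
  have hd'' : ∀ t ∈ Ioo (1 - δ') 1, ζ t ∈ normDom v.length (letterPos pos v) c' σ' := by
    intro t ht
    have := hd' (1 - t) ⟨by linarith [ht.2], by linarith [ht.1]⟩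
    rwa [sub_sub_cancel] at this
  obtain ⟨C, hC⟩ := exists_eq_mul_of_flat (𝕜 := ℝ) isOpen_Ioo isPreconnected_Ioo
    (fun t ht => hW t (hsub ht))
    (FlatAlong.comp (fun t ht => h.differentiableAt (hsub ht))
      fun t ht => hasDerivAt_normSec (hd t ht))
    (fun t _ => isUnit_of_sub_one_mem (iterMat_sub_one_mem v (1 / 2) t))
  have hH : FlatAlong v.length (letterPos pos v) ζ (Ioo 0 1)
      fun t => iterMat pos ζ v (1 / 2) t * C := by
    intro t ht
    have := (hW t ht).mul_const C
    rwa [mul_assoc] at this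
  obtain ⟨Φ, hΦ⟩ := exists_eq_mul_of_flat (𝕜 := ℝ) isOpen_Ioo isPreconnected_Ioo
    (FlatAlong.comp (fun t ht => h.differentiableAt (hsub' ht))
      fun t ht => hasDerivAt_normSec (hd'' t ht))
    (fun t ht => hH t (hsub' ht)) (fun t ht => isUnit_normSec (hd'' t ht))
  refine ⟨Φ, _, hH, ?_, ?_⟩
  · filter_upwards [Ioo_mem_nhdsGT hδ.1] with t ht using (hC t ht).symm
  · filter_upwards [Ioo_mem_nhdsGT hδ'.1] with t ht
    exact hΦ _ ⟨by linarith [ht.2], by linarith [ht.1]⟩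

theorem sub_one_mem_of_hasTransport (h : IsTangentialCurve pos ζ c σ c' σ') (v : List S)
    {Φ : Mat v.length} (hΦ : HasTransport v.length (letterPos pos v) ζ c σ c' σ' Φ) :
    Φ - 1 ∈ filt v.length 1 := by
  obtain ⟨H, hH, h0, h1⟩ := hΦ
  have hhalf : (1 / 2 : ℝ) ∈ Ioo (0 : ℝ) 1 := by norm_num
  have hunip := fun t => iterMat_sub_one_mem (pos := pos) (ζ := ζ) v (1 / 2) t
  obtain ⟨C, hC⟩ := exists_eq_mul_of_flat (𝕜 := ℝ) isOpen_Ioo isPreconnected_Ioo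
    (fun t ht => hasDerivAt_iterMat (t := t) h.contDiffOn h.avoids v hhalf ht) hH
    (fun t _ => isUnit_of_sub_one_mem (hunip t))
  have hCu : C - 1 ∈ filt v.length 1 := by
    obtain ⟨t, e, hm, ht⟩ := (h0.and ((eventually_mem_normDom (n := v.length)
      (a := letterPos pos v) h.source_ne h.source).and (Ioo_mem_nhdsGT one_pos))).exists
    have := hC t ht
    rw [← Ring.inverse_mul_cancel_left _ C (isUnit_of_sub_one_mem (hunip t)), ← this, e]
    exact sub_one_mem_mul (sub_one_mem_inverse (hunip t)) (normSec_sub_one_mem hm)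
  obtain ⟨t, e, hm, ht⟩ := (h1.and ((eventually_mem_normDom (n := v.length)
    (a := letterPos pos v) h.target_ne h.target).and (Ioo_mem_nhdsGT one_pos))).exists
  have h2 := hC (1 - t) ⟨by linarith [ht.2], by linarith [ht.1]⟩
  rw [← Ring.inverse_mul_cancel_left _ Φ (isUnit_normSec hm), ← e, h2]
  exact sub_one_mem_mul (sub_one_mem_inverse (normSec_sub_one_mem hm))
    (sub_one_mem_mul (hunip _) hCu)

/-- The matrix of iterated integrals from `ε` to `1 - ε` carries `H ε` to `H (1 - ε)`. Near the ends
these are normalized sections, whose asymptotics put the truncated integrals in the shape required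
by `hasRegLim_entry`. -/
theorem hasRegLim (h : IsTangentialCurve pos ζ c σ c' σ') (v : List S) {Φ : Mat v.length}
    (hΦ : HasTransport v.length (letterPos pos v) ζ c σ c' σ' Φ) {i j : Fin (v.length + 1)}
    (hij : i ≤ j) :
    HasRegLim (fun ε => iterInt pos ζ ε (slice v i j) (1 - ε)) (Φ i j) := by
  obtain ⟨H, hH, h0, h1⟩ := hΦ
  obtain ⟨R₀, hR₀, e0⟩ := exists_normSec_asymptotics (n := v.length) (a := letterPos pos v)
    h.source_ne h.source
  obtain ⟨R₁, hR₁, e1⟩ := exists_normSec_asymptotics (n := v.length) (a := letterPos pos v)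
    h.target_ne h.target
  have hsmall : ∀ᶠ ε in 𝓝[>] (0 : ℝ), ε < 1 :=
    (eventually_lt_nhds one_pos).filter_mono nhdsWithin_le_nhds
  have key := hasRegLim_entry (F := fun ε => iterMat pos ζ v ε (1 - ε)) (Φ := Φ)
    (resMat_mem (n := v.length) (a := letterPos pos v) c) (resMat_mem c') hR₀ hR₁ (by
      filter_upwards [h0, h1, e0, e1, hsmall, self_mem_nhdsWithin] with ε h0 h1 e0 e1 hε' hε
      have hε0 : ε ∈ Ioo (0 : ℝ) 1 := ⟨hε, hε'⟩
      have hε1 : 1 - ε ∈ Ioo (0 : ℝ) 1 := ⟨by linarith [hε0.2], by linarith [hε0.1]⟩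
      obtain ⟨C, hC⟩ := exists_eq_mul_of_flat (𝕜 := ℝ) isOpen_Ioo isPreconnected_Ioo
        (fun t ht => hasDerivAt_iterMat h.contDiffOn h.avoids v hε0 ht) hH
        (fun t _ => isUnit_of_sub_one_mem (iterMat_sub_one_mem v ε t))
      have hC0 := hC ε hε0
      rw [iterMat_self, one_mul] at hC0
      rw [← e0, ← h0, hC0, ← hC _ hε1, h1, e1]) i j
  simp only [iterMat_apply v _ _ hij] at key
  exact key

end IsTangentialCurve

end

end GenusZero

namespace GenusZero
open scoped Matrix.Norms.Operator

/-! ### The plane curve of a tangential path -/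

section Smooth

variable {X : Type*} [TopologicalSpace X] [ChartedSpace ℂ X]

theorem contMDiffAt_real_of_complex {Y : Type*} [TopologicalSpace Y] [ChartedSpace ℂ Y]
    {f : X → Y} {x : X} (h : ContMDiffAt 𝓘(ℂ, ℂ) 𝓘(ℂ, ℂ) ω f x) :
    ContMDiffAt 𝓘(ℝ, ℂ) 𝓘(ℝ, ℂ) ∞ f x := by
  rw [contMDiffAt_iff] at h ⊢
  exact ⟨h.1, (h.2.restrict_scalars ℝ).of_le le_top⟩

/-- Second-order Taylor expansion at the end point. The quadratic error is what makes the ratio of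
the path to its tangent `1 + O(t)`. -/
theorem isBigO_sq_of_contDiffWithinAt {f : ℝ → ℂ} {f' : ℂ}
    (hf : ContDiffWithinAt ℝ 2 f (Icc 0 1) 0) (hf' : HasDerivWithinAt f f' (Icc 0 1) 0) :
    (fun t : ℝ => f t - f 0 - f' * t) =O[𝓝[>] 0] fun t : ℝ => t ^ 2 := by
  obtain ⟨u, hu, h0u, hfu⟩ := hf.contDiffOn' (m := 2) le_rfl (by simp)
  obtain ⟨δ, hδ, hsub⟩ := Metric.isOpen_iff.1 hu 0 h0u
  set r := min (δ / 2) 1 with hr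
  have hr0 : 0 < r := by positivity
  have hIcc : Icc 0 r ⊆ insert 0 (Icc (0 : ℝ) 1) ∩ u := by
    intro t ht
    refine ⟨Or.inr ⟨ht.1, ht.2.trans (min_le_right _ _)⟩, hsub ?_⟩
    have := min_le_left (δ / 2) 1
    rw [Metric.mem_ball, Real.dist_eq, sub_zero, abs_of_nonneg ht.1]
    linarith [ht.2]
  obtain ⟨C, hC⟩ := exists_taylor_mean_remainder_bound (n := 1) hr0.le (hfu.mono hIcc)
  refine Asymptotics.IsBigO.of_bound C ?_
  filter_upwards [Ioo_mem_nhdsGT hr0] with t ht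
  have hd : derivWithin f (Icc 0 r) 0 = f' :=
    (hf'.mono (Icc_subset_Icc_right (min_le_right _ _))).derivWithin
      (uniqueDiffOn_Icc hr0 0 ⟨le_rfl, hr0.le⟩)
  have h1 := hC t ⟨ht.1.le, ht.2.le⟩
  rw [taylorWithinEval_succ, taylor_within_zero_eval, iteratedDerivWithin_one, hd] at h1
  simp only [sub_zero, Real.norm_eq_abs, abs_pow] at h1 ⊢
  rw [abs_of_pos ht.1]
  refine le_trans (le_of_eq ?_) h1
  congr 1
  simp [sub_sub, mul_comm]

end Smooth

/-! ### Marked points seen in the coordinate plane -/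

section Homeo

variable {X : Type*} [TopologicalSpace X] [ChartedSpace ℂ X] {S : Type*} {C : MarkedCurve X S}
  (z : AdmissibleCoord C)

@[simp] theorem affine_coe (x : ℂ) : affine (x : OnePoint ℂ) = x := rfl

theorem coe_affine {y : OnePoint ℂ} (hy : y ≠ OnePoint.infty) : ((affine y : ℂ) : OnePoint ℂ) = y := by
  induction y using OnePoint.rec with
  | infty => exact absurd rfl hy
  | coe x => rfl

/-- The position on the sphere of a marked point. -/
def AdmissibleCoord.center (P : Option S) : Option ℂ := P.map z.pos

theorem mark_some_ne_infty (s : S) : z.toHomeo (C.mark (some s)) ≠ OnePoint.infty := by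
  rw [← z.map_infty]
  intro h
  have := C.mark_injective (z.toHomeo.injective h)
  simp at this

theorem coe_pos (s : S) : ((z.pos s : ℂ) : OnePoint ℂ) = z.toHomeo (C.mark (some s)) :=
  coe_affine (mark_some_ne_infty z s)

theorem pos_injective : Function.Injective z.pos := by
  intro s s' h
  have h1 := coe_pos z s
  rw [h, coe_pos z s'] at h1
  simpa using (C.mark_injective (z.toHomeo.injective h1)).symm

theorem ne_infty_of_notMem {x : X} (hx : x ∉ range C.mark) : z.toHomeo x ≠ OnePoint.infty := by
  rw [← z.map_infty]
  exact fun h => hx ⟨none, (z.toHomeo.injective h).symm⟩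

theorem coord_ne_pos {x : X} (hx : x ∉ range C.mark) (s : S) : z.coord x ≠ z.pos s := by
  intro h
  have h1 : ((z.coord x : ℂ) : OnePoint ℂ) = z.toHomeo x := coe_affine (ne_infty_of_notMem z hx)
  rw [h, coe_pos] at h1
  exact hx ⟨some s, z.toHomeo.injective h1⟩

theorem notMem_range_mark {x : X} (hx : z.toHomeo x ≠ OnePoint.infty)
    (hx' : ∀ s, z.coord x ≠ z.pos s) : x ∉ range C.mark := by
  rintro ⟨P, rfl⟩
  cases P with
  | none => exact hx z.map_infty
  | some s => exact hx' s rfl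

end Homeo

namespace TangentialPath

variable {X : Type*} [TopologicalSpace X] [ChartedSpace ℂ X] {S : Type*} {C : MarkedCurve X S}
  {z : AdmissibleCoord C} {p q : TangentialBasePoint S}

/-- The path in the coordinate plane. -/
def plane (γ : TangentialPath z p q) (t : ℝ) : ℂ := z.coord (γ.toFun t)

/-- The reversed path. -/
def reverse (γ : TangentialPath z p q) : TangentialPath z q p where
  toFun t := γ.toFun (1 - t)
  smooth := by
    have h : ContMDiffOn 𝓘(ℝ, ℝ) 𝓘(ℝ, ℝ) ∞ (fun t : ℝ => 1 - t) (Icc 0 1) := by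
      rw [contMDiffOn_iff_contDiffOn]; fun_prop
    exact γ.smooth.comp h fun t ht => ⟨by linarith [ht.2], by linarith [ht.1]⟩
  source := by simp [γ.target]
  target := by simp [γ.source]
  velocity_source := by
    have h : HasDerivWithinAt (fun t : ℝ => 1 - t) (-1) (Icc 0 1) 0 :=
      ((hasDerivAt_id (0 : ℝ)).const_sub 1).hasDerivWithinAt
    have h1 : HasDerivWithinAt (fun t => z.localCoord q.point (γ.toFun t))
        (-((q.sign : ℤ) : ℂ)) (Icc 0 1) (1 - 0) := by simpa using γ.velocity_target
    have := h1.scomp (0 : ℝ) h fun t ht => ⟨by linarith [ht.2], by linarith [ht.1]⟩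
    simpa [Function.comp_def] using this
  velocity_target := by
    have h : HasDerivWithinAt (fun t : ℝ => 1 - t) (-1) (Icc 0 1) 1 :=
      ((hasDerivAt_id (1 : ℝ)).const_sub 1).hasDerivWithinAt
    have h1 : HasDerivWithinAt (fun t => z.localCoord p.point (γ.toFun t))
        (((p.sign : ℤ) : ℂ)) (Icc 0 1) (1 - 1) := by simpa using γ.velocity_source
    have := h1.scomp (1 : ℝ) h fun t ht => ⟨by linarith [ht.2], by linarith [ht.1]⟩
    simpa [Function.comp_def] using this
  mem_punctured t ht := γ.mem_punctured _ ⟨by linarith [ht.2], by linarith [ht.1]⟩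

theorem contMDiffAt_toFun (γ : TangentialPath z p q) {t : ℝ} (ht : t ∈ Ioo (0 : ℝ) 1) :
    ContMDiffAt 𝓘(ℝ, ℝ) 𝓘(ℝ, ℂ) ∞ γ.toFun t :=
  γ.smooth.contMDiffAt (Icc_mem_nhds ht.1 ht.2)

theorem contDiffOn_plane (γ : TangentialPath z p q) : ContDiffOn ℝ ∞ γ.plane (Ioo 0 1) := by
  intro t ht
  have h1 := contMDiffAt_real_of_complex
    (z.holo_z (γ.toFun t) (ne_infty_of_notMem z (γ.mem_punctured t ht)))
  have h2 := h1.comp t (γ.contMDiffAt_toFun ht)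
  exact (contMDiffAt_iff_contDiffAt.1 h2).contDiffWithinAt

theorem isBigO_source (γ : TangentialPath z p q) :
    (fun t : ℝ => loc (z.center p.point) (γ.plane t) - ((p.sign : ℤ) : ℂ) * t)
      =O[𝓝[>] 0] fun t : ℝ => t ^ 2 := by
  have hsm : ContMDiffWithinAt 𝓘(ℝ, ℝ) 𝓘(ℝ, ℂ) ∞ γ.toFun (Icc 0 1) 0 :=
    γ.smooth 0 ⟨le_rfl, zero_le_one⟩
  have key : ContMDiffAt 𝓘(ℝ, ℂ) 𝓘(ℝ, ℂ) ∞ (z.localCoord p.point) (γ.toFun 0) := by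
    rw [γ.source]
    cases hp : p.point with
    | none => exact contMDiffAt_real_of_complex (z.holo_w _ (by rw [z.map_infty]; simp))
    | some s => exact contMDiffAt_real_of_complex (z.holo_z _ (mark_some_ne_infty z s))
  have h1 : ContDiffWithinAt ℝ ∞ (fun t => z.localCoord p.point (γ.toFun t)) (Icc 0 1) 0 :=
    contMDiffWithinAt_iff_contDiffWithinAt.1 (key.comp_contMDiffWithinAt 0 hsm)
  have h2 := isBigO_sq_of_contDiffWithinAt (by exact_mod_cast contDiffWithinAt_infty.1 h1 2) γ.velocity_source
  refine h2.congr_left fun t => ?_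
  rw [γ.source]
  cases hp : p.point with
  | none =>
    -- At infinity the local coordinate takes the right value `0` at the marked point because of the
    -- conventions `affine ∞ = 0` and `0⁻¹ = 0`.
    simp only [AdmissibleCoord.localCoord, AdmissibleCoord.center, loc, plane, Option.map_none,
      AdmissibleCoord.coord, z.map_infty]
    simp [affine]
  | some s => rfl

theorem isTangentialCurve (γ : TangentialPath z p q) :
    IsTangentialCurve z.pos γ.plane (z.center p.point) ((p.sign : ℤ) : ℂ) (z.center q.point)
      ((q.sign : ℤ) : ℂ) where
  contDiffOn := γ.contDiffOn_plane.of_le (by exact_mod_cast le_top)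
  avoids t ht s := coord_ne_pos z (γ.mem_punctured t ht) s
  source_ne := by simp
  target_ne := by simp
  source := γ.isBigO_source
  target := γ.reverse.isBigO_source

end TangentialPath

end GenusZero

namespace GenusZero

/-! ### Construction of tangential paths -/

/-- Two points of a connected open set are joined by a smooth curve that is constant near the
ends. -/
theorem exists_smooth_join {U : Set ℂ} (hU : IsOpen U) (hU' : IsPreconnected U) {x y : ℂ}
    (hx : x ∈ U) (hy : y ∈ U) :
    ∃ m : ℝ → ℂ, ContDiff ℝ ∞ m ∧ (∀ t, m t ∈ U) ∧ (∀ t ≤ 0, m t = x) ∧ ∀ t, 1 ≤ t → m t = y := by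
  refine hU'.induction₂' (fun x y => ∃ m : ℝ → ℂ, ContDiff ℝ ∞ m ∧ (∀ t, m t ∈ U) ∧
    (∀ t ≤ 0, m t = x) ∧ ∀ t, 1 ≤ t → m t = y) (fun x hx => ?_) ?_ hx hy
  · obtain ⟨r, hr, hsub⟩ := Metric.isOpen_iff.1 hU x hx
    have key : ∀ x' y', x' ∈ Metric.ball x r → y' ∈ Metric.ball x r → ∃ m : ℝ → ℂ,
        ContDiff ℝ ∞ m ∧ (∀ t, m t ∈ U) ∧ (∀ t ≤ 0, m t = x') ∧ ∀ t, 1 ≤ t → m t = y' := by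
      intro x' y' hx' hy'
      refine ⟨fun t => x' + Real.smoothTransition t • (y' - x'),
        contDiff_const.add (Real.smoothTransition.contDiff.smul contDiff_const), fun t => hsub ?_,
        fun t ht => ?_, fun t ht => ?_⟩
      · exact (convex_ball x r).add_smul_sub_mem hx' hy'
          ⟨Real.smoothTransition.nonneg t, Real.smoothTransition.le_one t⟩
      · simp [Real.smoothTransition.zero_of_nonpos ht]
      · simp [Real.smoothTransition.one_of_one_le ht]
    filter_upwards [mem_nhdsWithin_of_mem_nhds (Metric.ball_mem_nhds x hr)] with y hy
    exact ⟨key x y (Metric.mem_ball_self hr) hy, key y x hy (Metric.mem_ball_self hr)⟩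
  · rintro x y w - - - ⟨m, hm, hmU, hm0, hm1⟩ ⟨m', hm', hmU', hm0', hm1'⟩
    -- At every time at least one of the two summands equals `y`, so the formula follows `m` and
    -- then `m'` and is smooth without any gluing.
    refine ⟨fun t => m (3 * t) + m' (3 * t - 2) - y, ?_, fun t => ?_, fun t ht => ?_, fun t ht => ?_⟩
    · exact ((hm.comp (by fun_prop)).add (hm'.comp (by fun_prop))).sub contDiff_const
    · rcases le_total t (2 / 3) with h | h
      · simpa only [hm0' (3 * t - 2) (by linarith), add_sub_cancel_right] using hmU _
      · simpa only [hm1 (3 * t) (by linarith), add_sub_cancel_left] using hmU' _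
    · simp only [hm0 (3 * t) (by linarith), hm0' (3 * t - 2) (by linarith), add_sub_cancel_right]
    · simp only [hm1 (3 * t) (by linarith), hm1' (3 * t - 2) (by linarith), add_sub_cancel_left]

/-- A smooth function that is the identity near `0` and constant later. -/
def legFun (ρ t : ℝ) : ℝ :=
  (1 - Real.smoothTransition (2 / ρ * t - 1)) * t + Real.smoothTransition (2 / ρ * t - 1) * ρ

theorem contDiff_legFun (ρ : ℝ) : ContDiff ℝ ∞ (legFun ρ) := by
  have h : ContDiff ℝ ∞ fun t => Real.smoothTransition (2 / ρ * t - 1) :=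
    Real.smoothTransition.contDiff.comp (by fun_prop)
  exact ((contDiff_const.sub h).mul contDiff_id).add (h.mul contDiff_const)

theorem legFun_of_le {ρ t : ℝ} (hρ : 0 < ρ) (ht : t ≤ ρ / 2) : legFun ρ t = t := by
  have : 2 / ρ * t ≤ 1 := by
    rw [div_mul_eq_mul_div, div_le_one hρ]; linarith
  rw [legFun, Real.smoothTransition.zero_of_nonpos (by linarith)]
  ring

theorem legFun_of_ge {ρ t : ℝ} (hρ : 0 < ρ) (ht : ρ ≤ t) : legFun ρ t = ρ := by
  have : 2 ≤ 2 / ρ * t := by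
    rw [div_mul_eq_mul_div, le_div_iff₀ hρ]; linarith
  rw [legFun, Real.smoothTransition.one_of_one_le (by linarith)]
  ring

theorem legFun_mem {ρ t : ℝ} (hρ : 0 < ρ) (ht : 0 < t) : legFun ρ t ∈ Ioc 0 ρ := by
  rcases le_total ρ t with h | h
  · rw [legFun_of_ge hρ h]; exact ⟨hρ, le_rfl⟩
  · have h0 := Real.smoothTransition.nonneg (2 / ρ * t - 1)
    have h1 := Real.smoothTransition.le_one (2 / ρ * t - 1)
    rw [legFun]
    set s := Real.smoothTransition (2 / ρ * t - 1)
    constructor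
    · nlinarith [mul_nonneg h0 (sub_nonneg.2 h)]
    · nlinarith [mul_nonneg (sub_nonneg.2 h1) (sub_nonneg.2 h)]

variable {X : Type*} [TopologicalSpace X] [ChartedSpace ℂ X] {S : Type*} {C : MarkedCurve X S}
  (z : AdmissibleCoord C)

/-- The inverse of the local coordinate at a marked point, as a map to the curve. -/
def localInv : Option S → ℂ → X
  | some s => fun u => z.toHomeo.symm ((z.pos s + u : ℂ) : OnePoint ℂ)
  | none => fun u => z.toHomeo.symm (ofInv u)

theorem contMDiffAt_real_localInv (P : Option S) (u : ℂ) :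
    ContMDiffAt 𝓘(ℝ, ℂ) 𝓘(ℝ, ℂ) ∞ (localInv z P) u := by
  cases P with
  | none => exact contMDiffAt_real_of_complex (z.holo_symm_w u)
  | some s =>
    have h : ContMDiffAt 𝓘(ℂ, ℂ) 𝓘(ℂ, ℂ) ω (fun u : ℂ => z.pos s + u) u :=
      contMDiffAt_iff_contDiffAt.2 (by fun_prop)
    exact contMDiffAt_real_of_complex ((z.holo_symm_z (z.pos s + u)).comp u h)

theorem localInv_zero (P : Option S) : localInv z P 0 = C.mark P := by
  cases P with
  | none => simp [localInv, ofInv, ← z.map_infty]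
  | some s => simp [localInv, coe_pos]

theorem localInv_eq (P : Option S) {u : ℂ} (hu : u ≠ 0) :
    localInv z P u = z.toHomeo.symm ((chart (z.center P) u : ℂ) : OnePoint ℂ) := by
  cases P with
  | none => simp [localInv, ofInv, hu, AdmissibleCoord.center, chart]
  | some s => rfl

theorem localCoord_localInv (P : Option S) (u : ℂ) :
    z.localCoord P (localInv z P u) = z.localCoord P (C.mark P) + u := by
  cases P with
  | none =>
    have h : affine (ofInv u) = u⁻¹ := by
      by_cases hu : u = 0
      · simp [ofInv, hu, affine]
      · simp [ofInv, hu]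
    simp only [AdmissibleCoord.localCoord, AdmissibleCoord.coord, localInv, z.map_infty,
      Homeomorph.apply_symm_apply, h]
    simp [affine]
  | some s =>
    simp [AdmissibleCoord.localCoord, AdmissibleCoord.coord, localInv, AdmissibleCoord.pos]

/-- The path is a straight leg in the local coordinate at `p`, a smooth curve in `U`, and a reversed
leg at `q`. Neighbouring pieces are constant and equal on a common time interval, so the
concatenation is smooth. -/
theorem exists_tangentialPath {U : Set ℂ} (hU : IsOpen U) (hU' : IsPreconnected U)
    (hav : ∀ x ∈ U, ∀ s, x ≠ z.pos s) (p q : TangentialBasePoint S)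
    (hp : ∀ᶠ ρ : ℝ in 𝓝[>] 0, chart (z.center p.point) (((p.sign : ℤ) : ℂ) * ρ) ∈ U)
    (hq : ∀ᶠ ρ : ℝ in 𝓝[>] 0, chart (z.center q.point) (((q.sign : ℤ) : ℂ) * ρ) ∈ U) :
    ∃ γ : TangentialPath z p q, ∀ t ∈ Ioo (0 : ℝ) 1, γ.plane t ∈ U := by
  obtain ⟨δ, hδ, hd⟩ := eventually_one_sub (hp.and hq)
  -- `ρ < δ` keeps the legs in `U`; `ρ ≤ 1/4` makes them stationary on `[1/4, 3/4]`, which contains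
  -- both switching times `1/3` and `2/3`.
  set ρ := min (δ / 2) (1 / 4) with hρdef
  have hρ : 0 < ρ := lt_min (half_pos hδ.1) (by norm_num)
  have hρ4 : ρ ≤ 1 / 4 := min_le_right _ _
  have hρδ : ρ < δ := (min_le_left _ _).trans_lt (half_lt_self hδ.1)
  have hleg : ∀ t : ℝ, 0 < t → legFun ρ t ∈ Ioo 0 δ := fun t ht =>
    ⟨(legFun_mem hρ ht).1, (legFun_mem hρ ht).2.trans_lt hρδ⟩
  obtain ⟨m, hm, hmU, hm0, hm1⟩ := exists_smooth_join hU hU' (hd ρ ⟨hρ, hρδ⟩).1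
    (hd ρ ⟨hρ, hρδ⟩).2
  have hsgn : ∀ ε : ℤˣ, ((ε : ℤ) : ℂ) ≠ 0 := fun ε => by simp
  set A : ℝ → X := fun t => localInv z p.point (((p.sign : ℤ) : ℂ) * (legFun ρ t : ℝ)) with hA
  set B : ℝ → X := fun t => z.toHomeo.symm ((m (3 * t - 1) : ℂ) : OnePoint ℂ) with hB
  set D : ℝ → X := fun t => localInv z q.point (((q.sign : ℤ) : ℂ) * (legFun ρ (1 - t) : ℝ)) with hD
  set g : ℝ → X := fun t => if t ≤ 1 / 3 then A t else if t < 2 / 3 then B t else D t with hg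
  have hgA : ∀ t ≤ 1 / 3, g t = A t := fun t ht => if_pos ht
  have hAB : ∀ t, 1 / 4 ≤ t → t ≤ 1 / 3 → A t = B t := by
    intro t h1 h2
    simp only [hA, hB]
    rw [legFun_of_ge hρ (by linarith), hm0 _ (by linarith), localInv_eq]
    exact mul_ne_zero (hsgn _) (by exact_mod_cast hρ.ne')
  have hDB : ∀ t, 2 / 3 ≤ t → t ≤ 3 / 4 → D t = B t := by
    intro t h1 h2
    simp only [hD, hB]
    rw [legFun_of_ge hρ (by linarith), hm1 _ (by linarith), localInv_eq]
    exact mul_ne_zero (hsgn _) (by exact_mod_cast hρ.ne')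
  have hgB : ∀ t, 1 / 4 ≤ t → t ≤ 3 / 4 → g t = B t := by
    intro t h1 h2
    simp only [hg]
    split_ifs with h3 h4
    · exact hAB t h1 h3
    · rfl
    · exact hDB t (not_lt.1 h4) h2
  have hgD : ∀ t, 2 / 3 ≤ t → g t = D t := by
    intro t h
    simp only [hg]
    rw [if_neg (by linarith), if_neg (by linarith)]
  have hAs : ∀ t, ContMDiffAt 𝓘(ℝ, ℝ) 𝓘(ℝ, ℂ) ∞ A t := by
    intro t
    have h : ContDiff ℝ ∞ fun t : ℝ => ((p.sign : ℤ) : ℂ) * (legFun ρ t : ℝ) :=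
      contDiff_const.mul (Complex.ofRealCLM.contDiff.comp (contDiff_legFun ρ))
    exact (contMDiffAt_real_localInv z p.point _).comp t
      (contMDiffAt_iff_contDiffAt.2 h.contDiffAt)
  have hDs : ∀ t, ContMDiffAt 𝓘(ℝ, ℝ) 𝓘(ℝ, ℂ) ∞ D t := by
    intro t
    have h : ContDiff ℝ ∞ fun t : ℝ => ((q.sign : ℤ) : ℂ) * (legFun ρ (1 - t) : ℝ) :=
      contDiff_const.mul (Complex.ofRealCLM.contDiff.comp ((contDiff_legFun ρ).comp (by fun_prop)))
    exact (contMDiffAt_real_localInv z q.point _).comp t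
      (contMDiffAt_iff_contDiffAt.2 h.contDiffAt)
  have hBs : ∀ t, ContMDiffAt 𝓘(ℝ, ℝ) 𝓘(ℝ, ℂ) ∞ B t := by
    intro t
    have h : ContDiff ℝ ∞ fun t : ℝ => m (3 * t - 1) := hm.comp (by fun_prop)
    exact ContMDiffAt.comp (g := fun u : ℂ => z.toHomeo.symm (u : OnePoint ℂ))
      (f := fun t : ℝ => m (3 * t - 1)) t
      (contMDiffAt_real_of_complex (z.holo_symm_z (m (3 * t - 1))))
      (contMDiffAt_iff_contDiffAt.2 h.contDiffAt)
  have hgs : ∀ t, ContMDiffAt 𝓘(ℝ, ℝ) 𝓘(ℝ, ℂ) ∞ g t := by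
    intro t
    rcases lt_or_ge t (1 / 3) with h | h
    · refine (hAs t).congr_of_eventuallyEq ?_
      filter_upwards [Iio_mem_nhds h] with s hs using hgA s (le_of_lt hs)
    · rcases lt_or_ge t (3 / 4) with h' | h'
      · refine (hBs t).congr_of_eventuallyEq ?_
        filter_upwards [Ioo_mem_nhds (show (1 / 4 : ℝ) < t by linarith) h'] with s hs
          using hgB s hs.1.le hs.2.le
      · refine (hDs t).congr_of_eventuallyEq ?_
        filter_upwards [Ioi_mem_nhds (show (2 / 3 : ℝ) < t by linarith)] with s hs
          using hgD s (le_of_lt hs)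
  have hval : ∀ t ∈ Ioo (0 : ℝ) 1, ∃ x ∈ U, g t = z.toHomeo.symm ((x : ℂ) : OnePoint ℂ) := by
    intro t ht
    rcases le_or_gt t (1 / 3) with h | h
    · refine ⟨_, (hd _ (hleg t ht.1)).1, ?_⟩
      rw [hgA t h]
      exact localInv_eq z _ (mul_ne_zero (hsgn _) (by exact_mod_cast (hleg t ht.1).1.ne'))
    · rcases lt_or_ge t (2 / 3) with h' | h'
      · exact ⟨_, hmU (3 * t - 1), hgB t (by linarith) (by linarith)⟩
      · have ht' : 0 < 1 - t := by linarith [ht.2]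
        refine ⟨_, (hd _ (hleg (1 - t) ht')).2, ?_⟩
        rw [hgD t h']
        exact localInv_eq z _ (mul_ne_zero (hsgn _) (by exact_mod_cast (hleg _ ht').1.ne'))
  have hleg0 : HasDerivAt (fun t : ℝ => ((legFun ρ t : ℝ) : ℂ)) 1 0 := by
    refine (Complex.ofRealCLM.hasDerivAt (x := (0 : ℝ))).congr_of_eventuallyEq ?_
    filter_upwards [Iio_mem_nhds (half_pos hρ)] with t ht
    rw [legFun_of_le hρ (le_of_lt ht)]; rfl
  refine ⟨{ toFun := g
            smooth := fun t _ => (hgs t).contMDiffWithinAt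
            source := ?_
            target := ?_
            velocity_source := ?_
            velocity_target := ?_
            mem_punctured := ?_ }, ?_⟩
  · rw [hgA 0 (by norm_num)]
    simp only [hA]
    rw [legFun_of_le hρ (by positivity), Complex.ofReal_zero, mul_zero, localInv_zero]
  · rw [hgD 1 (by norm_num)]
    simp only [hD]
    rw [sub_self, legFun_of_le hρ (by positivity), Complex.ofReal_zero, mul_zero, localInv_zero]
  · have h := (hleg0.const_mul ((p.sign : ℤ) : ℂ)).const_add
      (z.localCoord p.point (C.mark p.point))
    rw [mul_one] at h
    refine (h.congr_of_eventuallyEq ?_).hasDerivWithinAt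
    filter_upwards [Iio_mem_nhds (show (0 : ℝ) < 1 / 3 by norm_num)] with t ht
    rw [hgA t (le_of_lt ht)]
    exact localCoord_localInv z _ _
  · have h0 : HasDerivAt (fun t : ℝ => ((legFun ρ (1 - t) : ℝ) : ℂ)) (-1) 1 := by
      have h1 : HasDerivAt (fun t : ℝ => ((legFun ρ t : ℝ) : ℂ)) 1 (1 - 1) := by
        rw [sub_self]; exact hleg0
      have := h1.scomp (1 : ℝ) ((hasDerivAt_id (1 : ℝ)).const_sub 1)
      simpa [Function.comp_def] using this
    have h := (h0.const_mul ((q.sign : ℤ) : ℂ)).const_add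
      (z.localCoord q.point (C.mark q.point))
    rw [mul_neg_one] at h
    refine (h.congr_of_eventuallyEq ?_).hasDerivWithinAt
    filter_upwards [Ioi_mem_nhds (show (2 / 3 : ℝ) < 1 by norm_num)] with t ht
    rw [hgD t (le_of_lt ht)]
    exact localCoord_localInv z _ _
  · intro t ht
    obtain ⟨x, hx, e⟩ := hval t ht
    rw [e]
    refine notMem_range_mark z (by simp) fun s => ?_
    simpa [AdmissibleCoord.coord] using hav x hx s
  · intro t ht
    obtain ⟨x, hx, e⟩ := hval t ht
    simp only [TangentialPath.plane, AdmissibleCoord.coord]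
    rw [e]
    simpa using hx

end GenusZero

namespace GenusZero
open scoped Matrix.Norms.Operator

/-! ### The plane cut along rays -/

theorem ofReal_mul_mem_slitPlane {r : ℝ} (hr : 0 < r) {w : ℂ} :
    (r : ℂ) * w ∈ Complex.slitPlane ↔ w ∈ Complex.slitPlane := by
  rw [Complex.mem_slitPlane_iff, Complex.mem_slitPlane_iff, Complex.re_ofReal_mul,
    Complex.im_ofReal_mul, mul_pos_iff_of_pos_left hr, mul_ne_zero_iff_left hr.ne']

theorem dense_slitPlane : Dense Complex.slitPlane := by
  intro x
  have h : Tendsto (fun t : ℝ => x + t * Complex.I) (𝓝[>] 0) (𝓝 x) := by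
    have : Continuous fun t : ℝ => x + t * Complex.I := by fun_prop
    simpa using (this.tendsto 0).mono_left nhdsWithin_le_nhds
  refine mem_closure_of_tendsto h ?_
  have hne : ∀ᶠ t : ℝ in 𝓝[>] 0, t ≠ -x.im := by
    rcases eq_or_ne x.im 0 with hx | hx
    · filter_upwards [self_mem_nhdsWithin] with t (ht : 0 < t)
      rw [hx, neg_zero]; exact ht.ne'
    · exact (eventually_ne_nhds (by simpa [eq_comm] using hx)).filter_mono nhdsWithin_le_nhds
  filter_upwards [hne] with t ht
  rw [Complex.mem_slitPlane_iff]
  right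
  simp only [Complex.add_im, Complex.mul_im, Complex.ofReal_re, Complex.I_im, mul_one,
    Complex.ofReal_im, Complex.I_re, mul_zero, add_zero]
  intro h
  exact ht (by linarith)

theorem mem_slitPlane_of_im_ne {w : ℂ} (h : w.im ≠ 0) : w ∈ Complex.slitPlane :=
  Complex.mem_slitPlane_iff.2 (Or.inr h)

section Cut

variable {S : Type*} {pos : S → ℂ} {b : ℂ}

/-- The base point `b` lies above all positions and off the lines through two of them. -/
structure IsGenericBase (pos : S → ℂ) (b : ℂ) : Prop where
  im_lt : ∀ s, (pos s).im < b.im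
  im_ne : ∀ s s', s ≠ s' → ((pos s - b) / (pos s' - b)).im ≠ 0

/-- On a horizontal line above all positions, each line through two positions excludes at most one
point, so only finitely many real parts are forbidden. -/
theorem exists_genericBase [Finite S] (hpos : Function.Injective pos) :
    ∃ b, IsGenericBase pos b := by
  obtain ⟨y, hy⟩ : ∃ y : ℝ, ∀ s, (pos s).im < y := by
    obtain ⟨M, hM⟩ := (Set.finite_range fun s => (pos s).im).bddAbove
    exact ⟨M + 1, fun s => (hM ⟨s, rfl⟩).trans_lt (lt_add_one M)⟩
  have hbad : ∀ q : S × S, {x : ℝ | q.1 ≠ q.2 ∧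
      ((pos q.1 - (x + y * Complex.I)) / (pos q.2 - (x + y * Complex.I))).im = 0}.Finite := by
    rintro ⟨s, s'⟩
    refine Set.Subsingleton.finite fun x₁ h₁ x₂ h₂ => ?_
    have key : ∀ x : ℝ, ((pos s - (x + y * Complex.I)) / (pos s' - (x + y * Complex.I))).im = 0 →
        ((pos s).im - y) * ((pos s').re - x) = ((pos s).re - x) * ((pos s').im - y) := by
      intro x hx
      have hw : pos s' - (x + y * Complex.I) ≠ 0 := by
        intro h
        have := congrArg Complex.im h
        simp at this
        linarith [hy s']
      rw [Complex.div_im, ← sub_div, div_eq_zero_iff] at hx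
      rcases hx with hx | hx
      · simp at hx
        linarith
      · exact absurd (Complex.normSq_eq_zero.1 hx) hw
    have e₁ := key x₁ h₁.2
    have e₂ := key x₂ h₂.2
    have e : ((pos s').im - (pos s).im) * (x₁ - x₂) = 0 := by linarith
    rcases mul_eq_zero.1 e with h | h
    · exfalso
      have him : (pos s).im = (pos s').im := by linarith
      have h3 : ((pos s').im - y) * ((pos s').re - (pos s).re) = 0 := by
        rw [him] at e₁; linarith
      rcases mul_eq_zero.1 h3 with h4 | h4
      · linarith [hy s']
      · exact h₁.1 (hpos (Complex.ext (by linarith) him))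
    · linarith
  have hfin : (⋃ q : S × S, {x : ℝ | q.1 ≠ q.2 ∧
      ((pos q.1 - (x + y * Complex.I)) / (pos q.2 - (x + y * Complex.I))).im = 0}).Finite :=
    Set.finite_iUnion hbad
  obtain ⟨x, hx⟩ := hfin.infinite_compl.nonempty
  simp only [mem_compl_iff, mem_iUnion, not_exists] at hx
  refine ⟨x + y * Complex.I, fun s => by simpa using hy s, fun s s' hs h => hx (s, s') ⟨hs, h⟩⟩

/-- The complement of the rays emanating from the given positions in the direction away from
`b`. -/
def cutPlane (pos : S → ℂ) (b : ℂ) : Set ℂ :=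
  {x | ∀ s, (x - pos s) / (b - pos s) ∈ Complex.slitPlane}

namespace IsGenericBase

variable (hb : IsGenericBase pos b)
include hb

theorem sub_ne (s : S) : b - pos s ≠ 0 := by
  intro h
  have := congrArg Complex.im h
  simp at this
  linarith [hb.im_lt s]

theorem mem_cutPlane : b ∈ cutPlane pos b := fun s => by
  rw [div_self (hb.sub_ne s)]; exact Complex.one_mem_slitPlane

theorem starConvex_cutPlane : StarConvex ℝ b (cutPlane pos b) := by
  intro x hx t t' ht ht' htt s
  have h := Complex.starConvex_one_slitPlane (hx s) ht ht' htt
  convert! h using 1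
  have h1 := hb.sub_ne s
  have h2 : (t' : ℂ) = 1 - t := by
    rw [eq_sub_iff_add_eq, add_comm]; exact_mod_cast htt
  simp only [Complex.real_smul, h2]
  field_simp
  ring

theorem isPreconnected_cutPlane : IsPreconnected (cutPlane pos b) :=
  (hb.starConvex_cutPlane.isPathConnected hb.mem_cutPlane).isConnected.isPreconnected

omit hb in
theorem ne_of_mem_cutPlane {x : ℂ} (hx : x ∈ cutPlane pos b) (s : S) : x ≠ pos s := by
  rintro rfl
  have := Complex.slitPlane_ne_zero (hx s)
  simp at this

omit hb in
theorem isOpen_cutPlane [Finite S] : IsOpen (cutPlane pos b) := by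
  rw [cutPlane, ofPred_forall]
  exact isOpen_iInter_of_finite fun s => Complex.isOpen_slitPlane.preimage (by fun_prop)

theorem dense_cutPlane [Finite S] : Dense (cutPlane pos b) := by
  rw [cutPlane, ofPred_forall]
  refine dense_iInter_of_isOpen (fun s => Complex.isOpen_slitPlane.preimage (by fun_prop))
    fun s => ?_
  have hβ := hb.sub_ne s
  refine dense_slitPlane.preimage (f := fun x => (x - pos s) / (b - pos s)) ?_
  have h : (fun x => (x - pos s) / (b - pos s))
      = (Homeomorph.mulRight₀ (b - pos s)⁻¹ (inv_ne_zero hβ)) ∘ (Homeomorph.subRight (pos s)) := by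
    funext x; simp [div_eq_mul_inv]
  rw [h]
  exact (Homeomorph.isOpenMap _).comp (Homeomorph.isOpenMap _)

/-- No marked point lies on the cut of another one, because `b` is off the lines joining them. -/
theorem im_sub_div_ne {s s' : S} (h : s ≠ s') : ((pos s - pos s') / (b - pos s')).im ≠ 0 := by
  have h1 := hb.sub_ne s'
  have h2 : pos s' - b ≠ 0 := fun e => h1 (by rw [← neg_sub, e, neg_zero])
  have e : (pos s - pos s') / (b - pos s') = 1 - (pos s - b) / (pos s' - b) := by
    field_simp
    ring
  rw [e, Complex.sub_im, Complex.one_im, zero_sub, neg_ne_zero]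
  exact hb.im_ne s s' h

/-- Tangent vectors are real while `b - pos s` is not, so no tangential base point is directed along
a cut. -/
theorem im_div_ne {σ : ℂ} (hσ : σ ≠ 0) (hσr : σ.im = 0) (s : S) : (σ / (b - pos s)).im ≠ 0 := by
  have h1 : σ.re ≠ 0 := fun h => hσ (Complex.ext h hσr)
  have h2 : (b - pos s).im ≠ 0 := by
    simp only [Complex.sub_im]; linarith [hb.im_lt s]
  have h3 : Complex.normSq (b - pos s) ≠ 0 := fun h => hb.sub_ne s (Complex.normSq_eq_zero.1 h)
  rw [Complex.div_im, hσr, zero_mul, zero_div, zero_sub, neg_ne_zero]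
  exact div_ne_zero (mul_ne_zero h1 h2) h3

end IsGenericBase

/-! ### Legs at the marked points -/

/-- The filter describing approach along a tangent direction: the parameters `(ρ, θ)` stand for
the point with local coordinate `σ ρ θ`. -/
def legFilter : Filter (ℝ × ℂ) := 𝓝[>] 0 ×ˢ 𝓝 1

theorem legFilter_le : legFilter ≤ 𝓝 ((0 : ℝ), (1 : ℂ)) := by
  rw [nhds_prod_eq]
  exact Filter.prod_mono nhdsWithin_le_nhds le_rfl

theorem eventually_pos_legFilter : ∀ᶠ q in legFilter, 0 < q.1 :=
  (tendsto_fst (f := 𝓝[>] (0 : ℝ)) (g := 𝓝 (1 : ℂ))).eventually self_mem_nhdsWithin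

theorem eventually_ne_legFilter : ∀ᶠ q in legFilter, q.2 ≠ 0 :=
  (tendsto_snd (f := 𝓝[>] (0 : ℝ)) (g := 𝓝 (1 : ℂ))).eventually_ne one_ne_zero

/-- The point with parameters `(ρ, θ)` near a point of the sphere. -/
def legPoint (c : Option ℂ) (σ : ℂ) (q : ℝ × ℂ) : ℂ := chart c (σ * q.1 * q.2)

/-- The slit plane is invariant under positive scaling. Where needed, a factor `ρ` (at the same
point) or `ρ⁻¹` (at infinity) is removed; the quotient then has a nonreal limit, and nonreal numbers
are interior to the slit plane. -/
theorem eventually_legPoint_mem_cutPlane [Finite S] (hb : IsGenericBase pos b) (P : Option S)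
    {σ : ℂ} (hσ : σ ≠ 0) (hσr : σ.im = 0) :
    ∀ᶠ q in legFilter, legPoint (P.map pos) σ q ∈ cutPlane pos b := by
  simp only [cutPlane, mem_ofPred_eq]
  rw [eventually_all]
  intro s
  have hβ := hb.sub_ne s
  cases P with
  | some s' =>
    by_cases hs : s' = s
    · subst hs
      have hc : ContinuousAt (fun q : ℝ × ℂ => σ * q.2 / (b - pos s')) (0, 1) := by fun_prop
      have := hc.eventually (Complex.isOpen_slitPlane.mem_nhds (by
        simpa using mem_slitPlane_of_im_ne (hb.im_div_ne hσ hσr s')))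
      filter_upwards [legFilter_le this, eventually_pos_legFilter] with q hq hq0
      convert! (ofReal_mul_mem_slitPlane hq0).2 hq using 1
      simp only [legPoint, chart, Option.map_some]
      ring
    · have hc : ContinuousAt (fun q : ℝ × ℂ => (pos s' + σ * q.1 * q.2 - pos s) / (b - pos s))
          (0, 1) := by fun_prop
      exact legFilter_le (hc.eventually (Complex.isOpen_slitPlane.mem_nhds (by
        simpa using mem_slitPlane_of_im_ne (hb.im_sub_div_ne hs))))
  | none =>
    have hc : ContinuousAt (fun q : ℝ × ℂ => ((σ * q.2)⁻¹ - q.1 * pos s) / (b - pos s)) (0, 1) := by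
      have : ContinuousAt (fun q : ℝ × ℂ => (σ * q.2)⁻¹) (0, 1) :=
        ContinuousAt.inv₀ (by fun_prop) (by simpa using hσ)
      fun_prop
    have := hc.eventually (Complex.isOpen_slitPlane.mem_nhds (by
        simpa using mem_slitPlane_of_im_ne (hb.im_div_ne (inv_ne_zero hσ)
          (by rw [Complex.inv_im, hσr]; simp) s)))
    filter_upwards [legFilter_le this, eventually_pos_legFilter, eventually_ne_legFilter]
      with q hq hq0 hq1
    convert! (ofReal_mul_mem_slitPlane (inv_pos.2 hq0)).2 hq using 1
    have : (q.1 : ℂ) ≠ 0 := by exact_mod_cast hq0.ne'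
    simp only [legPoint, chart, Option.map_none]
    push_cast
    field_simp

end Cut

variable {n : ℕ} {a : ℕ → ℂ}

theorem loc_legPoint (c : Option ℂ) (σ : ℂ) (q : ℝ × ℂ) : loc c (legPoint c σ q) = σ * q.1 * q.2 :=
  loc_chart _ _

theorem eventually_legPoint_mem_normDom (c : Option ℂ) {σ : ℂ} (hσ : σ ≠ 0) :
    ∀ᶠ q in legFilter, legPoint c σ q ∈ normDom n a c σ := by
  have h1 : ContinuousAt (fun q : ℝ × ℂ => σ * q.1 * q.2) (0, 1) := by fun_prop
  have h1' := legFilter_le (h1.eventually (Metric.ball_mem_nhds _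
    (normRadius_pos (n := n) (a := a) (c := c))))
  have h2 : ContinuousAt (fun q : ℝ × ℂ => q.2) (0, 1) := by fun_prop
  have h2' := legFilter_le (h2.eventually (Complex.isOpen_slitPlane.mem_nhds
    (by simp : ((0 : ℝ), (1 : ℂ)).2 ∈ Complex.slitPlane)))
  filter_upwards [h1', h2', eventually_pos_legFilter] with q hq hq' hq0
  refine ⟨?_, ?_⟩
  · rw [loc_legPoint]; simpa using hq
  · rw [loc_legPoint, mul_assoc, mul_div_cancel_left₀ _ hσ, ofReal_mul_mem_slitPlane hq0]
    exact hq'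

/-- The derivative of the inverse of the local coordinate. -/
theorem differentiableAt_chart (c : Option ℂ) {u : ℂ} (hu : u ≠ 0) :
    DifferentiableAt ℂ (chart c) u := by
  cases c with
  | some c => exact (differentiableAt_id.const_add c)
  | none => exact differentiableAt_inv hu

/-- A flat section equals `Λ T` along a leg, for the normalized local section `Λ`. -/
def LegEq (n : ℕ) (a : ℕ → ℂ) (L : ℂ → Mat n) (c : Option ℂ) (σ : ℂ) (T : Mat n) : Prop :=
  ∀ᶠ q in legFilter, L (legPoint c σ q) = normSec n a c σ (legPoint c σ q) * T

theorem exists_box_of_eventually {p : ℝ × ℂ → Prop} (h : ∀ᶠ q in legFilter, p q) :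
    ∃ r > 0, ∃ η > 0, ∀ ρ ∈ Ioo (0 : ℝ) r, ∀ θ ∈ Metric.ball (1 : ℂ) η, p (ρ, θ) := by
  obtain ⟨⟨r, η⟩, ⟨hr, hη⟩, hsub⟩ :=
    (((nhdsGT_basis (0 : ℝ)).prod (Metric.nhds_basis_ball (x := (1 : ℂ)))).eventually_iff).1 h
  exact ⟨r, hr, η, hη, fun ρ hρ θ hθ => hsub (x := (ρ, θ)) ⟨hρ, hθ⟩⟩

/-- Letting `θ` vary in a complex disc thickens the ray to a connected open set of local
coordinates, on which two flat sections differ by a constant. On the ray alone complex derivatives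
would not be available. -/
theorem exists_flat_eq_on_leg {c : Option ℂ} {σ : ℂ} (hσ : σ ≠ 0) {X Y : ℂ → Mat n}
    (hX : ∀ᶠ q in legFilter, HasDerivAt X (conn n a (legPoint c σ q) * X (legPoint c σ q))
      (legPoint c σ q) ∧ IsUnit (X (legPoint c σ q)))
    (hY : ∀ᶠ q in legFilter, HasDerivAt Y (conn n a (legPoint c σ q) * Y (legPoint c σ q))
      (legPoint c σ q)) :
    ∃ T, ∀ᶠ q in legFilter, Y (legPoint c σ q) = X (legPoint c σ q) * T := by
  obtain ⟨r, hr, η, hη, hbox⟩ :=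
    exists_box_of_eventually ((hX.and hY).and eventually_ne_legFilter)
  set f : ℝ × ℂ → ℂ := fun q => σ * q.1 * q.2 with hf
  set W : Set ℂ := f '' (Ioo (0 : ℝ) r ×ˢ Metric.ball (1 : ℂ) η) with hW
  have hWpre : IsPreconnected W := by
    refine (isPreconnected_Ioo.prod (convex_ball 1 η).isPreconnected).image _ ?_
    simp only [hf]; fun_prop
  have hWopen : IsOpen W := by
    have : W = ⋃ ρ ∈ Ioo (0 : ℝ) r, (fun θ : ℂ => (σ * ρ) * θ) '' Metric.ball 1 η := by
      ext x
      simp only [hW, hf, mem_image, mem_prod, Prod.exists, mem_iUnion, exists_prop]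
      constructor
      · rintro ⟨ρ, θ, ⟨h1, h2⟩, rfl⟩; exact ⟨ρ, h1, θ, h2, rfl⟩
      · rintro ⟨ρ, h1, θ, h2, rfl⟩; exact ⟨ρ, θ, ⟨h1, h2⟩, rfl⟩
    rw [this]
    refine isOpen_biUnion fun ρ hρ => ?_
    have hne : σ * (ρ : ℂ) ≠ 0 := mul_ne_zero hσ (by exact_mod_cast hρ.1.ne')
    exact (Homeomorph.mulLeft₀ _ hne).isOpenMap _ Metric.isOpen_ball
  have hWd : ∀ u ∈ W, (HasDerivAt X (conn n a (chart c u) * X (chart c u)) (chart c u) ∧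
      IsUnit (X (chart c u))) ∧ HasDerivAt Y (conn n a (chart c u) * Y (chart c u)) (chart c u) ∧
      u ≠ 0 := by
    rintro _ ⟨⟨ρ, θ⟩, ⟨hρ, hθ⟩, rfl⟩
    have := hbox ρ hρ θ hθ
    refine ⟨this.1.1, this.1.2, mul_ne_zero (mul_ne_zero hσ ?_) this.2⟩
    exact_mod_cast hρ.1.ne'
  obtain ⟨T, hT⟩ := exists_eq_mul_of_flat (𝕜 := ℂ) hWopen hWpre
    (B := fun u => deriv (chart c) u • conn n a (chart c u))
    (X := fun u => X (chart c u)) (Y := fun u => Y (chart c u))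
    (fun u hu => by
      have := (hWd u hu).1.1.scomp u (differentiableAt_chart c (hWd u hu).2.2).hasDerivAt
      convert! this using 1
      rw [smul_mul_assoc])
    (fun u hu => by
      have := (hWd u hu).2.1.scomp u (differentiableAt_chart c (hWd u hu).2.2).hasDerivAt
      convert! this using 1
      rw [smul_mul_assoc])
    (fun u hu => (hWd u hu).1.2)
  refine ⟨T, ?_⟩
  have hmem : Ioo (0 : ℝ) r ×ˢ Metric.ball (1 : ℂ) η ∈ legFilter :=
    prod_mem_prod (Ioo_mem_nhdsGT hr) (Metric.ball_mem_nhds _ hη)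
  filter_upwards [hmem] with q hq using hT _ ⟨q, hq, rfl⟩

theorem tendsto_legFilter {c : Option ℂ} {σ : ℂ} {ζ : ℝ → ℂ} (hσ : σ ≠ 0)
    (h : (fun t => loc c (ζ t) - σ * t) =O[𝓝[>] 0] fun t : ℝ => t ^ 2) :
    Tendsto (fun t : ℝ => (t, loc c (ζ t) / (σ * t))) (𝓝[>] 0) legFilter :=
  Tendsto.prodMk tendsto_id (tendsto_one_of_isBigO (tendsto_loc_div hσ h))

/-- The curve has leg parameters `ρ = t` and `θ = loc c (ζ t) / (σ t)`, and the latter tends to `1`.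
Hence whatever holds along the leg holds on every curve with that tangent vector. -/
theorem eventually_curve_of_leg {c : Option ℂ} {σ : ℂ} {ζ : ℝ → ℂ} (hσ : σ ≠ 0)
    (h : (fun t => loc c (ζ t) - σ * t) =O[𝓝[>] 0] fun t : ℝ => t ^ 2) {p : ℂ → Prop}
    (hp : ∀ᶠ q in legFilter, p (legPoint c σ q)) : ∀ᶠ t in 𝓝[>] 0, p (ζ t) := by
  filter_upwards [(tendsto_legFilter hσ h).eventually hp, self_mem_nhdsWithin] with t ht ht0
  have ht0' : (t : ℂ) ≠ 0 := by exact_mod_cast (show 0 < t from ht0).ne'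
  rwa [legPoint, mul_div_cancel₀ _ (mul_ne_zero hσ ht0'), chart_loc] at ht

end GenusZero

namespace GenusZero
open scoped Matrix.Norms.Operator

variable {n : ℕ} {a : ℕ → ℂ}

/-! ### Flat sections on the cut plane and their monodromy -/

/-- An invertible flat section of the connection. -/
def FlatOn (n : ℕ) (a : ℕ → ℂ) (U : Set ℂ) (L : ℂ → Mat n) : Prop :=
  ∀ x ∈ U, HasDerivAt L (conn n a x * L x) x ∧ IsUnit (L x)

theorem FlatOn.mono {U V : Set ℂ} {L : ℂ → Mat n} (h : FlatOn n a V L) (hUV : U ⊆ V) :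
    FlatOn n a U L := fun x hx => h x (hUV hx)

theorem FlatOn.mul_const {U : Set ℂ} {L : ℂ → Mat n} (h : FlatOn n a U L) {T : Mat n}
    (hT : IsUnit T) : FlatOn n a U fun x => L x * T := fun x hx => by
  refine ⟨?_, (h x hx).2.mul hT⟩
  have := (h x hx).1.mul_const T
  rwa [mul_assoc] at this

theorem FlatOn.exists_eq_mul {U : Set ℂ} (hU : IsOpen U) (hU' : IsPreconnected U) {L M : ℂ → Mat n}
    (hL : FlatOn n a U L) (hM : FlatOn n a U M) : ∃ T, ∀ x ∈ U, M x = L x * T :=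
  exists_eq_mul_of_flat hU hU' (fun x hx => (hL x hx).1) (fun x hx => (hM x hx).1)
    fun x hx => (hL x hx).2

theorem isUnit_of_eq_mul {X Y T : Mat n} (hX : IsUnit X) (hY : IsUnit Y) (h : Y = X * T) :
    IsUnit T := by
  rw [← Ring.inverse_mul_cancel_left _ T hX, ← h]
  exact hX.ringInverse.mul hY

theorem flatOn_normSec (c : Option ℂ) (σ : ℂ) : FlatOn n a (normDom n a c σ) (normSec n a c σ) :=
  fun _ hx => ⟨hasDerivAt_normSec hx, isUnit_normSec hx⟩

theorem exists_flatOn {U : Set ℂ} (hU : IsOpen U) {b : ℂ} (hb : StarConvex ℝ b U)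
    (hbU : b ∈ U) (ha : ∀ x ∈ U, ∀ i < n, x ≠ a i) :
    ∃ L : ℂ → Mat n, FlatOn n a U L ∧ ∀ x ∈ U, L x - 1 ∈ filt n 1 := by
  obtain ⟨L, -, h1, h2⟩ := exists_flat_of_starConvex hU hb hbU ha
  exact ⟨L, fun x hx => ⟨h2 x hx, isUnit_of_sub_one_mem (h1 x hx)⟩, h1⟩

theorem isPreconnected_slitDisc (c : ℂ) {r : ℝ} (hr : 0 < r) {d : ℂ} (hd : d ≠ 0) :
    IsPreconnected {x : ℂ | x ∈ Metric.ball c r ∧ (x - c) / d ∈ Complex.slitPlane} := by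
  have hnd : 0 < ‖d‖ := norm_pos_iff.2 hd
  set τ : ℝ := r / (2 * ‖d‖) with hτ
  have hτ0 : 0 < τ := by positivity
  have hmem : c + τ * d ∈ Metric.ball c r := by
    rw [Metric.mem_ball, dist_eq_norm, add_sub_cancel_left, norm_mul, Complex.norm_real,
      Real.norm_of_nonneg hτ0.le, hτ]
    field_simp
    linarith
  have h2 : StarConvex ℝ (c + τ * d) {x : ℂ | (x - c) / d ∈ Complex.slitPlane} := by
    intro x hx t t' ht ht' htt
    have h := Complex.starConvex_ofReal_slitPlane hτ0 hx ht ht' htt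
    rw [mem_ofPred_eq]
    convert! h using 1
    have h2 : (t' : ℂ) = 1 - t := by
      rw [eq_sub_iff_add_eq, add_comm]; exact_mod_cast htt
    simp only [Complex.real_smul, h2]
    field_simp
    ring
  have hmem2 : c + τ * d ∈ {x : ℂ | (x - c) / d ∈ Complex.slitPlane} := by
    rw [mem_ofPred_eq, add_sub_cancel_left, mul_div_cancel_right₀ _ hd]
    exact Complex.ofReal_mem_slitPlane.2 hτ0
  exact ((((convex_ball c r).starConvex hmem).inter h2).isPathConnected
    ⟨hmem, hmem2⟩).isConnected.isPreconnected

theorem log_neg_of_im_pos {ξ : ℂ} (h : 0 < ξ.im) :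
    Complex.log (-ξ) = Complex.log ξ + -(Real.pi * Complex.I) := by
  rw [Complex.log, Complex.log, norm_neg, Complex.arg_neg_eq_arg_sub_pi_of_im_pos h]
  push_cast; ring

theorem log_neg_of_im_neg {ξ : ℂ} (h : ξ.im < 0) :
    Complex.log (-ξ) = Complex.log ξ + Real.pi * Complex.I := by
  rw [Complex.log, Complex.log, norm_neg, Complex.arg_neg_eq_arg_add_pi_of_im_neg h]
  push_cast; ring

/-! ### Local monodromy across a cut -/

section Monodromy

variable {S : Type*} [Finite S] {pos : S → ℂ} {b : ℂ}

/-- The other cuts keep away from `pos s`, so a small disc slit along the cut of `s` lies in the cut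
plane; it is connected, and both sections are flat there. The normalization uses the direction `b -
pos s`, for which the slit of the logarithm is exactly the cut. -/
theorem exists_eq_normSec_of_flatOn (hb : IsGenericBase pos b) (s : S) {L : ℂ → Mat n}
    (hL : FlatOn n a (cutPlane pos b) L) :
    ∃ T, IsUnit T ∧ ∀ᶠ x in 𝓝 (pos s), (x - pos s) / (b - pos s) ∈ Complex.slitPlane →
      L x = normSec n a (some (pos s)) (b - pos s) x * T := by
  have h1 : ∀ᶠ x in 𝓝 (pos s), ∀ s', s' ≠ s → (x - pos s') / (b - pos s') ∈ Complex.slitPlane := by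
    rw [eventually_all]
    intro s'
    by_cases hs : s' = s
    · exact Eventually.of_forall fun x h => absurd hs h
    · have hc : ContinuousAt (fun x => (x - pos s') / (b - pos s')) (pos s) := by fun_prop
      filter_upwards [hc.eventually (Complex.isOpen_slitPlane.mem_nhds
        (mem_slitPlane_of_im_ne (hb.im_sub_div_ne (Ne.symm hs))))] with x hx _ using hx
  obtain ⟨r, hr, hball⟩ := Metric.eventually_nhds_iff_ball.1
    (h1.and (Metric.ball_mem_nhds (pos s) (normRadius_pos (n := n) (a := a) (c := some (pos s)))))
  set D : Set ℂ := {x : ℂ | x ∈ Metric.ball (pos s) r ∧ (x - pos s) / (b - pos s) ∈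
    Complex.slitPlane} with hD
  have hDo : IsOpen D := Metric.isOpen_ball.inter (Complex.isOpen_slitPlane.preimage (by fun_prop))
  have hDU : D ⊆ cutPlane pos b := by
    rintro x ⟨hx, hx'⟩ s'
    by_cases hs : s' = s
    · rw [hs]; exact hx'
    · exact (hball x hx).1 s' hs
  have hDN : D ⊆ normDom n a (some (pos s)) (b - pos s) := by
    rintro x ⟨hx, hx'⟩
    refine ⟨?_, hx'⟩
    have := (hball x hx).2
    rw [dist_eq_norm] at this
    simpa [loc] using this
  obtain ⟨T, hT⟩ := FlatOn.exists_eq_mul hDo (isPreconnected_slitDisc _ hr (hb.sub_ne s))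
    ((flatOn_normSec _ _).mono hDN) (hL.mono hDU)
  refine ⟨T, ?_, ?_⟩
  · have hr' : (0 : ℝ) < r / 2 := by positivity
    have hx : pos s + (r / 2 : ℝ) ∈ D := by
      refine ⟨?_, ?_⟩
      · rw [Metric.mem_ball, dist_eq_norm, add_sub_cancel_left, Complex.norm_real,
          Real.norm_of_nonneg hr'.le]
        linarith
      · rw [add_sub_cancel_left]
        exact mem_slitPlane_of_im_ne (hb.im_div_ne (by exact_mod_cast hr'.ne')
          (Complex.ofReal_im _) s)
    exact isUnit_of_eq_mul (isUnit_normSec (hDN hx)) (hL _ (hDU hx)).2 (hT _ hx)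
  · filter_upwards [Metric.ball_mem_nhds _ hr] with x hx hx' using hT x ⟨hx, hx'⟩

/-- A second flat section `L'` lives on a thin sector around the ray from `b` through `pos s`, slit
on the side of `b` instead. It crosses the cut of `s` freely, and comparing it with `L` near `pos
s`, above and below the cut, involves the two branches `∓πi` of `log(-1)`; their difference gives
`exp(2πi N)`. -/
theorem exists_flat_across_cut (hb : IsGenericBase pos b) (ha : ∀ i < n, ∃ s, a i = pos s) (s : S)
    {L : ℂ → Mat n} (hL : FlatOn n a (cutPlane pos b) L) {T : Mat n} (hT : IsUnit T)
    (hLT : ∀ᶠ x in 𝓝 (pos s), (x - pos s) / (b - pos s) ∈ Complex.slitPlane →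
      L x = normSec n a (some (pos s)) (b - pos s) x * T) {x : ℂ} (hxs : x ≠ pos s)
    (hx : (x - pos s) / (b - pos s) ∉ Complex.slitPlane) :
    ∃ δ > 0, ∃ M : ℂ → Mat n, FlatOn n a (Metric.ball x δ) M ∧
      ∀ y ∈ Metric.ball x δ ∩ cutPlane pos b, L y = M y ∨ L y = M y * (Ring.inverse T *
        NormedSpace.exp ((2 * Real.pi * Complex.I) • resMat n a (some (pos s))) * T) := by
  set β := pos s - b with hβ
  have hβ0 : β ≠ 0 := fun h => hb.sub_ne s (by rw [← neg_sub, ← hβ, h, neg_zero])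
  -- In this coordinate `b` is `0`, `pos s` is `1`, and the cut of `s` is the real half-line from
  -- `1` to infinity.
  set Y : ℂ → ℂ := fun x => (x - b) / β with hY
  have hYc : Continuous Y := by simp only [hY]; fun_prop
  have hY1 : ∀ x, Y x - 1 = (x - pos s) / β := fun x => by
    simp only [hY]; field_simp; ring
  have hY2 : ∀ x, (x - pos s) / (b - pos s) = -(Y x - 1) := fun x => by
    rw [hY1, hβ, ← div_neg, neg_sub]
  -- The cut of `s'` lies on the ray from `b` through `pos s'`, which is not parallel to `β`; this
  -- opening `η` makes the sector `K` miss all of those rays for `s' ≠ s`.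
  obtain ⟨η, hη0, hη⟩ : ∃ η > (0 : ℝ), ∀ s', s' ≠ s →
      η * |((pos s - b) / (pos s' - b)).re| < |((pos s - b) / (pos s' - b)).im| := by
    have : ∀ᶠ η : ℝ in 𝓝[>] 0, ∀ s', s' ≠ s →
        η * |((pos s - b) / (pos s' - b)).re| < |((pos s - b) / (pos s' - b)).im| := by
      rw [eventually_all]
      intro s'
      by_cases hs : s' = s
      · exact Eventually.of_forall fun x h => absurd hs h
      · have hc : Continuous fun η : ℝ => η * |((pos s - b) / (pos s' - b)).re| := by fun_prop
        have h0 := abs_pos.2 (hb.im_ne s s' (Ne.symm hs))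
        have hlim : Tendsto (fun η : ℝ => η * |((pos s - b) / (pos s' - b)).re|) (𝓝[>] 0) (𝓝 0) := by
          simpa using (hc.tendsto 0).mono_left nhdsWithin_le_nhds
        filter_upwards [hlim.eventually (gt_mem_nhds h0)] with η hη _ using hη
    obtain ⟨η, h1, h2⟩ := (this.and self_mem_nhdsWithin).exists
    exact ⟨η, h2, h1⟩
  set K : Set ℂ := {x | |(Y x).im| < η * (Y x).re} with hK
  have hKo : IsOpen K := isOpen_lt (by fun_prop) (by fun_prop)
  have hKs : ∀ x ∈ K, ∀ s', s' ≠ s → (x - pos s') / (b - pos s') ∈ Complex.slitPlane := by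
    intro x hx s' hs
    have hb' := hb.sub_ne s'
    have hb'' : pos s' - b ≠ 0 := fun e => hb' (by rw [← neg_sub, e, neg_zero])
    set κ := (pos s - b) / (pos s' - b) with hκ
    have e : (x - pos s') / (b - pos s') = 1 - Y x * κ := by
      simp only [hY, hκ, hβ]
      have : pos s - b ≠ 0 := hβ0
      field_simp
      ring
    rw [e]
    refine mem_slitPlane_of_im_ne ?_
    rw [Complex.sub_im, Complex.one_im, Complex.mul_im, zero_sub, neg_ne_zero]
    intro h
    have hre : 0 < (Y x).re := by
      have hx' : |(Y x).im| < η * (Y x).re := hx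
      have := (abs_nonneg _).trans_lt hx'
      exact pos_of_mul_pos_right this hη0.le
    have h2 : (Y x).re * |κ.im| = |(Y x).im| * |κ.re| := by
      have := congrArg abs (show (Y x).re * κ.im = -((Y x).im * κ.re) by linarith)
      rwa [abs_mul, abs_neg, abs_mul, abs_of_pos hre] at this
    have h3 := mul_lt_mul_of_pos_left (hη s' hs) hre
    have h4 := mul_le_mul_of_nonneg_right (le_of_lt hx) (abs_nonneg κ.re)
    rw [h2] at h3
    linarith
  set W : Set ℂ := {x | x ∈ K ∧ Y x - 1 ∈ Complex.slitPlane} with hW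
  have hWo : IsOpen W := hKo.inter (Complex.isOpen_slitPlane.preimage (by fun_prop))
  have hKim : ∀ x ∈ K, (Y x).im ≠ 0 → x ∈ W ∧ x ∈ cutPlane pos b := by
    intro x hx him
    refine ⟨⟨hx, mem_slitPlane_of_im_ne (by simpa using him)⟩, fun s' => ?_⟩
    by_cases hs : s' = s
    · rw [hs, hY2]
      exact mem_slitPlane_of_im_ne (by simpa using him)
    · exact hKs x hx s' hs
  have hWim : ∀ x ∈ W, x ∈ cutPlane pos b → (Y x).im ≠ 0 := by
    intro x hx hx' him
    have h1 := hx' s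
    have h2 := hx.2
    rw [hY2] at h1
    rw [Complex.mem_slitPlane_iff] at h1 h2
    simp [him] at h1 h2
    linarith
  have hc0 : b + 2 * β ∈ W := by
    have : Y (b + 2 * β) = 2 := by simp [hY, hβ0]
    refine ⟨?_, ?_⟩
    · rw [hK, mem_ofPred_eq, this]; simpa using hη0
    · rw [this]; norm_num
  have hstar : StarConvex ℝ (b + 2 * β) W := by
    intro x hx t t' ht ht' htt
    have h2 : (t' : ℂ) = 1 - t := by
      rw [eq_sub_iff_add_eq, add_comm]; exact_mod_cast htt
    have e : Y (t • (b + 2 * β) + t' • x) = (2 * t : ℝ) + (t' : ℝ) * Y x := by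
      simp only [hY, Complex.real_smul, h2]
      push_cast
      field_simp
      ring
    refine ⟨?_, ?_⟩
    · rw [hK, mem_ofPred_eq, e, Complex.add_im, Complex.add_re, Complex.im_ofReal_mul,
        Complex.re_ofReal_mul, Complex.ofReal_im, Complex.ofReal_re, zero_add, abs_mul,
        abs_of_nonneg ht']
      have hx1 : |(Y x).im| < η * (Y x).re := hx.1
      rcases ht'.eq_or_lt with h | h
      · have : t = 1 := by linarith
        rw [← h, this]; simpa using hη0
      · nlinarith [mul_lt_mul_of_pos_left hx1 h, mul_nonneg hη0.le ht]
    · have h := Complex.starConvex_one_slitPlane hx.2 ht ht' htt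
      convert! h using 1
      rw [e]
      simp only [Complex.real_smul, h2]
      push_cast
      ring
  have hWa : ∀ x ∈ W, ∀ i < n, x ≠ a i := by
    rintro x hx i hi rfl
    obtain ⟨s', hs'⟩ := ha i hi
    by_cases hs : s' = s
    · have h := Complex.slitPlane_ne_zero hx.2
      rw [hY1, hs', hs, sub_self, zero_div] at h
      exact h rfl
    · have h := Complex.slitPlane_ne_zero (hKs _ hx.1 s' hs)
      rw [hs', sub_self, zero_div] at h
      exact h rfl
  obtain ⟨L', hL', -⟩ := exists_flatOn hWo hstar hc0 hWa
  have hKnhds : ∀ᶠ x in 𝓝 (pos s), x ∈ K := by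
    refine hKo.mem_nhds ?_
    have : Y (pos s) = 1 := by simp only [hY]; exact div_self hβ0
    rw [hK, mem_ofPred_eq, this]; simpa using hη0
  obtain ⟨r, hr, hball⟩ := Metric.eventually_nhds_iff_ball.1
    ((hKnhds.and hLT).and (Metric.ball_mem_nhds (pos s)
      (normRadius_pos (n := n) (a := a) (c := some (pos s)))))
  set D : Set ℂ := {x : ℂ | x ∈ Metric.ball (pos s) r ∧ (x - pos s) / β ∈
    Complex.slitPlane} with hD
  have hDo : IsOpen D := Metric.isOpen_ball.inter (Complex.isOpen_slitPlane.preimage (by fun_prop))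
  have hDW : D ⊆ W := fun x hx => ⟨(hball x hx.1).1.1, by rw [hY1]; exact hx.2⟩
  have hDN : D ⊆ normDom n a (some (pos s)) β := by
    rintro x ⟨hx, hx'⟩
    refine ⟨?_, hx'⟩
    have := (hball x hx).2
    rw [dist_eq_norm] at this
    simpa [loc] using this
  obtain ⟨T', hT'⟩ := FlatOn.exists_eq_mul hDo (isPreconnected_slitDisc _ hr hβ0)
    (hL'.mono hDW) ((flatOn_normSec _ _).mono hDN)
  set N := resMat n a (some (pos s)) with hN
  -- The sign `ε` selects a side of the cut, and `θ` is the discrepancy there between the logarithms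
  -- normalized by `b - pos s` and by `β`. The half-sector is convex, so evaluating at the single
  -- point `pos s + τ i β` close to `pos s` determines the constant relating `L` and `L'`.
  have hside : ∀ ε : ℝ, |ε| = 1 → ∀ θ : ℂ,
      (∀ ξ : ℂ, 0 < ε * ξ.im → Complex.log (-ξ) = Complex.log ξ + θ) →
      IsUnit (T' * NormedSpace.exp (θ • N) * T) ∧
      ∀ x ∈ K, 0 < ε * (Y x).im → L x = L' x * (T' * NormedSpace.exp (θ • N) * T) := by
    intro ε hε θ hθ
    set V : Set ℂ := {x | x ∈ K ∧ 0 < ε * (Y x).im} with hV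
    have hVo : IsOpen V := hKo.inter
      (isOpen_lt continuous_const (continuous_const.mul (Complex.continuous_im.comp hYc)))
    have hVim : ∀ x ∈ V, (Y x).im ≠ 0 := fun x hx h => by
      have := hx.2; rw [h, mul_zero] at this; exact lt_irrefl _ this
    have hVc : Convex ℝ V := by
      intro x hx y hy t t' ht ht' htt
      have h2 : (t' : ℂ) = 1 - t := by
        rw [eq_sub_iff_add_eq, add_comm]; exact_mod_cast htt
      have e : Y (t • x + t' • y) = (t : ℝ) * Y x + (t' : ℝ) * Y y := by
        simp only [hY, Complex.real_smul, h2]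
        field_simp
        ring
      have h1 : |(Y x).im| < η * (Y x).re := hx.1
      have h2 : |(Y y).im| < η * (Y y).re := hy.1
      have h3 := hx.2
      have h4 := hy.2
      have ht1 : t = 1 - t' := by linarith
      refine ⟨?_, ?_⟩
      · rw [hK, mem_ofPred_eq, e, Complex.add_im, Complex.add_re, Complex.im_ofReal_mul,
          Complex.re_ofReal_mul, Complex.im_ofReal_mul, Complex.re_ofReal_mul]
        refine (abs_add_le _ _).trans_lt ?_
        rw [abs_mul, abs_mul, abs_of_nonneg ht, abs_of_nonneg ht']
        rcases ht.eq_or_lt with h | h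
        · have : t' = 1 := by linarith
          rw [← h, this]; simpa using h2
        · nlinarith [mul_lt_mul_of_pos_left h1 h, mul_le_mul_of_nonneg_left h2.le ht']
      · rw [e, Complex.add_im, Complex.im_ofReal_mul, Complex.im_ofReal_mul]
        rcases ht.eq_or_lt with h | h
        · have : t' = 1 := by linarith
          rw [← h, this]; simpa using h4
        · nlinarith [mul_pos h h3, mul_nonneg ht' h4.le]
    have hVW : V ⊆ W := fun x hx => (hKim x hx.1 (hVim x hx)).1
    have hVU : V ⊆ cutPlane pos b := fun x hx => (hKim x hx.1 (hVim x hx)).2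
    obtain ⟨g, hg⟩ := FlatOn.exists_eq_mul hVo hVc.isPreconnected (hL'.mono hVW) (hL.mono hVU)
    have hnβ : 0 < ‖β‖ := norm_pos_iff.2 hβ0
    set τ : ℝ := ε * (r / (2 * ‖β‖)) with hτ
    have hετ : 0 < ε * τ := by
      have : ε * ε = 1 := by rw [← abs_mul_abs_self, hε, one_mul]
      rw [hτ, ← mul_assoc, this, one_mul]; positivity
    have hball' : pos s + τ * Complex.I * β ∈ Metric.ball (pos s) r := by
      rw [Metric.mem_ball, dist_eq_norm, add_sub_cancel_left, norm_mul, norm_mul, Complex.norm_real,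
        Complex.norm_I, mul_one, hτ, Real.norm_eq_abs, abs_mul, hε, one_mul,
        abs_of_pos (by positivity)]
      field_simp
      linarith
    set x₀ := pos s + τ * Complex.I * β with hx₀
    have hYx₀ : Y x₀ - 1 = τ * Complex.I := by
      rw [hY1, hx₀, add_sub_cancel_left, mul_div_cancel_right₀ _ hβ0]
    have hYim : (Y x₀).im = τ := by
      have := congrArg Complex.im hYx₀
      simpa using this
    have hx₀V : x₀ ∈ V := ⟨(hball x₀ hball').1.1, by rw [hYim]; exact hετ⟩
    have hx₀D : x₀ ∈ D := ⟨hball', by rw [← hY1]; exact (hVW hx₀V).2⟩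
    have h1 := (hball x₀ hball').1.2 (hVU hx₀V s)
    have h2 : normSec n a (some (pos s)) (b - pos s) x₀
        = normSec n a (some (pos s)) β x₀ * NormedSpace.exp (θ • N) := by
      refine normSec_eq_mul_exp ?_
      simp only [loc]
      rw [hY2, ← hY1]
      refine hθ _ ?_
      rw [Complex.sub_im, Complex.one_im, sub_zero, hYim]
      exact hετ
    have hgeq : g = T' * NormedSpace.exp (θ • N) * T := by
      have h3 := hg x₀ hx₀V
      rw [h1, h2, hT' x₀ hx₀D] at h3
      rw [← Ring.inverse_mul_cancel_left _ g (hL' x₀ (hVW hx₀V)).2, ← h3, mul_assoc, mul_assoc,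
        Ring.inverse_mul_cancel_left _ _ (hL' x₀ (hVW hx₀V)).2, mul_assoc]
    rw [← hgeq]
    exact ⟨isUnit_of_eq_mul (hL' x₀ (hVW hx₀V)).2 (hL x₀ (hVU hx₀V)).2 (hg x₀ hx₀V),
      fun x hx hx' => hg x ⟨hx, hx'⟩⟩
  obtain ⟨hu, hplus⟩ := hside 1 (by simp) (-(Real.pi * Complex.I))
    fun ξ h => log_neg_of_im_pos (by simpa using h)
  obtain ⟨-, hminus⟩ := hside (-1) (by simp) (Real.pi * Complex.I)
    fun ξ h => log_neg_of_im_neg (by simpa using h)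
  have hxW : x ∈ W := by
    rw [hY2, Complex.mem_slitPlane_iff, not_or] at hx
    obtain ⟨h1, h2⟩ := hx
    simp only [Complex.neg_re, Complex.sub_re, Complex.one_re, Complex.neg_im, Complex.sub_im,
      Complex.one_im, sub_zero, ne_eq, not_not, neg_eq_zero, not_lt] at h1 h2
    have h3 : Y x - 1 ≠ 0 := by
      rw [hY1]; exact div_ne_zero (sub_ne_zero.2 hxs) hβ0
    have h4 : (Y x).re ≠ 1 := fun h => h3 (Complex.ext (by simp [h]) (by simp [h2]))
    have h5 : 1 < (Y x).re := lt_of_le_of_ne (by linarith) (Ne.symm h4)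
    refine ⟨?_, Complex.mem_slitPlane_iff.2 (Or.inl (by simpa using h5))⟩
    rw [hK, mem_ofPred_eq, h2, abs_zero]
    exact mul_pos hη0 (by linarith)
  obtain ⟨δ, hδ, hsub⟩ := Metric.isOpen_iff.1 hWo x hxW
  -- The constant factor makes `M` agree with `L` on the side where `Y` has positive imaginary part,
  -- so that the whole jump appears on the other side.
  refine ⟨δ, hδ, fun y => L' y * (T' * NormedSpace.exp ((-(Real.pi * Complex.I)) • N) * T),
    (hL'.mono hsub).mul_const hu, fun y hy => ?_⟩
  have hyW := hsub hy.1
  rcases lt_or_gt_of_ne (hWim y hyW hy.2) with h | h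
  · right
    rw [hminus y hyW.1 (by linarith), mul_assoc (L' y)]
    congr 1
    have e : (2 * Real.pi * Complex.I : ℂ) = Real.pi * Complex.I + Real.pi * Complex.I := by ring
    rw [e, exp_add_smul]
    set E := NormedSpace.exp ((Real.pi * Complex.I : ℂ) • N)
    set E' := NormedSpace.exp ((-(Real.pi * Complex.I : ℂ)) • N)
    have hEE : E' * E = 1 := exp_neg_smul_mul_exp_smul _ _
    calc T' * E * T = T' * (E' * E) * E * T := by rw [hEE, mul_one]
      _ = T' * E' * (T * Ring.inverse T) * (E * E) * T := by
        rw [Ring.mul_inverse_cancel _ hT]; noncomm_ring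
      _ = _ := by noncomm_ring
  · left
    exact hplus y hyW.1 (by linarith)

end Monodromy

end GenusZero

namespace GenusZero
open scoped Matrix.Norms.Operator

variable {n : ℕ} {a : ℕ → ℂ}

/-! ### Lifting curves to the monodromy covering -/

section Lift

variable {U : Set ℂ} {L : ℂ → Mat n} {G : Subgroup (Mat n)ˣ}

/-- The section `M`, flat on a disc, agrees with the branches of `L` up to the group `G`. -/
structure IsLocalLift (n : ℕ) (a : ℕ → ℂ) (U : Set ℂ) (L : ℂ → Mat n) (G : Subgroup (Mat n)ˣ)
    (x : ℂ) (δ : ℝ) (M : ℂ → Mat n) : Prop where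
  pos : 0 < δ
  flat : FlatOn n a (Metric.ball x δ) M
  eq : ∀ y ∈ Metric.ball x δ ∩ U, ∃ g ∈ G, L y = M y * (g : Mat n)

/-- The value `F` at `x` belongs to a continuation of `L` up to the group `G`. -/
def IsBranch (n : ℕ) (a : ℕ → ℂ) (U : Set ℂ) (L : ℂ → Mat n) (G : Subgroup (Mat n)ˣ)
    (x : ℂ) (F : Mat n) : Prop :=
  ∃ δ M, IsLocalLift n a U L G x δ M ∧ M x = F

/-- On the convex overlap of the discs `M' = M C` with `C` constant. Density of `U` supplies a point
of the overlap where both are compared with `L`, and this identifies `C` as an element of `G`. -/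
theorem IsLocalLift.exists_eq_mul (hU : Dense U) {x x' : ℂ} {δ δ' : ℝ}
    {M M' : ℂ → Mat n} (h : IsLocalLift n a U L G x δ M) (h' : IsLocalLift n a U L G x' δ' M')
    {w : ℂ} (hw : w ∈ Metric.ball x δ) (hw' : w ∈ Metric.ball x' δ') :
    ∃ g ∈ G, M' w = M w * (g : Mat n) := by
  have ho : IsOpen (Metric.ball x δ ∩ Metric.ball x' δ') := Metric.isOpen_ball.inter
    Metric.isOpen_ball
  obtain ⟨C, hC⟩ := FlatOn.exists_eq_mul ho
    ((convex_ball x δ).inter (convex_ball x' δ')).isPreconnected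
    (h.flat.mono inter_subset_left) (h'.flat.mono inter_subset_right)
  obtain ⟨y, hy, hyU⟩ := hU.inter_open_nonempty _ ho ⟨w, hw, hw'⟩
  obtain ⟨g, hg, e⟩ := h.eq y ⟨hy.1, hyU⟩
  obtain ⟨g', hg', e'⟩ := h'.eq y ⟨hy.2, hyU⟩
  refine ⟨g * g'⁻¹, G.mul_mem hg (G.inv_mem hg'), ?_⟩
  rw [hC w ⟨hw, hw'⟩]
  congr 1
  rw [e', hC y hy, mul_assoc] at e
  have := (h.flat y hy.1).2.mul_left_cancel e
  rw [Units.val_mul, ← this, mul_assoc, Units.mul_inv, mul_one]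

theorem IsLocalLift.isBranch {x : ℂ} {δ : ℝ} {M : ℂ → Mat n}
    (h : IsLocalLift n a U L G x δ M) {y : ℂ} (hy : y ∈ Metric.ball x δ) {g : (Mat n)ˣ}
    (hg : g ∈ G) : IsBranch n a U L G y (M y * (g : Mat n)) := by
  obtain ⟨δ', hδ', hsub⟩ := Metric.isOpen_iff.1 Metric.isOpen_ball y hy
  refine ⟨δ', fun w => M w * (g : Mat n), ⟨hδ', (h.flat.mono hsub).mul_const g.isUnit, ?_⟩, rfl⟩
  intro w hw
  obtain ⟨g', hg', e⟩ := h.eq w ⟨hsub hw.1, hw.2⟩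
  refine ⟨g⁻¹ * g', G.mul_mem (G.inv_mem hg) hg', ?_⟩
  rw [e, mul_assoc, ← Units.val_mul, mul_inv_cancel_left]

theorem IsBranch.exists_eq_mul (hU : Dense U) {x : ℂ} {F F' : Mat n}
    (h : IsBranch n a U L G x F) (h' : IsBranch n a U L G x F') :
    ∃ g ∈ G, F' = F * (g : Mat n) := by
  obtain ⟨δ, M, hM, rfl⟩ := h
  obtain ⟨δ', M', hM', rfl⟩ := h'
  exact hM.exists_eq_mul hU hM' (Metric.mem_ball_self hM.pos) (Metric.mem_ball_self hM'.pos)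

theorem isBranch_self {x : ℂ} (hx : x ∈ U) (h : ∃ δ M, IsLocalLift n a U L G x δ M) :
    IsBranch n a U L G x (L x) := by
  obtain ⟨δ, M, hM⟩ := h
  obtain ⟨g, hg, e⟩ := hM.eq x ⟨Metric.mem_ball_self hM.pos, hx⟩
  rw [e]
  exact hM.isBranch (Metric.mem_ball_self hM.pos) hg

/-- Near each time, `F` is a local lift along the curve times a constant `C`. Being a branch at one
nearby time forces `C` into `G`, and then `F` is a branch at all nearby times; connectedness of `I`
does the rest. This replaces a presentation of paths by loops around the marked points. -/
theorem IsBranch.lift (hU : Dense U) {I : Set ℝ} (hI : IsOpen I) (hI' : IsPreconnected I)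
    {ζ : ℝ → ℂ} (hζ : ∀ t ∈ I, DifferentiableAt ℝ ζ t)
    (hL : ∀ t ∈ I, ∃ δ M, IsLocalLift n a U L G (ζ t) δ M) {F : ℝ → Mat n}
    (hF : FlatAlong n a ζ I F) {t t' : ℝ} (ht : t ∈ I) (ht' : t' ∈ I)
    (h : IsBranch n a U L G (ζ t) (F t)) : IsBranch n a U L G (ζ t') (F t') := by
  refine hI'.induction₂' (fun t t' => IsBranch n a U L G (ζ t) (F t) →
    IsBranch n a U L G (ζ t') (F t')) (fun t₀ ht₀ => ?_) (fun _ _ _ _ _ _ h1 h2 h => h2 (h1 h))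
    ht ht' h
  obtain ⟨δ, M, hM⟩ := hL t₀ ht₀
  have hball : ∀ᶠ t in 𝓝 t₀, t ∈ I ∧ ζ t ∈ Metric.ball (ζ t₀) δ :=
    (hI.eventually_mem ht₀).and ((hζ t₀ ht₀).continuousAt.eventually (Metric.ball_mem_nhds _ hM.pos))
  obtain ⟨r, hr, hsub⟩ := Metric.eventually_nhds_iff_ball.1 hball
  obtain ⟨C, hC⟩ := exists_eq_mul_of_flat (𝕜 := ℝ) (Metric.isOpen_ball (x := t₀) (ε := r))
    (convex_ball t₀ r).isPreconnected
    (FlatAlong.comp (fun t ht => hζ t (hsub t ht).1) fun t ht => (hM.flat _ (hsub t ht).2).1)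
    (fun t ht => hF t (hsub t ht).1) (fun t ht => (hM.flat _ (hsub t ht).2).2)
  have key : ∀ t ∈ Metric.ball t₀ r, ∀ t' ∈ Metric.ball t₀ r,
      IsBranch n a U L G (ζ t) (F t) → IsBranch n a U L G (ζ t') (F t') := by
    intro t ht t' ht' h
    obtain ⟨g, hg, e⟩ := (hM.isBranch (hsub t ht).2 G.one_mem).exists_eq_mul hU h
    rw [Units.val_one, mul_one, hC t ht] at e
    rw [hC t' ht', (hM.flat _ (hsub t ht).2).2.mul_left_cancel e]
    exact hM.isBranch (hsub t' ht').2 hg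
  filter_upwards [mem_nhdsWithin_of_mem_nhds (Metric.ball_mem_nhds t₀ hr)] with t ht
  exact ⟨key _ (Metric.mem_ball_self hr) t ht, key t ht _ (Metric.mem_ball_self hr)⟩

end Lift

/-! ### Transport along closed curves -/

section Loop

variable {S : Type*} [Finite S] {pos : S → ℂ} {b : ℂ} {L : ℂ → Mat n} {G : Subgroup (Mat n)ˣ}

/-- Off the cuts `L` is its own local lift; on a cut, the section continued across it is one,
provided that the local monodromies lie in `G`. -/
theorem exists_isLocalLift (hb : IsGenericBase pos b) (ha : ∀ i < n, ∃ s, a i = pos s)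
    (hL : FlatOn n a (cutPlane pos b) L)
    (hG : ∀ s T, IsUnit T → (∀ᶠ x in 𝓝 (pos s), (x - pos s) / (b - pos s) ∈ Complex.slitPlane →
      L x = normSec n a (some (pos s)) (b - pos s) x * T) → ∃ g ∈ G, (g : Mat n) =
        Ring.inverse T * NormedSpace.exp ((2 * Real.pi * Complex.I) • resMat n a (some (pos s)))
          * T)
    {x : ℂ} (hx : ∀ s, x ≠ pos s) : ∃ δ M, IsLocalLift n a (cutPlane pos b) L G x δ M := by
  by_cases hxU : x ∈ cutPlane pos b
  · obtain ⟨δ, hδ, hsub⟩ := Metric.isOpen_iff.1 (IsGenericBase.isOpen_cutPlane (pos := pos)) x hxU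
    exact ⟨δ, L, hδ, hL.mono hsub, fun y _ => ⟨1, G.one_mem, by simp⟩⟩
  · obtain ⟨s, hs⟩ := not_forall.1 hxU
    obtain ⟨T, hT, hLT⟩ := exists_eq_normSec_of_flatOn hb s hL
    obtain ⟨g, hg, e⟩ := hG s T hT hLT
    obtain ⟨δ, hδ, M, hM, hM'⟩ := exists_flat_across_cut hb ha s hL hT hLT (hx s) hs
    refine ⟨δ, M, hδ, hM, fun y hy => ?_⟩
    rcases hM' y hy with h | h
    · exact ⟨1, G.one_mem, by simpa using h⟩
    · exact ⟨g, hg, by rw [e]; exact h⟩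

/-- `H t * T` continues `L` along the loop, starting from `normSec * T`. It returns as `normSec * Φ
* T`, still a branch, while `L` itself is `normSec * T` there; two branches at one point differ by
an element of `G`. -/
theorem exists_eq_of_hasTransport (hb : IsGenericBase pos b)
    (hloc : ∀ x, (∀ s, x ≠ pos s) → ∃ δ M, IsLocalLift n a (cutPlane pos b) L G x δ M)
    {P : Option S} {σ : ℂ} (hσr : σ.im = 0) {T : Mat n} (hT : LegEq n a L (P.map pos) σ T)
    {ζ : ℝ → ℂ} (hζ : IsTangentialCurve pos ζ (P.map pos) σ (P.map pos) σ) {Φ : Mat n}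
    (hΦ : HasTransport n a ζ (P.map pos) σ (P.map pos) σ Φ) :
    ∃ g ∈ G, T = Φ * T * (g : Mat n) := by
  obtain ⟨H, hH, h0, h1⟩ := hΦ
  have hleg := (eventually_legPoint_mem_cutPlane hb P hζ.source_ne hσr).and
    ((eventually_legPoint_mem_normDom (n := n) (a := a) (P.map pos) hζ.source_ne).and hT)
  have hF : FlatAlong n a ζ (Ioo 0 1) fun t => H t * T := fun t ht => by
    have := (hH t ht).mul_const T
    rwa [mul_assoc] at this
  have hloc' : ∀ t ∈ Ioo (0 : ℝ) 1, ∃ δ M, IsLocalLift n a (cutPlane pos b) L G (ζ t) δ M :=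
    fun t ht => hloc _ (hζ.avoids t ht)
  obtain ⟨t, ⟨e, ⟨hU, -, hLt⟩⟩, ht⟩ :=
    ((h0.and (eventually_curve_of_leg (p := fun x => x ∈ cutPlane pos b ∧
      x ∈ normDom n a (P.map pos) σ ∧ L x = normSec n a (P.map pos) σ x * T)
      hζ.source_ne hζ.source hleg)).and (Ioo_mem_nhdsGT one_pos)).exists
  obtain ⟨t', ⟨e', ⟨hU', hN, hLt'⟩⟩, ht'⟩ :=
    ((h1.and (eventually_curve_of_leg (p := fun x => x ∈ cutPlane pos b ∧
      x ∈ normDom n a (P.map pos) σ ∧ L x = normSec n a (P.map pos) σ x * T)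
      hζ.target_ne hζ.target hleg)).and (Ioo_mem_nhdsGT one_pos)).exists
  have ht1 : 1 - t' ∈ Ioo (0 : ℝ) 1 := ⟨by linarith [ht'.2], by linarith [ht'.1]⟩
  have hbr := isBranch_self hU (hloc' t ht)
  rw [hLt, ← e] at hbr
  have hbr1 := IsBranch.lift hb.dense_cutPlane isOpen_Ioo isPreconnected_Ioo
    (fun t ht => hζ.differentiableAt ht) hloc' hF ht ht1 hbr
  have hbr2 := isBranch_self hU' (hloc' _ ht1)
  obtain ⟨g, hg, e2⟩ := hbr1.exists_eq_mul hb.dense_cutPlane hbr2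
  refine ⟨g, hg, (isUnit_normSec hN).mul_left_cancel ?_⟩
  rw [← hLt', e2, e']
  simp only [mul_assoc]

/-- The product rule for a gauge factor times an exponential: the two terms containing `N` cancel,
leaving the connection. -/
theorem gauge_identity (A h N E T : Mat n) (z d w : ℂ) (e : z * d = -w) :
    (z • (A * h - d • (h * N)) * E + h * (-w • (N * E))) * T = z • A * (h * E * T) := by
  rw [← e]
  simp only [smul_sub, smul_smul, sub_mul, add_mul, smul_mul_assoc, mul_smul_comm, mul_assoc]
  abel

/-- The monodromy around infinity. -/
theorem exists_eq_of_circle (hb : IsGenericBase pos b)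
    (hloc : ∀ x, (∀ s, x ≠ pos s) → ∃ δ M, IsLocalLift n a (cutPlane pos b) L G x δ M)
    {T : Mat n} (hT : LegEq n a L none 1 T) :
    ∃ g ∈ G, NormedSpace.exp ((-(2 * Real.pi * Complex.I)) • resMat n a none) * T
      = T * (g : Mat n) := by
  set N := resMat n a none with hN
  have hleg := (eventually_legPoint_mem_cutPlane hb none (σ := 1) one_ne_zero (by simp)).and
    ((eventually_legPoint_mem_normDom (n := n) (a := a) none (σ := 1) one_ne_zero).and hT)
  obtain ⟨r, hr, η, hη, hbox⟩ := exists_box_of_eventually hleg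
  obtain ⟨B, hB⟩ : ∃ B : ℝ, ∀ s, ‖pos s‖ < B := by
    obtain ⟨M, hM⟩ := (Set.finite_range fun s => ‖pos s‖).bddAbove
    exact ⟨M + 1, fun s => (hM ⟨s, rfl⟩).trans_lt (lt_add_one M)⟩
  -- The circle encloses all positions, and its starting point `R` lies on the leg at infinity. That
  -- point lies in the normal-form disc at infinity, hence so does the whole circle.
  obtain ⟨R, hR0, hRr, hRB⟩ : ∃ R : ℝ, 0 < R ∧ R⁻¹ < r ∧ B < R := by
    have h1 : ∀ᶠ R : ℝ in atTop, R⁻¹ < r := tendsto_inv_atTop_zero.eventually (gt_mem_nhds hr)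
    obtain ⟨R, h1, h2, h3⟩ := (h1.and ((eventually_gt_atTop B).and (eventually_gt_atTop 0))).exists
    exact ⟨R, h3, h1, h2⟩
  have hRC : (R : ℂ) ≠ 0 := by exact_mod_cast hR0.ne'
  have hpt : legPoint none 1 (R⁻¹, 1) = (R : ℂ) := by simp [legPoint, chart]
  obtain ⟨hU, hND, hLR⟩ := hbox R⁻¹ ⟨inv_pos.2 hR0, hRr⟩ 1 (Metric.mem_ball_self hη)
  rw [Option.map_none, hpt] at hU
  rw [hpt] at hND hLR
  set ζ : ℝ → ℂ := fun t => R * Complex.exp (t * (2 * Real.pi * Complex.I)) with hζ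
  have hζd : ∀ t, HasDerivAt ζ (ζ t * (2 * Real.pi * Complex.I)) t := by
    intro t
    have h1 : HasDerivAt (fun t : ℝ => (t : ℂ) * (2 * Real.pi * Complex.I))
        (2 * Real.pi * Complex.I) t := by
      simpa using (Complex.ofRealCLM.hasDerivAt (x := t)).mul_const (2 * Real.pi * Complex.I)
    have := (h1.cexp).const_mul (R : ℂ)
    convert! this using 1
    simp only [hζ]; ring
  have hζn : ∀ t, ‖ζ t‖ = R := by
    intro t
    simp only [hζ]
    rw [norm_mul, Complex.norm_real, Real.norm_of_nonneg hR0.le, Complex.norm_exp]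
    simp
  have hζ0 : ∀ t, ζ t ≠ 0 := fun t h => by
    have := hζn t
    rw [h, norm_zero] at this
    exact hR0.ne this
  have hav : ∀ t s, ζ t ≠ pos s := fun t s h => by
    have := hζn t
    rw [h] at this
    linarith [hB s]
  have hinv : ∀ t, loc none (ζ t) ∈ Metric.ball 0 (normRadius n a none) := by
    intro t
    have h := hND.1
    rw [mem_ball_zero_iff] at h ⊢
    simp only [loc, norm_inv] at h ⊢
    rwa [hζn, ← Real.norm_of_nonneg hR0.le, ← Complex.norm_real]
  -- The normalized section at infinity with `log (1 / ζ t)` continued along the circle, so that it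
  -- decreases by `2πi` in one turn.
  set F : ℝ → Mat n := fun t => normMat n a none (loc none (ζ t)) *
    NormedSpace.exp ((-Real.log R - t * (2 * Real.pi * Complex.I)) • N) * T with hF
  have hflat : FlatAlong n a ζ univ F := by
    intro t _
    have h0 : loc none (ζ t) ≠ 0 := inv_ne_zero (hζ0 t)
    have h1 := ((normMat_spec n a none).2.2.2.2.2 (ζ t) (hinv t) h0).scomp t (hζd t)
    have h2 : HasDerivAt (fun t : ℝ => (-Real.log R - t * (2 * Real.pi * Complex.I) : ℂ))
        (-(2 * Real.pi * Complex.I)) t := by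
      simpa using ((Complex.ofRealCLM.hasDerivAt (x := t)).mul_const
        (2 * Real.pi * Complex.I)).const_sub (-Real.log R : ℂ)
    have h3 := (hasDerivAt_exp_smul_const' N (-Real.log R - t * (2 * Real.pi * Complex.I) : ℂ)).scomp
      t h2
    have h4 := (h1.mul h3).mul_const T
    convert! h4 using 1
    rw [(hζd t).deriv]
    simp only [hF, Function.comp]
    set E := NormedSpace.exp ((-Real.log R - t * (2 * Real.pi * Complex.I) : ℂ) • N)
    have e : (ζ t * (2 * Real.pi * Complex.I)) * (locDeriv none (ζ t) / loc none (ζ t))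
        = -(2 * Real.pi * Complex.I) := by
      have := hζ0 t
      simp only [locDeriv, loc]
      field_simp
    exact (gauge_identity _ _ _ _ _ _ _ _ e).symm
  have h0 : ζ 0 = R := by simp [hζ]
  have h01 : ζ 1 = ζ 0 := by
    simp [hζ, Complex.exp_two_pi_mul_I]
  have hlog : Complex.log (loc none (R : ℂ) / 1) = -(Real.log R : ℂ) := by
    simp only [loc]
    rw [div_one, ← Complex.ofReal_inv, ← Complex.ofReal_log (inv_pos.2 hR0).le, Real.log_inv,
      Complex.ofReal_neg]
  have hF0 : F 0 = L (ζ 0) := by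
    simp only [hF]
    rw [h0, hLR, normSec, hlog, Complex.ofReal_zero, zero_mul, sub_zero]
  have hF1 : F 1 = normSec n a none 1 (ζ 0) *
      (NormedSpace.exp ((-(2 * Real.pi * Complex.I)) • N) * T) := by
    simp only [hF]
    rw [h01, h0, normSec, hlog, Complex.ofReal_one, one_mul, sub_eq_add_neg, exp_add_smul]
    simp only [mul_assoc, hN]
  have h0U : ζ 0 ∈ cutPlane pos b := by
    rw [h0]; exact hU
  have hbr := isBranch_self h0U (hloc _ (hav 0))
  rw [← hF0] at hbr
  have hbr1 := IsBranch.lift hb.dense_cutPlane isOpen_univ isPreconnected_univ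
    (fun t _ => (hζd t).differentiableAt) (fun t _ => hloc _ (hav t)) hflat (mem_univ 0)
    (mem_univ 1) hbr
  rw [h01] at hbr1
  obtain ⟨g, hg, e⟩ := hbr.exists_eq_mul hb.dense_cutPlane hbr1
  refine ⟨g, hg, (isUnit_normSec hND).mul_left_cancel ?_⟩
  rw [hF1, hF0, h0, hLR] at e
  rw [e, mul_assoc]

end Loop

end GenusZero

namespace GenusZero
open scoped Matrix.Norms.Operator

variable {X : Type*} [TopologicalSpace X] [ChartedSpace ℂ X] {S : Type*} {C : MarkedCurve X S}
  {z : AdmissibleCoord C}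

/-! ### The ring of periods -/

theorem prod_mem_periods {ι : Type*} [Fintype ι] (d : ι → ℕ) (p q : ι → TangentialBasePoint S)
    (γ : ∀ i, TangentialPath z (p i) (q i)) (u : ι → (List S →₀ ℤ))
    (hu : ∀ i, u i ∈ wordsOfWeight S (d i)) :
    ∏ i, (γ i).integral (u i) ∈ periods z (∑ i, d i) := by
  refine Submodule.subset_span ⟨Fintype.card ι, d ∘ (Fintype.equivFin ι).symm,
    p ∘ (Fintype.equivFin ι).symm, q ∘ (Fintype.equivFin ι).symm,
    fun i => γ ((Fintype.equivFin ι).symm i), u ∘ (Fintype.equivFin ι).symm, fun i => hu _, ?_, ?_⟩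
  · exact Equiv.sum_comp (Fintype.equivFin ι).symm d
  · exact (Equiv.prod_comp (Fintype.equivFin ι).symm fun i => (γ i).integral (u i)).symm

theorem mul_mem_periods {m m' : ℕ} {x y : ℂ} (hx : x ∈ periods z m) (hy : y ∈ periods z m') :
    x * y ∈ periods z (m + m') := by
  induction hx using Submodule.span_induction with
  | mem x hx =>
    induction hy using Submodule.span_induction with
    | mem y hy =>
      obtain ⟨k, d, p, q, γ, u, hu, rfl, rfl⟩ := hx
      obtain ⟨k', d', p', q', γ', u', hu', rfl, rfl⟩ := hy
      let Γ : ∀ i : Fin k ⊕ Fin k', TangentialPath z (Sum.elim p p' i) (Sum.elim q q' i) :=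
        fun i => match i with
          | Sum.inl i => γ i
          | Sum.inr i => γ' i
      have := prod_mem_periods (z := z) (Sum.elim d d') _ _ Γ (Sum.elim u u') (by
        rintro (i | i)
        · exact hu i
        · exact hu' i)
      rwa [Fintype.sum_sum_type, Fintype.prod_sum_type] at this
    | zero => rw [mul_zero]; exact zero_mem _
    | add y y' _ _ h h' => rw [mul_add]; exact add_mem h h'
    | smul c y _ h => rw [mul_smul_comm]; exact Submodule.smul_mem _ c h
  | zero => rw [zero_mul]; exact zero_mem _
  | add x x' _ _ h h' => rw [add_mul]; exact add_mem h h'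
  | smul c x _ h => rw [smul_mul_assoc]; exact Submodule.smul_mem _ c h

theorem one_mem_periods_zero : (1 : ℂ) ∈ periods z 0 :=
  Submodule.subset_span ⟨0, Fin.elim0, Fin.elim0, Fin.elim0, fun i => i.elim0, Fin.elim0,
    fun i => i.elim0, by simp, by simp⟩

theorem intCast_mul_mem_periods {m : ℕ} (k : ℤ) {x : ℂ} (hx : x ∈ periods z m) :
    (k : ℂ) * x ∈ periods z m := by
  rw [← zsmul_eq_mul]
  exact Submodule.smul_mem _ k hx

theorem TangentialPath.integral_single {p q : TangentialBasePoint S} (γ : TangentialPath z p q)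
    (v : List S) : γ.integral (Finsupp.single v 1) = γ.wordInt v := by
  simp [TangentialPath.integral]

theorem TangentialPath.wordInt_mem_periods {p q : TangentialBasePoint S}
    (γ : TangentialPath z p q) (v : List S) : γ.wordInt v ∈ periods z v.length := by
  have := prod_mem_periods (ι := Unit) (fun _ => v.length) (fun _ => p) (fun _ => q) (fun _ => γ)
    (fun _ => Finsupp.single v 1) fun _ => Finsupp.single_mem_supported ℤ 1 rfl
  simpa [TangentialPath.integral_single] using this

theorem regLim_eq {f : ℝ → ℂ} {c : ℂ} (h : HasRegLim f c) : regLim f = c := by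
  have h' : ∃ c, HasRegLim f c := ⟨c, h⟩
  rw [regLim, dif_pos h']
  exact h'.choose_spec.unique h

theorem mem_periods_of_le (h1 : (1 : ℂ) ∈ periods z 1) {m m' : ℕ} (h : m ≤ m') {x : ℂ}
    (hx : x ∈ periods z m) : x ∈ periods z m' := by
  induction m', h using Nat.le_induction with
  | base => exact hx
  | succ k _ ih => simpa using mul_mem_periods ih h1

/-! ### Matrices of periods -/

variable {n : ℕ}

/-- Upper triangular matrices whose `(i, j)` entry is a period of weight `j - i - e`, and zero if
this number is negative. -/
def periodMat (z : AdmissibleCoord C) (n e : ℕ) : AddSubgroup (Mat n) where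
  carrier := {M | ∀ i j : Fin (n + 1), ((i : ℕ) + e ≤ j → M i j ∈ periods z (j - (i + e))) ∧
    ((j : ℕ) < i + e → M i j = 0)}
  add_mem' := fun ha hb i j => ⟨fun h => add_mem ((ha i j).1 h) ((hb i j).1 h), fun h => by
    rw [Matrix.add_apply, (ha i j).2 h, (hb i j).2 h, add_zero]⟩
  zero_mem' := fun i j => ⟨fun _ => zero_mem _, fun _ => rfl⟩
  neg_mem' := fun ha i j => ⟨fun h => neg_mem ((ha i j).1 h), fun h => by
    rw [Matrix.neg_apply, (ha i j).2 h, neg_zero]⟩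

theorem mem_filt_of_mem_periodMat {e : ℕ} {M : Mat n} (h : M ∈ periodMat z n e) : M ∈ filt n e :=
  fun i j hij => (h i j).2 hij

theorem one_mem_periodMat : (1 : Mat n) ∈ periodMat z n 0 := by
  intro i j
  refine ⟨fun h => ?_, fun h => one_mem_filt i j h⟩
  rcases eq_or_ne i j with rfl | hij
  · simpa using one_mem_periods_zero
  · rw [Matrix.one_apply_ne hij]; exact zero_mem _

theorem mul_mem_periodMat {e e' : ℕ} {M M' : Mat n} (hM : M ∈ periodMat z n e)
    (hM' : M' ∈ periodMat z n e') : M * M' ∈ periodMat z n (e + e') := by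
  intro i j
  refine ⟨fun h => ?_, fun h => mul_mem_filt (mem_filt_of_mem_periodMat hM)
    (mem_filt_of_mem_periodMat hM') i j h⟩
  rw [Matrix.mul_apply]
  refine sum_mem fun k _ => ?_
  rcases lt_or_ge (k : ℕ) (i + e) with h1 | h1
  · rw [(hM i k).2 h1, zero_mul]; exact zero_mem _
  · rcases lt_or_ge (j : ℕ) (k + e') with h2 | h2
    · rw [(hM' k j).2 h2, mul_zero]; exact zero_mem _
    · have := mul_mem_periods ((hM i k).1 h1) ((hM' k j).1 h2)
      rwa [show (k - (i + e) + (j - (k + e')) : ℕ) = j - (i + (e + e')) by omega] at this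

theorem periodMat_anti (h1 : (1 : ℂ) ∈ periods z 1) {e e' : ℕ} (h : e ≤ e') :
    periodMat z n e' ≤ periodMat z n e := by
  intro M hM i j
  refine ⟨fun hij => ?_, fun hij => (hM i j).2 (by omega)⟩
  rcases lt_or_ge (j : ℕ) (i + e') with h2 | h2
  · rw [(hM i j).2 h2]; exact zero_mem _
  · exact mem_periods_of_le h1 (by omega) ((hM i j).1 h2)

theorem pow_mem_periodMat {e : ℕ} {M : Mat n} (hM : M ∈ periodMat z n e) (k : ℕ) :
    M ^ k ∈ periodMat z n (k * e) := by
  induction k with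
  | zero => simpa using one_mem_periodMat
  | succ k ih => rw [pow_succ, Nat.succ_mul]; exact mul_mem_periodMat ih hM

theorem inverse_mem_periodMat {M : Mat n} (hM : M ∈ periodMat z n 0) (hM' : M - 1 ∈ filt n 1) :
    Ring.inverse M ∈ periodMat z n 0 := by
  have h := inverse_eq_sum hM'
  rw [add_sub_cancel] at h
  rw [h]
  exact sum_mem fun k _ => pow_mem_periodMat (neg_mem (sub_mem hM one_mem_periodMat)) k

theorem inverse_sub_one_mem_periodMat (h1 : (1 : ℂ) ∈ periods z 1) {M : Mat n}
    (hM : M - 1 ∈ periodMat z n 1) : Ring.inverse M - 1 ∈ periodMat z n 1 := by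
  have h := inverse_eq_sum (mem_filt_of_mem_periodMat hM)
  rw [add_sub_cancel] at h
  rw [h, Finset.sum_range_succ', pow_zero, add_sub_cancel_right]
  exact sum_mem fun k _ => periodMat_anti h1 (by omega) (pow_mem_periodMat (neg_mem hM) (k + 1))

/-- The group of unipotent matrices whose entries above the diagonal are periods of a weight one
less than that of the corresponding iterated integrals. -/
def lowWeightGroup (z : AdmissibleCoord C) (h1 : (1 : ℂ) ∈ periods z 1) (n : ℕ) :
    Subgroup (Mat n)ˣ where
  carrier := {g | (g : Mat n) - 1 ∈ periodMat z n 1}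
  mul_mem' {g h} hg hh := by
    have e : ((g * h : (Mat n)ˣ) : Mat n) - 1
        = ((g : Mat n) - 1) * ((h : Mat n) - 1) + ((g : Mat n) - 1) + ((h : Mat n) - 1) := by
      rw [Units.val_mul]; noncomm_ring
    rw [mem_ofPred_eq, e]
    exact add_mem (add_mem (periodMat_anti h1 (by norm_num) (mul_mem_periodMat hg hh)) hg) hh
  one_mem' := by simp [zero_mem]
  inv_mem' {g} hg := by
    rw [mem_ofPred_eq, ← Ring.inverse_unit]
    exact inverse_sub_one_mem_periodMat h1 hg

theorem mem_lowWeightGroup {h1 : (1 : ℂ) ∈ periods z 1} {g : (Mat n)ˣ} :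
    g ∈ lowWeightGroup z h1 n ↔ (g : Mat n) - 1 ∈ periodMat z n 1 := Iff.rfl

/-- Conjugation by a matrix of periods preserves the group. -/
theorem exists_conj_mem_lowWeightGroup {h1 : (1 : ℂ) ∈ periods z 1} {T M : Mat n}
    (hT : T ∈ periodMat z n 0) (hT' : T - 1 ∈ filt n 1) (hM : M - 1 ∈ periodMat z n 1) :
    ∃ g ∈ lowWeightGroup z h1 n, (g : Mat n) = Ring.inverse T * M * T := by
  have e : Ring.inverse T * M * T = 1 + Ring.inverse T * (M - 1) * T := by
    have := Ring.inverse_mul_cancel T (isUnit_of_sub_one_mem hT')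
    rw [mul_sub, mul_one, sub_mul, this, add_sub_cancel]
  have hmem : Ring.inverse T * (M - 1) * T ∈ periodMat z n 1 := by
    have := mul_mem_periodMat (mul_mem_periodMat (inverse_mem_periodMat hT hT') hM) hT
    simpa using this
  have hu : IsUnit (Ring.inverse T * M * T) := isUnit_of_sub_one_mem (by
    rw [e, add_sub_cancel_left]; exact mem_filt_of_mem_periodMat hmem)
  refine ⟨hu.unit, ?_, hu.unit_spec⟩
  rw [mem_lowWeightGroup, hu.unit_spec, e, add_sub_cancel_left]
  exact hmem

/-- The factor `2πi` cancels the residue, so the entry `(i, j)` with `i < j` is `1/(j - i)!` when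
all letters from `i` to `j - 1` sit at `c`, and `0` otherwise. Asking only for the factorials of
runs that occur in the word is what makes the later induction possible. -/
theorem exp_sub_one_mem_periodMat {a : ℕ → ℂ} {c : ℂ}
    (hrun : ∀ i j, i < j → j ≤ n → (∀ l ∈ Finset.Ico i j, a l = a i) →
      (((j - i).factorial : ℂ)⁻¹) ∈ periods z (j - (i + 1))) :
    NormedSpace.exp ((2 * Real.pi * Complex.I : ℂ) • resMat n a (some c)) - 1
      ∈ periodMat z n 1 := by
  intro i j
  rw [Matrix.sub_apply, resMat, ← superdiag_smul]
  refine ⟨fun h => ?_, fun h => ?_⟩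
  · rw [exp_superdiag_apply _ _ _ (Fin.le_def.2 (by omega)), Matrix.one_apply_ne
      (fun e => by subst e; omega), sub_zero]
    simp only [localExp, mul_ite, mul_invTwoPiI, mul_zero]
    by_cases hc : ∀ l ∈ Finset.Ico (i : ℕ) j, a l = c
    · rw [Finset.prod_congr rfl (g := fun _ => (1 : ℂ)) (fun l hl => if_pos (hc l hl)),
        Finset.prod_const_one, mul_one]
      exact hrun i j (by omega) (by omega) fun l hl =>
        (hc l hl).trans (hc i (Finset.mem_Ico.2 ⟨le_rfl, by omega⟩)).symm
    · push Not at hc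
      obtain ⟨l, hl, hlc⟩ := hc
      rw [Finset.prod_eq_zero hl (if_neg hlc), mul_zero]
      exact zero_mem _
  · have := exp_sub_one_mem (superdiag_mem (n := n) fun l => (2 * Real.pi * Complex.I : ℂ) *
      localExp a (some c) l) i j h
    rwa [Matrix.sub_apply] at this

/-- Each entry of the transport is the regularized integral of a slice, and the slice from `i` to
`j` has length `j - i`. -/
theorem TangentialPath.mem_periodMat {p q : TangentialBasePoint S} (γ : TangentialPath z p q)
    (v : List S) {Φ : Mat v.length}
    (hΦ : HasTransport v.length (letterPos z.pos v) γ.plane (z.center p.point)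
      ((p.sign : ℤ) : ℂ) (z.center q.point) ((q.sign : ℤ) : ℂ) Φ) :
    Φ - 1 ∈ filt v.length 1 ∧ Φ ∈ periodMat z v.length 0 := by
  have h1 := γ.isTangentialCurve.sub_one_mem_of_hasTransport v hΦ
  refine ⟨h1, fun i j => ⟨fun hij => ?_, fun hij => ?_⟩⟩
  · have h2 := regLim_eq (γ.isTangentialCurve.hasRegLim v hΦ (i := i) (j := j)
      (Fin.le_def.2 (by omega)))
    rw [← h2]
    have h3 := γ.wordInt_mem_periods (slice v i j)
    rwa [length_slice v (by omega) (by omega)] at h3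
  · have := h1 i j (by omega)
    rwa [Matrix.sub_apply, Matrix.one_apply_ne (fun e => by subst e; omega), sub_zero] at this

end GenusZero

namespace GenusZero
open scoped Matrix.Norms.Operator

/-! ### Transport inside the cut plane -/

section

variable {n : ℕ} {a : ℕ → ℂ} {S : Type*} [Finite S] {pos : S → ℂ} {b : ℂ} {L : ℂ → Mat n}

theorem exists_legEq (hb : IsGenericBase pos b) (hL : FlatOn n a (cutPlane pos b) L)
    (P : Option S) {σ : ℂ} (hσ : σ ≠ 0) (hσr : σ.im = 0) :
    ∃ T, IsUnit T ∧ LegEq n a L (P.map pos) σ T := by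
  have h1 := eventually_legPoint_mem_cutPlane hb P hσ hσr
  have h2 := eventually_legPoint_mem_normDom (n := n) (a := a) (P.map pos) hσ
  obtain ⟨T, hT⟩ := exists_flat_eq_on_leg (n := n) (a := a) hσ
    (X := normSec n a (P.map pos) σ) (Y := L)
    (h2.mono fun q hq => flatOn_normSec _ _ _ hq) (h1.mono fun q hq => (hL _ hq).1)
  obtain ⟨r, hr, η, hη, hbox⟩ := exists_box_of_eventually (h1.and (h2.and hT))
  obtain ⟨h3, h4, h5⟩ := hbox (r / 2) ⟨by linarith, by linarith⟩ 1 (Metric.mem_ball_self hη)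
  exact ⟨T, isUnit_of_eq_mul (isUnit_normSec h4) (hL _ h3).2 h5, hT⟩

theorem LegEq.mul_const {c : Option ℂ} {σ : ℂ} {T : Mat n} (h : LegEq n a L c σ T) (T' : Mat n) :
    LegEq n a (fun x => L x * T') c σ (T * T') := by
  filter_upwards [h] with q hq
  rw [hq, mul_assoc]

theorem exists_flatOn_cutPlane (hb : IsGenericBase pos b) (ha : ∀ i < n, ∃ s, a i = pos s) :
    ∃ L, FlatOn n a (cutPlane pos b) L := by
  obtain ⟨L, hL, -⟩ := exists_flatOn (n := n) (a := a) IsGenericBase.isOpen_cutPlane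
    hb.starConvex_cutPlane hb.mem_cutPlane fun x hx i hi => by
      obtain ⟨s, hs⟩ := ha i hi
      rw [hs]
      exact IsGenericBase.ne_of_mem_cutPlane hx s
  exact ⟨L, hL⟩

/-- A flat section normalized along a given leg. -/
theorem exists_flatOn_legEq_one (hb : IsGenericBase pos b) (ha : ∀ i < n, ∃ s, a i = pos s)
    (P : Option S) {σ : ℂ} (hσ : σ ≠ 0) (hσr : σ.im = 0) :
    ∃ L, FlatOn n a (cutPlane pos b) L ∧ LegEq n a L (P.map pos) σ 1 := by
  obtain ⟨L, hL⟩ := exists_flatOn_cutPlane hb ha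
  obtain ⟨T, hT, hLT⟩ := exists_legEq hb hL P hσ hσr
  refine ⟨fun x => L x * Ring.inverse T, hL.mul_const hT.ringInverse, ?_⟩
  have := hLT.mul_const (Ring.inverse T)
  rwa [Ring.mul_inverse_cancel _ hT] at this

omit [Finite S] in
theorem hasTransport_of_legEq (hL : FlatOn n a (cutPlane pos b) L) {c c' : Option ℂ} {σ σ' : ℂ}
    {T T' : Mat n} (hT : IsUnit T) (hLT : LegEq n a L c σ T) (hLT' : LegEq n a L c' σ' T')
    {ζ : ℝ → ℂ} (hζ : IsTangentialCurve pos ζ c σ c' σ')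
    (hζU : ∀ t ∈ Ioo (0 : ℝ) 1, ζ t ∈ cutPlane pos b) :
    HasTransport n a ζ c σ c' σ' (T' * Ring.inverse T) := by
  refine ⟨fun t => L (ζ t) * Ring.inverse T, FlatAlong.comp (L := fun x => L x * Ring.inverse T)
    (fun t ht => hζ.differentiableAt ht)
    fun t ht => ((hL.mul_const hT.ringInverse) _ (hζU t ht)).1, ?_, ?_⟩
  · filter_upwards [eventually_curve_of_leg (p := fun x => L x = normSec n a c σ x * T)
      hζ.source_ne hζ.source hLT] with t ht
    rw [ht, mul_assoc, Ring.mul_inverse_cancel _ hT, mul_one]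
  · filter_upwards [eventually_curve_of_leg (p := fun x => L x = normSec n a c' σ' x * T')
      hζ.target_ne hζ.target hLT'] with t ht
    rw [ht, mul_assoc]

omit [Finite S] in
/-- Comparison of the normalizations along a leg and with respect to the direction of `b`. -/
theorem LegEq.eq_exp_mul (hb : IsGenericBase pos b) {s : S} {σ : ℂ} (hσ : σ ≠ 0) (hσr : σ.im = 0)
    {T T' : Mat n} (hT : ∀ᶠ x in 𝓝 (pos s), (x - pos s) / (b - pos s) ∈ Complex.slitPlane →
      L x = normSec n a (some (pos s)) (b - pos s) x * T)
    (hT' : LegEq n a L (some (pos s)) σ T') :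
    T' = NormedSpace.exp (Complex.log (σ / (b - pos s)) • resMat n a (some (pos s))) * T := by
  have hlim : Tendsto (fun q : ℝ × ℂ => legPoint (some (pos s)) σ q) legFilter (𝓝 (pos s)) := by
    have hc : Continuous fun q : ℝ × ℂ => pos s + σ * q.1 * q.2 := by fun_prop
    have := (hc.tendsto (0, 1)).mono_left legFilter_le
    simpa [legPoint, chart] using this
  obtain ⟨r, hr, η, hη, hbox⟩ := exists_box_of_eventually
    (((hlim.eventually hT).and hT').and
      (eventually_legPoint_mem_normDom (n := n) (a := a) (some (pos s)) hσ))
  have hr2 : (0 : ℝ) < r / 2 := by linarith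
  obtain ⟨⟨h1, h2⟩, h3⟩ := hbox (r / 2) ⟨hr2, by linarith⟩ 1 (Metric.mem_ball_self hη)
  set x := legPoint (some (pos s)) σ (r / 2, 1) with hx
  have hloc : loc (some (pos s)) x = ((r / 2 : ℝ) : ℂ) * σ := by
    rw [hx, loc_legPoint]; ring
  have hdir : σ / (b - pos s) ∈ Complex.slitPlane := mem_slitPlane_of_im_ne (hb.im_div_ne hσ hσr s)
  have hx' : (x - pos s) / (b - pos s) = ((r / 2 : ℝ) : ℂ) * (σ / (b - pos s)) := by
    rw [← mul_div_assoc, ← hloc]; rfl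
  have h4 := h1 (by rw [hx']; exact (ofReal_mul_mem_slitPlane hr2).2 hdir)
  have h5 : normSec n a (some (pos s)) (b - pos s) x = normSec n a (some (pos s)) σ x *
      NormedSpace.exp (Complex.log (σ / (b - pos s)) • resMat n a (some (pos s))) := by
    refine normSec_eq_mul_exp ?_
    rw [hloc, mul_div_assoc, Complex.log_ofReal_mul hr2 (Complex.slitPlane_ne_zero hdir),
      mul_div_cancel_right₀ _ hσ, Complex.ofReal_log hr2.le]
  rw [h2, h5, mul_assoc] at h4
  exact (isUnit_normSec h3).mul_left_cancel h4

theorem log_neg_sub_log {w : ℂ} (h : w.im ≠ 0) :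
    ∃ k : ℤ, Complex.log (-w) - Complex.log w = k * (Real.pi * Complex.I) ∧ k * k = 1 := by
  rcases lt_or_gt_of_ne h with h | h
  · exact ⟨1, by rw [log_neg_of_im_neg h]; push_cast; ring, by norm_num⟩
  · exact ⟨-1, by rw [log_neg_of_im_pos h]; push_cast; ring, by norm_num⟩

end

section

variable {X : Type*} [TopologicalSpace X] [ChartedSpace ℂ X] {S : Type*} [Finite S]
  {C : MarkedCurve X S} {z : AdmissibleCoord C} {b : ℂ}

omit [Finite S] in
theorem TangentialBasePoint.sign_ne_zero (p : TangentialBasePoint S) : ((p.sign : ℤ) : ℂ) ≠ 0 := by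
  exact_mod_cast p.sign.ne_zero

omit [Finite S] in
theorem TangentialBasePoint.sign_im (p : TangentialBasePoint S) : ((p.sign : ℤ) : ℂ).im = 0 :=
  Complex.intCast_im _

theorem exists_tangentialPath_cutPlane (hb : IsGenericBase z.pos b) (p q : TangentialBasePoint S) :
    ∃ γ : TangentialPath z p q, ∀ t ∈ Ioo (0 : ℝ) 1, γ.plane t ∈ cutPlane z.pos b := by
  have hleg : ∀ p : TangentialBasePoint S, ∀ᶠ ρ : ℝ in 𝓝[>] 0,
      chart (z.center p.point) (((p.sign : ℤ) : ℂ) * ρ) ∈ cutPlane z.pos b := by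
    intro p
    have h1 : Tendsto (fun ρ : ℝ => (ρ, (1 : ℂ))) (𝓝[>] 0) legFilter :=
      Tendsto.prodMk tendsto_id tendsto_const_nhds
    filter_upwards [h1.eventually
      (eventually_legPoint_mem_cutPlane hb p.point p.sign_ne_zero p.sign_im)] with ρ hρ
    simpa [legPoint, AdmissibleCoord.center] using hρ
  exact exists_tangentialPath z IsGenericBase.isOpen_cutPlane hb.isPreconnected_cutPlane
    (fun x hx s => IsGenericBase.ne_of_mem_cutPlane hx s) p q (hleg p) (hleg q)

/-- The constant comparing the normalizations at two base points is the transport along a tangential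
path inside the cut plane, so its entries are periods. -/
theorem LegEq.mem_periodMat (hb : IsGenericBase z.pos b) (v : List S)
    {L : ℂ → Mat v.length} (hL : FlatOn v.length (letterPos z.pos v) (cutPlane z.pos b) L)
    {p q : TangentialBasePoint S} {T T' : Mat v.length} (hT : IsUnit T)
    (hLT : LegEq v.length (letterPos z.pos v) L (z.center p.point) ((p.sign : ℤ) : ℂ) T)
    (hLT' : LegEq v.length (letterPos z.pos v) L (z.center q.point) ((q.sign : ℤ) : ℂ) T') :
    T' * Ring.inverse T - 1 ∈ filt v.length 1 ∧ T' * Ring.inverse T ∈ periodMat z v.length 0 := by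
  obtain ⟨γ, hγ⟩ := exists_tangentialPath_cutPlane hb p q
  exact γ.mem_periodMat v (hasTransport_of_legEq hL hT hLT hLT' γ.isTangentialCurve hγ)

omit [Finite S] in
theorem exists_letterPos_eq (pos : S → ℂ) (v : List S) :
    ∀ i < v.length, ∃ s, letterPos pos v i = pos s := fun _ hi => ⟨_, letterPos_eq pos v hi⟩

/-- One is a period of weight one. -/
theorem one_mem_periods_one (z : AdmissibleCoord C) (s : S) : (1 : ℂ) ∈ periods z 1 := by
  obtain ⟨b, hb⟩ := exists_genericBase (pos_injective z)
  set v := [s] with hv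
  obtain ⟨L, hL⟩ := exists_flatOn_cutPlane hb (exists_letterPos_eq z.pos v)
  obtain ⟨T, hT, hLT⟩ := exists_eq_normSec_of_flatOn hb s hL
  let p : TangentialBasePoint S := ⟨some s, 1⟩
  let q : TangentialBasePoint S := ⟨some s, -1⟩
  obtain ⟨Tp, hTp, hLp⟩ := exists_legEq hb hL p.point p.sign_ne_zero p.sign_im
  obtain ⟨Tq, hTq, hLq⟩ := exists_legEq hb hL q.point q.sign_ne_zero q.sign_im
  have hmem := (LegEq.mem_periodMat hb v hL hTp hLp hLq).2
  have ep := hLp.eq_exp_mul hb p.sign_ne_zero p.sign_im hLT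
  have eq := hLq.eq_exp_mul hb q.sign_ne_zero q.sign_im hLT
  have him := hb.im_div_ne one_ne_zero Complex.one_im s
  obtain ⟨k, hk, hkk⟩ := log_neg_sub_log him
  -- Passing from `∂` to `-∂` at `s` inside the cut plane is a half turn, clockwise or not according
  -- to `k = ±1`.
  have e : Tq * Ring.inverse Tp = NormedSpace.exp ((k * (Real.pi * Complex.I) : ℂ) •
      resMat v.length (letterPos z.pos v) (some (z.pos s))) := by
    have e1 : Tq = NormedSpace.exp ((k * (Real.pi * Complex.I) : ℂ) •
      resMat v.length (letterPos z.pos v) (some (z.pos s))) * Tp := by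
      rw [ep, eq, ← mul_assoc, ← exp_add_smul, ← hk]
      congr 4
      simp [p, q, neg_div]
    rw [e1, mul_assoc, Ring.mul_inverse_cancel _ hTp, mul_one]
  have h01 := (hmem 0 (Fin.last _)).1 (by simp)
  rw [e, resMat, ← superdiag_smul, exp_superdiag_apply _ _ _ (Fin.zero_le _)] at h01
  -- The half turn gives the period `k/2`, so `2k` times it is `k * k = 1`.
  have hval : ((2 * k : ℤ) : ℂ) * (k * (Real.pi * Complex.I) * invTwoPiI) = 1 := by
    have h2 : (k : ℂ) * k = 1 := by exact_mod_cast hkk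
    have h3 := mul_invTwoPiI
    push_cast
    linear_combination (2 * (Real.pi : ℂ) * Complex.I * invTwoPiI) * h2 + h3
  have h2 := intCast_mul_mem_periods (2 * k) h01
  have h3 : letterPos z.pos [s] 0 = z.pos s := rfl
  simp [hv, localExp, h3] at h2
  push_cast at hval
  rwa [hval] at h2

variable {v : List S}

/-- The fundamental group acts through the low weight group. -/
theorem exists_isLocalLift_lowWeightGroup (hb : IsGenericBase z.pos b)
    {h1 : (1 : ℂ) ∈ periods z 1}
    (hrun : ∀ i j, i < j → j ≤ v.length → (∀ l ∈ Finset.Ico i j,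
      letterPos z.pos v l = letterPos z.pos v i) →
      (((j - i).factorial : ℂ)⁻¹) ∈ periods z (j - (i + 1)))
    {L : ℂ → Mat v.length} (hL : FlatOn v.length (letterPos z.pos v) (cutPlane z.pos b) L)
    {p : TangentialBasePoint S}
    (hp : LegEq v.length (letterPos z.pos v) L (z.center p.point) ((p.sign : ℤ) : ℂ) 1)
    {x : ℂ} (hx : ∀ s, x ≠ z.pos s) :
    ∃ δ M, IsLocalLift v.length (letterPos z.pos v) (cutPlane z.pos b) L
      (lowWeightGroup z h1 v.length) x δ M := by
  refine exists_isLocalLift hb (exists_letterPos_eq z.pos v) hL (fun s T hT hLT => ?_) hx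
  let q : TangentialBasePoint S := ⟨some s, 1⟩
  obtain ⟨Tq, hTq, hLq⟩ := exists_legEq hb hL q.point q.sign_ne_zero q.sign_im
  have hmem := LegEq.mem_periodMat hb v hL isUnit_one hp hLq
  rw [Ring.inverse_one, mul_one] at hmem
  have eq := hLq.eq_exp_mul hb q.sign_ne_zero q.sign_im hLT
  obtain ⟨g, hg, e⟩ := exists_conj_mem_lowWeightGroup (h1 := h1) hmem.2 hmem.1
    (exp_sub_one_mem_periodMat (c := z.pos s) hrun)
  refine ⟨g, hg, ?_⟩
  rw [e]
  have hTq1 := Ring.inverse_mul_cancel _ hTq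
  set N := resMat v.length (letterPos z.pos v) (some (z.pos s))
  set θ := Complex.log (((q.sign : ℤ) : ℂ) / (b - z.pos s))
  set E := NormedSpace.exp ((2 * Real.pi * Complex.I : ℂ) • N)
  have hcomm : E * NormedSpace.exp (θ • N) = NormedSpace.exp (θ • N) * E := by
    simp only [E]
    rw [← exp_add_smul, ← exp_add_smul, add_comm θ]
  have hTT := Ring.mul_inverse_cancel _ hT
  -- `Tq` and `T` differ by `exp(θ N)`, which commutes with `E`. Hence the conjugate by `T`,
  -- normalized in the direction of `b`, equals the conjugate by the period matrix `Tq`.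
  calc Ring.inverse Tq * E * Tq = Ring.inverse Tq * (E * NormedSpace.exp (θ • N)) * T := by
        nth_rewrite 2 [eq]; simp only [mul_assoc]
    _ = Ring.inverse Tq * (NormedSpace.exp (θ • N) * (T * Ring.inverse T)) * E * T := by
        rw [hcomm, hTT, mul_one]; simp only [mul_assoc]
    _ = Ring.inverse Tq * Tq * Ring.inverse T * E * T := by
        nth_rewrite 3 [eq]; simp only [mul_assoc]
    _ = _ := by rw [hTq1, one_mul]

end

end GenusZero

namespace GenusZero
open scoped Matrix.Norms.Operator

/-! ### Inverse factorials are periods -/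

section

variable {X : Type*} [TopologicalSpace X] [ChartedSpace ℂ X] {S : Type*} [Finite S]
  {C : MarkedCurve X S} {z : AdmissibleCoord C}

/-- The monodromy around infinity expresses an inverse factorial by periods of lower weight. -/
theorem inv_factorial_mem_of_word (h1 : (1 : ℂ) ∈ periods z 1) (r : S) (v : List S)
    (hv : 0 < v.length)
    (hrun : ∀ i j, i < j → j ≤ v.length → (∀ l ∈ Finset.Ico i j,
      letterPos z.pos v l = letterPos z.pos v i) →
      (((j - i).factorial : ℂ)⁻¹) ∈ periods z (j - (i + 1)))
    (ih : ∀ k < v.length, 0 < k → ((k.factorial : ℂ)⁻¹) ∈ periods z (k - 1)) :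
    ((v.length.factorial : ℂ)⁻¹) ∈ periods z (v.length - 1) := by
  obtain ⟨b, hb⟩ := exists_genericBase (pos_injective z)
  let p : TangentialBasePoint S := ⟨some r, 1⟩
  let q : TangentialBasePoint S := ⟨none, 1⟩
  obtain ⟨L, hL, hp⟩ := exists_flatOn_legEq_one hb (exists_letterPos_eq z.pos v) p.point
    p.sign_ne_zero p.sign_im
  obtain ⟨T, hT, hq⟩ := exists_legEq hb hL q.point q.sign_ne_zero q.sign_im
  have hmem := LegEq.mem_periodMat (p := p) (q := q) hb v hL isUnit_one hp hq
  rw [Ring.inverse_one, mul_one] at hmem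
  obtain ⟨g, hg, e⟩ := exists_eq_of_circle hb
    (fun x hx => exists_isLocalLift_lowWeightGroup (h1 := h1) (p := p) hb hrun hL hp hx)
    (T := T) (by simpa [q] using hq)
  rw [resMat, ← superdiag_smul] at e
  simp only [localExp, neg_mul_neg, mul_invTwoPiI] at e
  set E := NormedSpace.exp (superdiag v.length fun _ => (1 : ℂ)) with hE
  have hEapp : ∀ j : Fin (v.length + 1), E 0 j = (((j : ℕ).factorial : ℂ)⁻¹) := by
    intro j
    rw [hE, exp_superdiag_apply _ _ _ (Fin.zero_le j)]
    simp
  -- The right-hand side has a corner entry of weight `length - 1`. The corner of the left-hand side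
  -- is `1/length!` plus the terms `1/k! * T k last` with `0 < k < length`, whose weights `k - 1`
  -- and `length - k` also add up to `length - 1`.
  have e2 : (E - 1) * T = T * ((g : Mat v.length) - 1) := by
    rw [sub_mul, mul_sub, e, one_mul, mul_one]
  have hlow : ((E - 1) * T) 0 (Fin.last _) ∈ periods z (v.length - 1) := by
    rw [e2]
    have := (mul_mem_periodMat hmem.2 (mem_lowWeightGroup.1 hg) 0 (Fin.last _)).1 (by
      simp only [Fin.val_zero, Fin.val_last]; omega)
    simpa using this
  have hlast : (Fin.last v.length) ≠ 0 := by
    intro h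
    have := congrArg Fin.val h
    simp only [Fin.val_last, Fin.val_zero] at this
    omega
  have hTlast : T (Fin.last _) (Fin.last _) = 1 := by
    have := hmem.1 (Fin.last _) (Fin.last _) (by omega)
    rwa [Matrix.sub_apply, Matrix.one_apply_eq, sub_eq_zero] at this
  rw [Matrix.mul_apply, ← Finset.add_sum_erase _ _ (Finset.mem_univ (Fin.last _)), hTlast, mul_one,
    Matrix.sub_apply, Matrix.one_apply_ne hlast.symm, sub_zero, hEapp, Fin.val_last] at hlow
  refine (Submodule.add_mem_iff_left _ (sum_mem fun k hk => ?_)).1 hlow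
  have hk' : (k : ℕ) < v.length := by
    have := Finset.ne_of_mem_erase hk
    have h2 := k.2
    have : (k : ℕ) ≠ v.length := fun h => this (Fin.ext h)
    omega
  rw [Matrix.sub_apply, hEapp]
  rcases eq_or_ne k 0 with rfl | hk0
  · simp
  · have hk1 : 0 < (k : ℕ) := Nat.pos_of_ne_zero fun h => hk0 (Fin.ext h)
    rw [Matrix.one_apply_ne hk0.symm, sub_zero]
    have := mul_mem_periods (ih k hk' hk1) ((hmem.2 k (Fin.last _)).1 (by simp; omega))
    rwa [Fin.val_last, show (k - 1 + (v.length - (k + 0)) : ℕ) = v.length - 1 by omega] at this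

theorem inv_factorial_mem_periods (z : AdmissibleCoord C) (m : ℕ) (hm : 0 < m) :
    ((m.factorial : ℂ)⁻¹) ∈ periods z (m - 1) := by
  obtain ⟨r, q, hr, hq⟩ := z.normalized
  have hr0 : z.pos r = 0 := by
    rw [AdmissibleCoord.pos, AdmissibleCoord.coord, hr, affine_coe]
  have hq1 : z.pos q = 1 := by
    rw [AdmissibleCoord.pos, AdmissibleCoord.coord, hq, affine_coe]
  induction m using Nat.strong_induction_on with
  | _ m ih =>
    -- The two letters sit at `1` and `0`, so for `m > 1` no run has length `m`, and the finite
    -- monodromies need only smaller factorials. For `m = 1` the single run needs `1/1! = 1`, a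
    -- period of weight `0`.
    set v := q :: List.replicate (m - 1) r with hv
    have hlen : v.length = m := by simp [hv]; omega
    rw [← hlen]
    refine inv_factorial_mem_of_word (one_mem_periods_one z r) r v (by omega)
      (fun i j hij hj hl => ?_) fun k hk hk0 => ih k (by omega) hk0
    rcases lt_or_ge (j - i) m with h | h
    · exact ih (j - i) h (by omega)
    · have hi : i = 0 := by omega
      have hj : j = m := by omega
      subst hi
      subst hj
      rcases Nat.lt_or_ge 1 j with h2 | h2
      · exfalso
        have h3 := hl 1 (by simpa using h2)
        rw [letterPos_eq _ _ (by omega), letterPos_eq _ _ (by omega)] at h3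
        simp [hv, hr0, hq1] at h3
      · have hj1 : j = 1 := by omega
        subst hj1
        simpa using one_mem_periods_zero

end

end GenusZero

end

/-! ### Conclusion for closed loops -/

theorem mainTheorem10 {S : Type*} [Fintype S] (hS : 2 ≤ Fintype.card S)
    {X : Type*} [TopologicalSpace X] [ChartedSpace ℂ X] [IsManifold 𝓘(ℂ, ℂ) ω X]
    (C : GenusZero.MarkedCurve X S) (z : GenusZero.AdmissibleCoord C)
    (p : GenusZero.TangentialBasePoint S) (γ : GenusZero.TangentialPath z p p)
    (n : ℕ) (hn : 1 ≤ n) (v : List S) (hv : v.length = n) :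
    GenusZero.HasRegLim (γ.truncInt v) (γ.integral (Finsupp.single v 1)) ∧
      γ.integral (Finsupp.single v 1) ∈ GenusZero.periods z (n - 1) := by
  subst hv
  obtain ⟨Φ, hΦ⟩ := γ.isTangentialCurve.exists_hasTransport v
  have hreg : GenusZero.HasRegLim (γ.truncInt v) (Φ 0 (Fin.last _)) := by
    have := γ.isTangentialCurve.hasRegLim v hΦ (Fin.zero_le (Fin.last _))
    simp only [Fin.val_zero, Fin.val_last, GenusZero.slice_zero_length] at this
    exact this
  have hval : γ.integral (Finsupp.single v 1) = Φ 0 (Fin.last _) := by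
    rw [γ.integral_single]
    exact GenusZero.regLim_eq hreg
  rw [hval]
  refine ⟨hreg, ?_⟩
  obtain ⟨r, -, -, -⟩ := z.normalized
  have h1 := GenusZero.one_mem_periods_one z r
  obtain ⟨b, hb⟩ := GenusZero.exists_genericBase (GenusZero.pos_injective z)
  obtain ⟨L, hL, hp⟩ := GenusZero.exists_flatOn_legEq_one hb
    (GenusZero.exists_letterPos_eq z.pos v) p.point p.sign_ne_zero p.sign_im
  have hrun : ∀ i j, i < j → j ≤ v.length → (∀ l ∈ Finset.Ico i j,
      GenusZero.letterPos z.pos v l = GenusZero.letterPos z.pos v i) →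
      (((j - i).factorial : ℂ)⁻¹) ∈ GenusZero.periods z (j - (i + 1)) := fun i j hij _ _ => by
    rw [← Nat.sub_sub]
    exact GenusZero.inv_factorial_mem_periods z (j - i) (by omega)
  -- The section `L` is normalized at the base point of the loop itself, so the leg constant is `1`
  -- and the relation becomes `1 = Φ * g`. Thus `Φ` is in the low weight group, and its corner entry
  -- is the integral of the whole word.
  obtain ⟨g, hg, e⟩ := GenusZero.exists_eq_of_hasTransport hb
    (fun x hx => GenusZero.exists_isLocalLift_lowWeightGroup (h1 := h1) hb hrun hL hp hx)
    p.sign_im hp γ.isTangentialCurve hΦ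
  rw [mul_one] at e
  have hΦg : Φ = ((g⁻¹ : (GenusZero.Mat v.length)ˣ) : GenusZero.Mat v.length) := by
    rw [← one_mul ((g⁻¹ : (GenusZero.Mat v.length)ˣ) : GenusZero.Mat v.length), e, mul_assoc,
      Units.mul_inv, mul_one]
  have hmem := GenusZero.mem_lowWeightGroup.1 (Subgroup.inv_mem _ hg)
  rw [← hΦg] at hmem
  have hne : (0 : Fin (v.length + 1)) ≠ Fin.last _ := fun h => by
    have := congrArg Fin.val h
    simp only [Fin.val_last, Fin.val_zero] at this
    omega
  have := (hmem 0 (Fin.last _)).1 (by simpa using hn)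
  rw [Matrix.sub_apply, Matrix.one_apply_ne hne, sub_zero] at this
  simpa using this
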